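/- Let $G$ be a finite simple graph on $n$ vertices, $\varepsilon>0$, $0<p<1$, and let $k\le\ell$ be positive integers. $G$ is called $(\varepsilon,p,k,\ell)$-pseudorandom if $\bigl|e(X,Y)-p|X||Y|\bigr|<\varepsilon p|X||Y|$ for all disjoint $X,Y\subseteq V(G)$ with $|X|\ge\varepsilon p^{k}n$ and $|Y|\ge\varepsilon p^{\ell}n$, where $e(X,Y)$ is the number of edges of $G$ with one end in $X$ and the other in $Y$. The $k$th power of a graph $H$ is the graph on $V(H)$ in which two distinct vertices are adjacent if and only if their distance in $H$ is at most $k$; the square is the second power. Theorem 1.2. For every integer $k\ge2$ and every $\beta>0$ there is an $\varepsilon>0$ such that the following holds for every $0<p<1$, every $n\ge3$ and every graph $G$ on $n$ vertices with minimum degree at least $\beta pn$. (a) If $G$ is $(\varepsilon,p,1,2)$-pseudorandom, then $G$ contains the square of a Hamilton cycle. (b) If $G$ is $(\varepsilon,p,k-1,2k-1)$-pseudorandom and $(\varepsilon,p,k,k+1)$-pseudorandom, then $G$ contains the $k$th power of a Hamilton cycle. (That is, $G$ contains the corresponding power of some cycle on all $n$ vertices as a subgraph.) -/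

import Mathlib

/-- An `n`-vertex graph `G` (with `n = Fintype.card V`) is `(ε, p, k, l)`-pseudorandom if
`|e(X, Y) - p |X| |Y|| < ε p |X| |Y|` for all disjoint vertex sets `X`, `Y` with
`|X| ≥ ε p ^ k n` and `|Y| ≥ ε p ^ l n`. Here `e(X, Y)` is the number of edges with one end in `X`
and the other in `Y`; as `X` and `Y` are disjoint, it is the number of pairs in
`G.interedges X Y`. -/
def IsPseudorandom {V : Type*} [Fintype V] (G : SimpleGraph V) [DecidableRel G.Adj]
    (ε p : ℝ) (k l : ℕ) : Prop :=
  ∀ X Y : Finset V, Disjoint X Y →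
    ε * p ^ k * (Fintype.card V : ℝ) ≤ (X.card : ℝ) →
    ε * p ^ l * (Fintype.card V : ℝ) ≤ (Y.card : ℝ) →
    |((G.interedges X Y).card : ℝ) - p * (X.card : ℝ) * (Y.card : ℝ)|
      < ε * p * (X.card : ℝ) * (Y.card : ℝ)

/-- The `k`th power of a graph `H`: distinct vertices are adjacent iff their distance in `H` is at
most `k` (the extended distance, so vertices in different components are never adjacent). -/
def graphPower {V : Type*} (H : SimpleGraph V) (k : ℕ) : SimpleGraph V where
  Adj u v := u ≠ v ∧ H.edist u v ≤ (k : ℕ∞)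
  symm := ⟨fun u v h => ⟨h.1.symm, by rw [SimpleGraph.edist_comm]; exact h.2⟩⟩
  loopless := ⟨fun _ h => h.1 rfl⟩

/-- `G` contains the `k`th power of a Hamilton cycle: there is a copy in `G` of the `k`th power of
the cycle with as many vertices as `G` (a copy is an injective homomorphism, so this copy is
spanning). Meant for graphs with at least three vertices. -/
def ContainsHamiltonCyclePower {V : Type*} [Fintype V] (G : SimpleGraph V) (k : ℕ) : Prop :=
  (graphPower (SimpleGraph.cycleGraph (Fintype.card V)) k).IsContained G

/-! The proof is an absorption argument. Pseudorandomness enters in two one-sided forms: few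
vertices are poor for a given large set `Y`, meaning that they have fewer than p|Y|/8 neighbours in
it (`Dense.lowerReg`), and large disjoint sets span at most twice the expected number of edges
(`Dense.upperReg`).

Two local tools follow. `Conn`: two path ends whose common neighbourhoods in a linear-sized set U
have the expected order are joined through boundedly many vertices of U. `Gad`: for a vertex v with
order pn neighbours in U there are two short paths with the same ends, one on vertices of U, the
other on these vertices and v.

Globally, V is split into a large part A 0 and small linear parts A 1, A 2, and one path is grown.
It covers the vertices poor for A 2; then gadgets taken from A 0 turn almost all of A 1 ∪ A 2 into a
reservoir R, any subset of which the path may include; then almost all of A 0 is covered by its own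
vertices. Reservoir vertices are optional, so they can be spent as building material: R ∩ A 1 serves
to cover the leftover down to ε p^k n vertices, and R ∩ A 2, still nearly all of A 2, serves for the
last ones, none of which is poor for A 2. The path is closed through R ∩ A 2 and absorbs the rest of
R.

For k-th powers (part (b)), a gadget is a path of 2k vertices inside N(v) with v inserted in the
middle. For connections, a tree of cliques is grown at each end; almost every ordered k-tuple can
follow some branch, and counting cliques yields one that suits both ends
(`exists_clique_of_allBut`).

For squares under the weaker assumption (a), that gadget would choose vertices from sets of order
p^3 n, smaller than the exceptional sets. Instead a closed strip of triangles through v is traversed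
in two ways (`gad_square`), and connections meet in a common middle vertex (`conn_square`).

If p is so small that single vertices count as large sets, G is either complete or so dense that the
same argument applies with p = 1 (`Dense.almost_complete`). -/

namespace HamPow
open scoped Classical

/-! ### Powers of paths, encoded as lists. -/

/-- Every vertex of the list is adjacent to each of the `k` vertices following it. -/
def KAdj {V : Type*} (G : SimpleGraph V) (k : ℕ) : List V → Prop
  | [] => True
  | z :: l => (∀ x ∈ l.take k, G.Adj z x) ∧ KAdj G k l

section KAdj

variable {V : Type*} {G : SimpleGraph V} {k : ℕ}

/-- The `k` vertices following a member of `A` all lie in `A ++ B` once `B` has `k` members, so they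
do not see `C`. -/
theorem KAdj.glue {A B C : List V} (hB : k ≤ B.length) (h1 : KAdj G k (A ++ B))
    (h2 : KAdj G k (B ++ C)) : KAdj G k (A ++ (B ++ C)) := by
  induction A with
  | nil => simpa using h2
  | cons z A ih =>
    simp only [List.cons_append, KAdj] at h1 ⊢
    refine ⟨?_, ih h1.2⟩
    have : (A ++ (B ++ C)).take k = (A ++ B).take k := by
      rw [← List.append_assoc, List.take_append_of_le_length]
      simp; omega
    rw [this]; exact h1.1

theorem KAdj.left {A B : List V} (h : KAdj G k (A ++ B)) : KAdj G k A := by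
  induction A with
  | nil => trivial
  | cons z A ih =>
    refine ⟨fun x hx => h.1 x ?_, ih h.2⟩
    exact (List.take_append (l₁ := A) (l₂ := B) (i := k)) ▸ List.mem_append_left _ hx

theorem KAdj.take {l : List V} (h : KAdj G k l) (i : ℕ) : KAdj G k (l.take i) := by
  rw [← List.take_append_drop i l] at h; exact h.left

theorem kadj_iff {l : List V} : KAdj G k l ↔
    ∀ (i j : ℕ) (hij : i < j) (_ : j ≤ i + k) (hj : j < l.length), G.Adj l[i] l[j] := by
  induction l with
  | nil => simp [KAdj]
  | cons z l ih =>
    simp only [KAdj, ih]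
    constructor
    · rintro ⟨h1, h2⟩ i j hij hjk hj
      obtain ⟨j, rfl⟩ : ∃ j', j = j' + 1 := ⟨j - 1, by omega⟩
      simp only [List.length_cons] at hj
      cases i with
      | zero =>
        simp only [List.getElem_cons_zero, List.getElem_cons_succ]
        refine h1 _ ?_
        rw [List.mem_take_iff_getElem]
        exact ⟨j, by omega, rfl⟩
      | succ i =>
        simp only [List.getElem_cons_succ]
        exact h2 i j (by omega) (by omega) (by omega)
    · intro h
      refine ⟨fun x hx => ?_, fun i j hij hjk hj => ?_⟩
      · rw [List.mem_take_iff_getElem] at hx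
        obtain ⟨j, hj, rfl⟩ := hx
        have := h 0 (j + 1) (by omega) (by omega) (by simp; omega)
        simpa using this
      · have := h (i + 1) (j + 1) (by omega) (by omega) (by simp; omega)
        simpa using this

theorem KAdj.reverse {l : List V} (h : KAdj G k l) : KAdj G k l.reverse := by
  rw [kadj_iff] at h ⊢
  intro i j hij hjk hj
  simp only [List.length_reverse] at hj
  simp only [List.getElem_reverse]
  exact (h _ _ (by omega) (by omega) (by omega)).symm

/-- Inserting a vertex only moves the others apart, so the old conditions get weaker. This is how a
vertex is absorbed in the case of k-th powers. -/
theorem KAdj.insert_mid {A B : List V} {r : V} (h : KAdj G k (A ++ B))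
    (hr : ∀ x ∈ A ++ B, G.Adj r x) : KAdj G k (A ++ r :: B) := by
  induction A with
  | nil =>
    refine ⟨fun x hx => hr x (by simpa using List.mem_of_mem_take hx), by simpa using h⟩
  | cons z A ih =>
    refine ⟨fun x hx => ?_, ih h.2 fun x hx => hr x (by simp at hx ⊢; tauto)⟩
    by_cases hxr : x = r
    · subst hxr; exact (hr z (by simp)).symm
    · refine h.1 x ?_
      change x ∈ (A ++ r :: B).take k at hx
      change x ∈ (A ++ B).take k
      rw [List.take_append] at hx ⊢
      rw [List.mem_append] at hx ⊢
      rcases hx with hx | hx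
      · exact Or.inl hx
      · right
        rw [List.mem_take_iff_getElem] at hx ⊢
        obtain ⟨j, hj, rfl⟩ := hx
        cases j with
        | zero => simp at hxr
        | succ j =>
          simp only [List.length_cons] at hj
          exact ⟨j, by omega, by simp⟩

end KAdj

/-- There is a `k`-th power of a path on the vertex set `S`, whose first and last `k` vertices,
listed from the outside inwards, are `f` and `e`. -/
def PathOn {V : Type*} (G : SimpleGraph V) (k : ℕ) (f e : List V) (S : Finset V) : Prop :=
  ∃ l : List V, KAdj G k l ∧ l.Nodup ∧ k ≤ l.length ∧ l.take k = f ∧ l.reverse.take k = e ∧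
    l.toFinset = S

section PathOn

variable {V : Type*} {G : SimpleGraph V} {k : ℕ}

theorem take_reverse_eq {l : List V} : (l.reverse.take k).reverse = l.drop (l.length - k) := by
  rw [List.take_reverse, List.reverse_reverse]

theorem PathOn.length_left {f e : List V} {S : Finset V} (h : PathOn G k f e S) :
    f.length = k := by
  obtain ⟨l, -, -, h1, h2, -, -⟩ := h
  rw [← h2]; simpa using h1

theorem PathOn.length_right {f e : List V} {S : Finset V} (h : PathOn G k f e S) :
    e.length = k := by
  obtain ⟨l, -, -, h1, -, h2, -⟩ := h
  rw [← h2]; simpa using h1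

/-- Two paths joined by a connecting path form a path. -/
theorem PathOn.append {f e f' e' m : List V} {S S' : Finset V} (h : PathOn G k f e S)
    (h' : PathOn G k f' e' S') (hm : KAdj G k (e.reverse ++ m ++ f')) (hmn : m.Nodup)
    (hSS' : Disjoint S S') (hmS : ∀ x ∈ m, x ∉ S) (hmS' : ∀ x ∈ m, x ∉ S') :
    PathOn G k f e' (S ∪ m.toFinset ∪ S') := by
  obtain ⟨l, h1, h2, h3, rfl, rfl, rfl⟩ := h
  obtain ⟨l', h1', h2', h3', rfl, rfl, rfl⟩ := h'
  rw [take_reverse_eq] at hm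
  set B := l.drop (l.length - k) with hB
  have hBl : B.length = k := by simp [hB]; omega
  set A := l.take (l.length - k)
  have hl : l = A ++ B := (List.take_append_drop _ l).symm
  set F := l'.take k
  have hFl : F.length = k := by simp [F, h3']
  set C := l'.drop k
  have hl' : l' = F ++ C := (List.take_append_drop _ l').symm
  have e1 : KAdj G k (A ++ (B ++ (m ++ F))) := by
    refine KAdj.glue hBl.ge (hl ▸ h1) ?_
    simpa using hm
  have e2 : KAdj G k ((A ++ B ++ m) ++ (F ++ C)) := by
    refine KAdj.glue hFl.ge ?_ (hl' ▸ h1')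
    simpa using e1
  have e3 : (A ++ B ++ m) ++ (F ++ C) = l ++ m ++ l' := by rw [← hl, ← hl']
  rw [e3] at e2
  refine ⟨l ++ m ++ l', e2, ?_, by simp; omega, ?_, ?_, ?_⟩
  · rw [List.nodup_append', List.nodup_append']
    refine ⟨⟨h2, hmn, ?_⟩, h2', ?_⟩
    · intro x hx hxm; exact hmS x hxm (by simpa using hx)
    · intro x hx hxl'
      rcases List.mem_append.1 hx with hx | hx
      · exact (Finset.disjoint_left.1 hSS') (by simpa using hx) (by simpa using hxl')
      · exact hmS' x hx (by simpa using hxl')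
  · rw [List.append_assoc, List.take_append_of_le_length h3]
  · rw [List.reverse_append, List.take_append_of_le_length (by simpa using h3')]
  · simp

theorem PathOn.of_kadj {l : List V} (h : KAdj G k l) (hn : l.Nodup) (hk : k ≤ l.length) :
    PathOn G k (l.take k) (l.reverse.take k) l.toFinset :=
  ⟨l, h, hn, hk, rfl, rfl, rfl⟩

end PathOn

/-! ### From cyclic lists to powers of Hamilton cycles. -/

section Cycle

variable {V : Type*} [Fintype V] {G : SimpleGraph V} {k : ℕ}

/-- Each edge of a walk shifts the residue by ±1, so a walk of length at most `k` shifts it by some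
integer `e` with |e| ≤ k; the sign of `e` decides the alternative. -/
theorem cycleGraph_edist_le {n : ℕ} (u v : Fin (n + 2)) {k : ℕ}
    (h : (SimpleGraph.cycleGraph (n + 2)).edist u v ≤ (k : ℕ∞)) :
    ∃ d ≤ k, (v : ℕ) = (u + d) % (n + 2) ∨ (u : ℕ) = (v + d) % (n + 2) := by
  have hw : ∀ (d : ℕ) (u v : Fin (n + 2)) (w : (SimpleGraph.cycleGraph (n + 2)).Walk u v),
      w.length = d → ∃ e : ℤ, |e| ≤ d ∧ ((v : ℕ) : ℤ) ≡ (u : ℕ) + e [ZMOD ((n + 2 : ℕ) : ℤ)] := by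
    intro d
    induction d with
    | zero =>
      intro u v w hw
      have := SimpleGraph.Walk.eq_of_length_eq_zero hw
      subst this
      exact ⟨0, by simp, by simp⟩
    | succ d ih =>
      intro u v w hw
      cases w with
      | nil => simp at hw
      | cons hadj w =>
        rename_i x
        simp only [SimpleGraph.Walk.length_cons, Nat.add_right_cancel_iff] at hw
        obtain ⟨e, he, hev⟩ := ih _ _ w hw
        have hx : ∃ s : ℤ, |s| ≤ 1 ∧ ((x : ℕ) : ℤ) ≡ (u : ℕ) + s [ZMOD ((n + 2 : ℕ) : ℤ)] := by
          rw [SimpleGraph.cycleGraph_adj] at hadj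
          rcases hadj with h | h
          · refine ⟨-1, by simp, ?_⟩
            have : u = x + 1 := sub_eq_iff_eq_add'.1 h
            rw [this, Fin.val_add]
            have h1 : (((1 : Fin (n + 2)) : ℕ)) = 1 := by simp
            rw [h1]
            push_cast
            have := (Int.mod_modEq (((x : ℕ) : ℤ) + 1) ((n : ℤ) + 2)).symm
            have := this.add_right (-1)
            simpa using this
          · refine ⟨1, by simp, ?_⟩
            have : x = u + 1 := sub_eq_iff_eq_add'.1 h
            rw [this, Fin.val_add]
            have h1 : (((1 : Fin (n + 2)) : ℕ)) = 1 := by simp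
            rw [h1]
            push_cast
            exact Int.mod_modEq _ _
        obtain ⟨s, hs, hxs⟩ := hx
        refine ⟨s + e, ?_, ?_⟩
        · calc |s + e| ≤ |s| + |e| := abs_add_le _ _
            _ ≤ 1 + d := add_le_add hs he
            _ = ((d + 1 : ℕ) : ℤ) := by push_cast; ring
        · rw [← add_assoc]
          exact hev.trans (hxs.add_right e)
  have hne : (SimpleGraph.cycleGraph (n + 2)).edist u v ≠ ⊤ :=
    ne_top_of_le_ne_top (by simp) h
  obtain ⟨w, hwl⟩ := SimpleGraph.exists_walk_of_edist_ne_top hne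
  rw [← hwl] at h
  obtain ⟨e, he, hev⟩ := hw _ u v w rfl
  have hlk : w.length ≤ k := by exact_mod_cast h
  refine ⟨e.natAbs, by have := Int.natCast_natAbs e; omega, ?_⟩
  rcases Int.natAbs_eq e with hee | hee
  · left
    rw [hee] at hev
    have : (v : ℕ) ≡ u + e.natAbs [MOD (n + 2)] := by
      rw [← Int.natCast_modEq_iff]; push_cast at hev ⊢; simpa using hev
    have h2 := this
    unfold Nat.ModEq at h2
    rwa [Nat.mod_eq_of_lt v.2] at h2
  · right
    have h3 : ((u : ℕ) : ℤ) ≡ (v : ℕ) + e.natAbs [ZMOD ((n + 2 : ℕ) : ℤ)] := by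
      have := (hev.add_right (e.natAbs : ℤ)).symm
      rw [hee] at this
      simpa using this
    have : (u : ℕ) ≡ v + e.natAbs [MOD (n + 2)] := by
      rw [← Int.natCast_modEq_iff]; push_cast at h3 ⊢; simpa using h3
    have h2 := this
    unfold Nat.ModEq at h2
    rwa [Nat.mod_eq_of_lt u.2] at h2

/-- A list of all vertices that is cyclically `k`-adjacent gives a `k`-th power of a Hamilton
cycle. -/
theorem containsHamiltonCyclePower_of_list {L : List V} (h3 : 3 ≤ Fintype.card V)
    (hL : L.Nodup) (hlen : L.length = Fintype.card V) (hkL : k ≤ L.length)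
    (h : KAdj G k (L ++ L.take k)) : ContainsHamiltonCyclePower G k := by
  obtain ⟨n, hn⟩ : ∃ n, Fintype.card V = n + 2 := ⟨Fintype.card V - 2, by omega⟩
  unfold ContainsHamiltonCyclePower
  rw [hn]
  rw [hn] at hlen
  rw [kadj_iff] at h
  have key : ∀ (i j d : ℕ) (hi : i < L.length) (hj : j < L.length), d ≤ k → i ≠ j →
      j = (i + d) % (n + 2) → G.Adj L[i] L[j] := by
    intro i j d hi hj hd hij hjd
    have hd0 : d ≠ 0 := by
      rintro rfl
      rw [add_zero, Nat.mod_eq_of_lt (by omega)] at hjd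
      exact hij hjd.symm
    have hlen2 : (L ++ L.take k).length = n + 2 + k := by simp; omega
    have := h i (i + d) (by omega) (by omega) (by omega)
    rw [List.getElem_append_left hi] at this
    -- If the position wraps around, it falls into the appended copy `L.take k`, at index i + d - (n
    -- + 2).
    by_cases hc : i + d < n + 2
    · rw [Nat.mod_eq_of_lt hc] at hjd
      subst hjd
      rwa [List.getElem_append_left hj] at this
    · have h1 : (i + d) % (n + 2) = i + d - (n + 2) := by
        rw [Nat.mod_eq_sub_mod (by omega), Nat.mod_eq_of_lt (by omega)]
      rw [h1] at hjd
      rw [List.getElem_append_right (by omega), List.getElem_take] at this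
      simp only [hlen] at this
      subst hjd
      exact this
  refine ⟨⟨⟨fun i => L[(i : ℕ)]'(by rw [hlen]; exact i.2), ?_⟩, ?_⟩⟩
  · intro a b hab
    obtain ⟨hne, hd⟩ := hab
    obtain ⟨d, hdk, hd | hd⟩ := cycleGraph_edist_le a b hd
    · exact key _ _ d _ _ hdk (fun h => hne (Fin.ext h)) hd
    · exact (key _ _ d _ _ hdk (fun h => hne (Fin.ext h.symm)) hd).symm
  · intro a b hab
    have := (List.Nodup.getElem_inj_iff hL).1 hab
    exact Fin.ext this

theorem PathOn.close {f e m : List V} {S : Finset V} (h3 : 3 ≤ Fintype.card V)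
    (h : PathOn G k f e S) (hm : KAdj G k (e.reverse ++ m ++ f)) (hmn : m.Nodup)
    (hmS : ∀ x ∈ m, x ∉ S) (hS : ∀ x, x ∈ S ∨ x ∈ m) : ContainsHamiltonCyclePower G k := by
  obtain ⟨l, h1, h2, hl3, rfl, rfl, rfl⟩ := h
  rw [take_reverse_eq] at hm
  have hnd : (l ++ m).Nodup := by
    rw [List.nodup_append']
    exact ⟨h2, hmn, fun x hx hxm => hmS x hxm (by simpa using hx)⟩
  refine containsHamiltonCyclePower_of_list (L := l ++ m) h3 hnd ?_ (by simp; omega) ?_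
  · rw [← List.toFinset_card_of_nodup hnd, ← Finset.card_univ]
    congr 1
    ext x
    have := hS x
    simpa using this
  · rw [List.take_append_of_le_length hl3]
    have := KAdj.glue (k := k) (G := G) (A := l.take (l.length - k)) (B := l.drop (l.length - k))
      (C := m ++ l.take k) (by simp; omega) (by simpa using h1) (by simpa using hm)
    rw [← List.append_assoc, List.take_append_drop] at this
    simpa using this

theorem containsHamiltonCyclePower_of_complete (h : ∀ u v : V, u ≠ v → G.Adj u v) :
    ContainsHamiltonCyclePower G k := by
  refine ⟨⟨⟨(Fintype.equivFin V).symm, ?_⟩, (Fintype.equivFin V).symm.injective⟩⟩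
  intro a b hab
  exact h _ _ fun h => hab.1 ((Fintype.equivFin V).symm.injective h)

end Cycle

end HamPow

/-! ### One-sided regularity, typical ends, and the two local tools. -/

namespace HamPow
open scoped Classical
open Finset

/-- The vertices of `U` adjacent to all members of the list `s`. -/
noncomputable def nb {V : Type*} (G : SimpleGraph V) (s : List V) (U : Finset V) : Finset V :=
  {v ∈ U | ∀ x ∈ s, G.Adj x v}

section nb

variable {V : Type*} {G : SimpleGraph V} {s : List V} {U W D : Finset V} {v z : V}

@[simp] theorem mem_nb : v ∈ nb G s U ↔ v ∈ U ∧ ∀ x ∈ s, G.Adj x v := by simp [nb]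

theorem mem_nb_singleton : v ∈ nb G [z] U ↔ v ∈ U ∧ G.Adj z v := by simp

theorem nb_subset : nb G s U ⊆ U := filter_subset _ _

@[simp] theorem nb_nil : nb G [] U = U := by ext; simp

theorem nb_cons : nb G (z :: s) U = nb G [z] (nb G s U) := by
  ext; simp; tauto

theorem nb_mono (h : U ⊆ W) : nb G s U ⊆ nb G s W := filter_subset_filter _ h

theorem card_nb_sdiff : #(nb G s U) ≤ #(nb G s (U \ D)) + #D := by
  calc #(nb G s U) ≤ #(nb G s (U \ D) ∪ D) := card_le_card fun x hx => by
        by_cases h : x ∈ D <;> simp_all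
    _ ≤ _ := card_union_le _ _

end nb

/-- The vertices with unexpectedly few neighbours in `Y`. -/
noncomputable def poor {V : Type*} [Fintype V] (G : SimpleGraph V) (p : ℝ) (Y : Finset V) :
    Finset V :=
  {v : V | (#(nb G [v] Y) : ℝ) < p / 8 * #Y}

/-- Few vertices are poor with respect to a set of size at least `ε p ^ j n`. -/
def LowerReg {V : Type*} [Fintype V] (G : SimpleGraph V) (ε p : ℝ) (i j : ℕ) : Prop :=
  ∀ Y : Finset V, ε * p ^ j * (Fintype.card V : ℝ) ≤ #Y →
    (#(poor G p Y) : ℝ) ≤ ε * p ^ i * (Fintype.card V : ℝ)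

/-- The number of edges between large disjoint sets is at most twice the expected one. -/
def UpperReg {V : Type*} [Fintype V] (G : SimpleGraph V) (ε p : ℝ) (i j : ℕ) : Prop :=
  ∀ X Y : Finset V, Disjoint X Y → ε * p ^ i * (Fintype.card V : ℝ) ≤ #X →
    ε * p ^ j * (Fintype.card V : ℝ) ≤ #Y → ∑ x ∈ X, (#(nb G [x] Y) : ℝ) ≤ 2 * p * #X * #Y

/-- The common neighbourhoods in `U` of the initial segments of `e` have the expected size, up to
the factor `c`. -/
def Typ {V : Type*} [Fintype V] (G : SimpleGraph V) (p : ℝ) (k : ℕ) (c : ℝ) (e : List V)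
    (U : Finset V) : Prop :=
  ∀ j ≤ k, c * p ^ j * (Fintype.card V : ℝ) ≤ #(nb G (e.take j) U)

/-- Ends of paths that are typical for a large set can be connected through this set. -/
def Conn {V : Type*} [Fintype V] (G : SimpleGraph V) (k : ℕ) (p c γ : ℝ) (K : ℕ) : Prop :=
  ∀ (U : Finset V) (e f : List V), γ * (Fintype.card V : ℝ) ≤ #U → e.length = k → f.length = k →
    KAdj G k e → KAdj G k f → Typ G p k c e U → Typ G p k c f U →
    ∃ m : List V, (∀ x ∈ m, x ∈ U) ∧ m.Nodup ∧ m.length ≤ K ∧ KAdj G k (e.reverse ++ m ++ f)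

/-- A vertex with many neighbours in a large set `U` can be absorbed by a short path in `U`. -/
def Gad {V : Type*} [Fintype V] (G : SimpleGraph V) (k : ℕ) (p cv γ c : ℝ) (K : ℕ) : Prop :=
  ∀ (U : Finset V) (v : V) (𝒯 : Finset (Finset V)), γ * (Fintype.card V : ℝ) ≤ #U → v ∉ U →
    cv * p * (Fintype.card V : ℝ) ≤ #(nb G [v] U) → #𝒯 ≤ 3 →
    (∀ T ∈ 𝒯, γ * (Fintype.card V : ℝ) ≤ #T) →
    ∃ l l' : List V, KAdj G k l ∧ KAdj G k l' ∧ l.Nodup ∧ l'.Nodup ∧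
      l'.toFinset = insert v l.toFinset ∧ (∀ x ∈ l, x ∈ U) ∧ k ≤ l.length ∧ l.length ≤ K ∧
      l'.take k = l.take k ∧ l'.reverse.take k = l.reverse.take k ∧
      Typ G p k c (l.take k) U ∧ ∀ T ∈ 𝒯, Typ G p k c (l.reverse.take k) T

section

variable {V : Type*} [Fintype V] {G : SimpleGraph V} {ε p : ℝ} {i j i' j' : ℕ}

theorem mem_poor {Y : Finset V} {v : V} :
    v ∈ poor G p Y ↔ (#(nb G [v] Y) : ℝ) < p / 8 * #Y := by simp [poor]

theorem notMem_poor {Y : Finset V} {v : V} :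
    v ∉ poor G p Y ↔ p / 8 * #Y ≤ (#(nb G [v] Y) : ℝ) := by simp [poor]

theorem nonempty_of_notMem_poor {Y : Finset V} {v : V} (h : v ∉ poor G p Y) (hp : 0 < p)
    (hY : (0 : ℝ) < #Y) : ∃ y ∈ Y, G.Adj v y := by
  rw [notMem_poor] at h
  have : 0 < #(nb G [v] Y) := by
    have : (0 : ℝ) < #(nb G [v] Y) := lt_of_lt_of_le (by positivity) h
    exact_mod_cast this
  obtain ⟨y, hy⟩ := card_pos.1 this
  exact ⟨y, by simpa using hy⟩

theorem scale_le (hp : 0 ≤ p) (hp1 : p ≤ 1) (hε : 0 ≤ ε) (h : i' ≤ i) :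
    ε * p ^ i * (Fintype.card V : ℝ) ≤ ε * p ^ i' * (Fintype.card V : ℝ) := by
  have := pow_le_pow_of_le_one hp hp1 h
  gcongr

theorem LowerReg.mono (h : LowerReg G ε p i j) (hp : 0 ≤ p) (hp1 : p ≤ 1) (hε : 0 ≤ ε)
    (hi : i' ≤ i) (hj : j' ≤ j) : LowerReg G ε p i' j' := fun Y hY =>
  (h Y ((scale_le hp hp1 hε hj).trans hY)).trans (scale_le hp hp1 hε hi)

theorem LowerReg.card_biUnion (h : LowerReg G ε p i j) (𝒴 : Finset (Finset V))
    (h𝒴 : ∀ Y ∈ 𝒴, ε * p ^ j * (Fintype.card V : ℝ) ≤ #Y) :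
    (#(𝒴.biUnion (poor G p)) : ℝ) ≤ #𝒴 * (ε * p ^ i * (Fintype.card V : ℝ)) := by
  calc (#(𝒴.biUnion (poor G p)) : ℝ) ≤ ∑ Y ∈ 𝒴, (#(poor G p Y) : ℝ) := by
        exact_mod_cast card_biUnion_le
    _ ≤ ∑ Y ∈ 𝒴, ε * p ^ i * (Fintype.card V : ℝ) := sum_le_sum fun Y hY => h Y (h𝒴 Y hY)
    _ = _ := by rw [sum_const, nsmul_eq_mul]

/-- If each `d ∈ D` has few exceptional vertices, then all but few vertices have many neighbours
in `D` for which they are not exceptional. -/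
theorem LowerReg.card_exceptional (h : LowerReg G ε p i j) (hp : 0 < p) {D : Finset V}
    (hD : ε * p ^ j * (Fintype.card V : ℝ) ≤ #D) (hD0 : (0 : ℝ) < #D) {B : V → Finset V} {b : ℝ}
    (hB : ∀ d ∈ D, (#(B d) : ℝ) ≤ b) :
    (#{u : V | (#{d ∈ D | G.Adj u d ∧ u ∉ B d} : ℝ) < p / 16 * #D} : ℝ) ≤
      ε * p ^ i * (Fintype.card V : ℝ) + 16 * b / p := by
  -- By double counting, at most 16b/p vertices are exceptional for a p/16 fraction of `D`. Any
  -- other vertex that is not poor for `D` has p|D|/8 neighbours there and keeps at least half of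
  -- them.
  set X : Finset V := {u : V | p / 16 * #D ≤ (#{d ∈ D | u ∈ B d} : ℝ)}
  have hX : (#X : ℝ) ≤ 16 * b / p := by
    have h1 : (#X : ℝ) * (p / 16 * #D) ≤ b * #D := by
      calc (#X : ℝ) * (p / 16 * #D) = ∑ u ∈ X, p / 16 * (#D : ℝ) := by
            rw [sum_const, nsmul_eq_mul]
        _ ≤ ∑ u ∈ X, (#{d ∈ D | u ∈ B d} : ℝ) := sum_le_sum fun u hu => by simpa [X] using hu
        _ = ∑ d ∈ D, (#{u ∈ X | u ∈ B d} : ℝ) := by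
            exact_mod_cast sum_card_bipartiteAbove_eq_sum_card_bipartiteBelow
              (s := X) (t := D) (fun u d => u ∈ B d)
        _ ≤ ∑ d ∈ D, b := by
            refine sum_le_sum fun d hd => le_trans ?_ (hB d hd)
            exact_mod_cast card_le_card fun u hu => (mem_filter.1 hu).2
        _ = b * #D := by rw [sum_const, nsmul_eq_mul, mul_comm]
    rw [le_div_iff₀ hp]
    have h2 : (#X : ℝ) * p * #D ≤ 16 * b * #D := by linarith
    exact le_of_mul_le_mul_right h2 hD0
  refine le_trans ?_ (add_le_add (h D hD) hX)
  rw [← Nat.cast_add]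
  refine Nat.cast_le.2 (le_trans (card_le_card ?_) (card_union_le _ _))
  intro u hu
  by_contra hc
  simp only [mem_union, not_or, notMem_poor, X, mem_filter, mem_univ, true_and, not_le] at hc hu
  have h3 : #(nb G [u] D) ≤ #{d ∈ D | G.Adj u d ∧ u ∉ B d} + #{d ∈ D | u ∈ B d} := by
    refine le_trans (card_le_card ?_) (card_union_le _ _)
    intro d hd
    simp at hd ⊢
    tauto
  have h4 : (#(nb G [u] D) : ℝ) ≤ #{d ∈ D | G.Adj u d ∧ u ∉ B d} + #{d ∈ D | u ∈ B d} := by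
    exact_mod_cast h3
  linarith [hc.1, hc.2]

/-- Deleting `D` costs at most |D| at every level, and p^k n is the smallest of the scales involved.
-/
theorem Typ.sdiff {k : ℕ} {c c' : ℝ} {e : List V} {U D : Finset V} (h : Typ G p k c e U)
    (hp : 0 ≤ p) (hp1 : p ≤ 1) (hc : c' ≤ c)
    (hD : (#D : ℝ) ≤ (c - c') * p ^ k * (Fintype.card V : ℝ)) : Typ G p k c' e (U \ D) := by
  intro j hj
  have h1 : (#(nb G (e.take j) U) : ℝ) ≤ #(nb G (e.take j) (U \ D)) + #D := by
    exact_mod_cast card_nb_sdiff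
  have h2 := h j hj
  have h3 := scale_le (V := V) (ε := c - c') hp hp1 (by linarith) hj
  linarith

theorem Typ.mono_left {k : ℕ} {c c' : ℝ} {e : List V} {U : Finset V} (h : Typ G p k c e U)
    (hp : 0 ≤ p) (hc : c' ≤ c) : Typ G p k c' e U := fun j hj =>
  le_trans (by gcongr) (h j hj)

theorem Typ.mono_right {k : ℕ} {c : ℝ} {e : List V} {U W : Finset V} (h : Typ G p k c e U)
    (hU : U ⊆ W) : Typ G p k c e W := fun j hj =>
  (h j hj).trans (by exact_mod_cast card_le_card (nb_mono hU))

end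

/-- Greedy choice: by monotonicity the first `m` sets together occupy at most `m * s m` elements,
which leaves `s m` free ones in the next set. -/
theorem exists_disjoint_subsets {V : Type*} (m : ℕ) (F : ℕ → Finset V) (s : ℕ → ℕ)
    (hs : Monotone s) (M : ℕ) (hM : m ≤ M) (hF : ∀ i < m, M * s i ≤ #(F i)) :
    ∃ F' : ℕ → Finset V, (∀ i < m, F' i ⊆ F i ∧ #(F' i) = s i) ∧
      ∀ i < m, ∀ j < m, i ≠ j → Disjoint (F' i) (F' j) := by
  induction m with
  | zero => exact ⟨F, by simp, by simp⟩
  | succ m ih =>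
    obtain ⟨F', h1, h2⟩ := ih (by omega) fun i hi => hF i (by omega)
    set B := (range m).biUnion F'
    have hB : #B ≤ m * s m := by
      refine le_trans card_biUnion_le ?_
      calc ∑ i ∈ range m, #(F' i) ≤ ∑ i ∈ range m, s m :=
            sum_le_sum fun i hi => by
              rw [(h1 i (mem_range.1 hi)).2]; exact hs (mem_range.1 hi).le
        _ = m * s m := by simp
    have hc : s m ≤ #(F m \ B) := by
      have h3 := le_card_sdiff B (F m)
      have h4 := hF m (by omega)
      have h5 : (m + 1) * s m ≤ M * s m := Nat.mul_le_mul_right _ hM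
      rw [add_mul, one_mul] at h5
      omega
    obtain ⟨S, hS1, hS2⟩ := exists_subset_card_eq hc
    have hSB : ∀ i < m, Disjoint S (F' i) := fun i hi => by
      refine disjoint_left.2 fun x hx hx' => (mem_sdiff.1 (hS1 hx)).2 ?_
      exact mem_biUnion.2 ⟨i, mem_range.2 hi, hx'⟩
    refine ⟨fun i => if i = m then S else F' i, fun i hi => ?_, fun i hi j hj hij => ?_⟩
    · by_cases him : i = m
      · subst him; simpa using ⟨hS1.trans sdiff_subset, hS2⟩
      · simpa [him] using h1 i (by omega)
    · by_cases him : i = m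
      · by_cases hjm : j = m
        · omega
        · simpa [him, hjm] using hSB j (by omega)
      · by_cases hjm : j = m
        · simpa [him, hjm] using (hSB i (by omega)).symm
        · simpa [him, hjm] using h2 i (by omega) j (by omega) hij

/-- Finitely many large sets have pairwise disjoint large subsets, if their required sizes are
increasing. -/
theorem exists_disjoint_subsets_real {V : Type*} (m : ℕ) (F : ℕ → Finset V) (t : ℕ → ℝ)
    (ht : Monotone t) (h1 : 1 ≤ t 0) (hF : ∀ i < m, 2 * m * t i ≤ #(F i)) :
    ∃ F' : ℕ → Finset V, (∀ i < m, F' i ⊆ F i ∧ t i ≤ #(F' i) ∧ (#(F' i) : ℝ) ≤ 2 * t i) ∧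
      ∀ i < m, ∀ j < m, i ≠ j → Disjoint (F' i) (F' j) := by
  -- Since t i ≥ 1, rounding up at most doubles it; hence the factor 2 in the size assumption.
  have hti : ∀ i, (⌈t i⌉₊ : ℝ) ≤ 2 * t i := fun i => by
    have h2 : 1 ≤ t i := h1.trans (ht (Nat.zero_le i))
    have := Nat.ceil_lt_add_one (show 0 ≤ t i by linarith)
    linarith
  obtain ⟨F', hF', hd⟩ := exists_disjoint_subsets m F (fun i => ⌈t i⌉₊)
    (fun i j hij => Nat.ceil_mono (ht hij)) m le_rfl (fun i hi => by
      have h2 : (m : ℝ) * ⌈t i⌉₊ ≤ #(F i) := by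
        have := mul_le_mul_of_nonneg_left (hti i) (Nat.cast_nonneg (α := ℝ) m)
        linarith [hF i hi]
      exact_mod_cast h2)
  exact ⟨F', fun i hi => ⟨(hF' i hi).1, by rw [(hF' i hi).2]; exact Nat.le_ceil _,
    by rw [(hF' i hi).2]; exact hti i⟩, hd⟩

theorem exists_mem_notMem_of_card {V : Type*} {C B : Finset V} (h : (#B : ℝ) < #C) :
    ∃ x ∈ C, x ∉ B :=
  exists_mem_notMem_of_card_lt_card (by exact_mod_cast h)

theorem card_sdiff_real {V : Type*} (C B : Finset V) : (#C : ℝ) - #B ≤ #(C \ B) := by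
  have := le_card_sdiff B C
  have h2 : #C ≤ #(C \ B) + #B := by omega
  have : (#C : ℝ) ≤ #(C \ B) + #B := by exact_mod_cast h2
  linarith

end HamPow

/-! ### Connections for squares. -/

namespace HamPow
open scoped Classical
open Finset

section

variable {V : Type*} [Fintype V] {G : SimpleGraph V} {ε p : ℝ}

local notation "𝐧" => (Fintype.card V : ℝ)

theorem scale_le' {c : ℝ} {a j : ℕ} {s : ℝ} (hp : 0 ≤ p) (hp1 : p ≤ 1) (hε : 0 ≤ ε) (hεc : ε ≤ c)
    (haj : a ≤ j) (h : c * p ^ a * 𝐧 ≤ s) :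
    ε * p ^ j * 𝐧 ≤ s := by
  refine (scale_le hp hp1 hε haj).trans (le_trans ?_ h)
  gcongr

/-- Almost all vertices `z` end a square of a path `x`, `y`, `z`, which many vertices `w` extend. -/
theorem half_connect_three (hp : 0 < p) (hp1 : p ≤ 1) (hε : 0 < ε) (h12 : LowerReg G ε p 1 2)
    (h21 : LowerReg G ε p 2 1)
    (hN : 1 ≤ ε * p ^ 2 * 𝐧) {c : ℝ} (hεc : ε ≤ c / 5000)
    {X Y Z W : Finset V} (hX : c * p ^ 2 * 𝐧 ≤ #X)
    (hY : c * p ^ 1 * 𝐧 ≤ #Y) (hZ : c * p ^ 0 * 𝐧 ≤ #Z)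
    (hW : c * p ^ 0 * 𝐧 ≤ #W) :
    ∃ Z1 ⊆ Z, c / 2 * p ^ 0 * 𝐧 ≤ #Z1 ∧ ∃ R : V → Finset V, ∀ z ∈ Z1,
      R z ⊆ W ∧ c / 64 * p ^ 2 * 𝐧 ≤ #(R z) ∧ ∀ w ∈ R z,
      ∃ x ∈ X, ∃ y ∈ Y, G.Adj x y ∧ G.Adj x z ∧ G.Adj y z ∧ G.Adj y w ∧ G.Adj z w := by
  have hc : 0 < c := by linarith
  have hNpos : 0 < 𝐧 := by
    by_contra h
    have : 𝐧 = 0 := le_antisymm (not_lt.1 h) (Nat.cast_nonneg _)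
    rw [this] at hN; linarith
  have hpN1 : p ^ 1 * 𝐧 ≤ p ^ 0 * 𝐧 := by
    have := pow_le_pow_of_le_one hp.le hp1 (show 0 ≤ 1 by norm_num); gcongr
  have hpN2 : p ^ 2 * 𝐧 ≤ p ^ 1 * 𝐧 := by
    have := pow_le_pow_of_le_one hp.le hp1 (show 1 ≤ 2 by norm_num); gcongr
  have hpp2 : 0 < p ^ 2 * 𝐧 := by positivity
  have hpp1 : 0 < p ^ 1 * 𝐧 := by positivity
  have e21 : ε * p ^ 2 * 𝐧 / p = ε * p ^ 1 * 𝐧 := by field_simp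
  have e10 : ε * p ^ 1 * 𝐧 / p = ε * p ^ 0 * 𝐧 := by field_simp
  have m1 : ε * (p ^ 1 * 𝐧) ≤ c / 5000 * (p ^ 1 * 𝐧) := by gcongr
  have m2 : ε * (p ^ 2 * 𝐧) ≤ c / 5000 * (p ^ 2 * 𝐧) := by gcongr
  have m0 : ε * (p ^ 0 * 𝐧) ≤ c / 5000 * (p ^ 0 * 𝐧) := by gcongr
  have hc0 : 0 < c * (p ^ 0 * 𝐧) := by positivity
  have hc1 : 0 < c * (p ^ 1 * 𝐧) := by positivity
  have hc2 : 0 < c * (p ^ 2 * 𝐧) := by positivity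
  have h12' : ε * (p ^ 2 * 𝐧) ≤ ε * (p ^ 1 * 𝐧) := by gcongr
  -- The sets are cleaned backwards, so that every remaining `y` has many neighbours in `W` and
  -- every remaining `x` many neighbours in `Y1`.
  set Y1 := Y \ poor G p W
  have hY1 : c / 2 * p ^ 1 * 𝐧 ≤ #Y1 := by
    have h1 := h21 W (scale_le' hp.le hp1 hε.le (by linarith) (Nat.zero_le _) hW)
    have := card_sdiff_real Y (poor G p W)
    change _ ≤ (#Y1 : ℝ) at this
    linarith
  set X1 := X \ poor G p Y1
  have hX1 : c / 2 * p ^ 2 * 𝐧 ≤ #X1 := by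
    have h1 := h21 Y1 (scale_le' hp.le hp1 hε.le (by linarith) le_rfl hY1)
    have := card_sdiff_real X (poor G p Y1)
    change _ ≤ (#X1 : ℝ) at this
    linarith
  have hYx : ∀ x ∈ X1, c / 16 * p ^ 2 * 𝐧 ≤ #(nb G [x] Y1) := fun x hx => by
    have := notMem_poor.1 (mem_sdiff.1 hx).2
    refine le_trans ?_ this
    calc c / 16 * p ^ 2 * 𝐧 = p / 8 * (c / 2 * p ^ 1 * 𝐧) := by ring
      _ ≤ _ := by gcongr
  have hWy : ∀ y ∈ Y1, c / 8 * p ^ 1 * 𝐧 ≤ #(nb G [y] W) := fun y hy => by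
    have := notMem_poor.1 (mem_sdiff.1 hy).2
    refine le_trans ?_ this
    calc c / 8 * p ^ 1 * 𝐧 = p / 8 * (c * p ^ 0 * 𝐧) := by ring
      _ ≤ _ := by gcongr
  have hBy : ∀ y ∈ Y1, (#(poor G p (nb G [y] W)) : ℝ) ≤ ε * p ^ 2 * 𝐧 := fun y hy =>
    h21 _ (scale_le' hp.le hp1 hε.le (by linarith) le_rfl (hWy y hy))
  -- Two nested averagings, first over `y` and then over `x`, each cost a factor 1/p: the
  -- exceptional sets grow from order ε p^2 n to ε p n and then to ε n, which is still small in `Z`.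
  set B1 : V → Finset V := fun x =>
    {z : V | (#{y ∈ nb G [x] Y1 | G.Adj z y ∧ z ∉ poor G p (nb G [y] W)} : ℝ) <
      p / 16 * #(nb G [x] Y1)}
  have hB1 : ∀ x ∈ X1, (#(B1 x) : ℝ) ≤ 17 * ε * p ^ 1 * 𝐧 := fun x hx => by
    have h1 := h12.card_exceptional hp (D := nb G [x] Y1)
      (scale_le' hp.le hp1 hε.le (by linarith) le_rfl (hYx x hx))
      (lt_of_lt_of_le (by positivity) (hYx x hx)) (B := fun y => poor G p (nb G [y] W))
      (fun y hy => hBy y (nb_subset hy))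
    rw [mul_div_assoc, e21] at h1
    refine h1.trans (le_of_eq (by ring))
  have hB2 := h12.card_exceptional hp (D := X1)
    (scale_le' hp.le hp1 hε.le (by linarith) le_rfl hX1)
    (lt_of_lt_of_le (by positivity) hX1) hB1
  set B2 : Finset V := {z : V | (#{x ∈ X1 | G.Adj z x ∧ z ∉ B1 x} : ℝ) < p / 16 * #X1}
  have hB2' : (#B2 : ℝ) ≤ 273 * ε * p ^ 0 * 𝐧 := by
    have : 16 * (17 * ε * p ^ 1 * 𝐧) / p = 272 * (ε * p ^ 1 * 𝐧 / p) := by ring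
    rw [this, e10] at hB2
    have : ε * (p ^ 1 * 𝐧) ≤ ε * (p ^ 0 * 𝐧) := by gcongr
    linarith
  set Z1 := Z \ B2
  have hZ1 : c / 2 * p ^ 0 * 𝐧 ≤ #Z1 := by
    have := card_sdiff_real Z B2
    change _ ≤ (#Z1 : ℝ) at this
    linarith
  have hR : ∀ z : V, ∃ R : Finset V, z ∈ Z1 → R ⊆ W ∧ c / 64 * p ^ 2 * 𝐧 ≤ #R ∧ ∀ w ∈ R,
      ∃ x ∈ X, ∃ y ∈ Y, G.Adj x y ∧ G.Adj x z ∧ G.Adj y z ∧ G.Adj y w ∧ G.Adj z w := by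
    intro z
    by_cases hz : z ∈ Z1
    swap
    · exact ⟨∅, fun h => absurd h hz⟩
    have hz2 := (mem_sdiff.1 hz).2
    simp only [B2, mem_filter, mem_univ, true_and, not_lt] at hz2
    have : (0 : ℝ) < #{x ∈ X1 | G.Adj z x ∧ z ∉ B1 x} :=
      lt_of_lt_of_le (mul_pos (by positivity) (lt_of_lt_of_le (by positivity) hX1)) hz2
    obtain ⟨x, hx⟩ := card_pos.1 (show 0 < #{x ∈ X1 | G.Adj z x ∧ z ∉ B1 x} by exact_mod_cast this)
    obtain ⟨hx1, hzx, hzB⟩ := mem_filter.1 hx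
    simp only [B1, mem_filter, mem_univ, true_and, not_lt] at hzB
    have : (0 : ℝ) < #{y ∈ nb G [x] Y1 | G.Adj z y ∧ z ∉ poor G p (nb G [y] W)} :=
      lt_of_lt_of_le (mul_pos (by positivity) (lt_of_lt_of_le (by positivity) (hYx x hx1))) hzB
    obtain ⟨y, hy⟩ := card_pos.1 (show 0 < #{y ∈ nb G [x] Y1 | G.Adj z y ∧
      z ∉ poor G p (nb G [y] W)} by exact_mod_cast this)
    obtain ⟨hy1, hzy, hzp⟩ := mem_filter.1 hy
    obtain ⟨hy2, hxy⟩ := mem_nb_singleton.1 hy1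
    refine ⟨nb G [z] (nb G [y] W), fun _ => ⟨nb_subset.trans nb_subset, ?_, ?_⟩⟩
    · refine le_trans ?_ (notMem_poor.1 hzp)
      calc c / 64 * p ^ 2 * 𝐧 = p / 8 * (c / 8 * p ^ 1 * 𝐧) := by ring
        _ ≤ _ := by have := hWy y hy2; gcongr
    · intro w hw
      obtain ⟨hw1, hzw⟩ := mem_nb_singleton.1 hw
      obtain ⟨hw2, hyw⟩ := mem_nb_singleton.1 hw1
      exact ⟨x, (mem_sdiff.1 hx1).1, y, (mem_sdiff.1 hy2).1, hxy, hzx.symm, hzy.symm, hyw, hzw⟩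
  choose R hR using hR
  exact ⟨Z1, sdiff_subset, hZ1, R, hR⟩

/-- If many neighbours `z` of `v` have large neighbourhoods `R z` in which `v` is not poor, then
`v` has many neighbours in the union of these sets. -/
theorem card_union_neighbours (hp : 0 < p) (hp1 : p ≤ 1) (hε : 0 < ε) (hu : UpperReg G ε p 1 2)
    (hN : 1 ≤ ε * p ^ 2 * 𝐧) {c : ℝ} (hc1 : c ≤ 1) (hεc : ε ≤ c / 5000)
    {Z W : Finset V} (hW : c * p ^ 0 * 𝐧 ≤ #W) (hZW : Disjoint Z W)
    {R : V → Finset V} {v : V} (hZ : c / 32 * p ^ 1 * 𝐧 ≤ #Z)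
    (hR : ∀ z ∈ Z, R z ⊆ W ∧ c / 64 * p ^ 2 * 𝐧 ≤ #(R z) ∧
      v ∉ poor G p (R z) ∧ ∀ w ∈ R z, G.Adj z w) :
    c / 4096 * p ^ 2 * 𝐧 ≤ #(nb G [v] (Z.biUnion R)) := by
  have hc : 0 < c := by linarith
  have hNpos : 0 < 𝐧 := by
    by_contra h
    have : 𝐧 = 0 := le_antisymm (not_lt.1 h) (Nat.cast_nonneg _)
    rw [this] at hN; linarith
  have hpN1 : p ^ 1 * 𝐧 ≤ p ^ 0 * 𝐧 := by
    have := pow_le_pow_of_le_one hp.le hp1 (show 0 ≤ 1 by norm_num); gcongr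
  have hpN2 : p ^ 2 * 𝐧 ≤ p ^ 1 * 𝐧 := by
    have := pow_le_pow_of_le_one hp.le hp1 (show 1 ≤ 2 by norm_num); gcongr
  have hpp2 : 0 < p ^ 2 * 𝐧 := by positivity
  have hpp1 : 0 < p ^ 1 * 𝐧 := by positivity
  have e21 : ε * p ^ 2 * 𝐧 / p = ε * p ^ 1 * 𝐧 := by field_simp
  have e10 : ε * p ^ 1 * 𝐧 / p = ε * p ^ 0 * 𝐧 := by field_simp
  have m1 : ε * (p ^ 1 * 𝐧) ≤ c / 5000 * (p ^ 1 * 𝐧) := by gcongr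
  have m2 : ε * (p ^ 2 * 𝐧) ≤ c / 5000 * (p ^ 2 * 𝐧) := by gcongr
  have m0 : ε * (p ^ 0 * 𝐧) ≤ c / 5000 * (p ^ 0 * 𝐧) := by gcongr
  set T := nb G [v] (Z.biUnion R)
  have hTW : T ⊆ W := nb_subset.trans (biUnion_subset.2 fun z hz => (hR z hz).1)
  -- Otherwise `T` fits into a set `T'` ⊆ `W` of at most 3c/4096 · p^2 n vertices. Each `z` sends at
  -- least c/512 · p^3 n = 8c/4096 · p^3 n edges into it, while `UpperReg` allows only 6c/4096 · p^3
  -- n on average.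
  by_contra hlt
  rw [not_le] at hlt
  set s := ⌈c / 4096 * p ^ 2 * 𝐧⌉₊
  have hs1 : c / 4096 * p ^ 2 * 𝐧 ≤ s := Nat.le_ceil _
  have hone : 1 ≤ 2 * (c / 4096 * p ^ 2 * 𝐧) := by linarith
  have hs2 : (s : ℝ) ≤ 3 * (c / 4096 * p ^ 2 * 𝐧) := by
    have := Nat.ceil_lt_add_one (show 0 ≤ c / 4096 * p ^ 2 * 𝐧 by positivity)
    change (s : ℝ) < _ at this
    linarith
  have hTs : #T ≤ s := by exact_mod_cast (hlt.le.trans hs1)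
  have hsW : s ≤ #W := by
    have h1 : 0 < c * (p ^ 2 * 𝐧) := by positivity
    have h2 : c * (p ^ 2 * 𝐧) ≤ c * (p ^ 0 * 𝐧) := by
      have := hpN2.trans hpN1
      gcongr
    have : (s : ℝ) ≤ #W := by linarith
    exact_mod_cast this
  obtain ⟨T', hT1, hT2, hT3⟩ := exists_subsuperset_card_eq hTW hTs hsW
  have hdisj : Disjoint Z T' := hZW.mono_right hT2
  have hup := hu Z T' hdisj (scale_le' hp.le hp1 hε.le (by linarith) le_rfl hZ)
    (by rw [hT3]; exact (scale_le' hp.le hp1 hε.le (by linarith) le_rfl hs1))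
  have hlow : ∀ z ∈ Z, c / 512 * p ^ 3 * 𝐧 ≤ (#(nb G [z] T') : ℝ) := by
    intro z hz
    obtain ⟨-, hRz, hvp, hzw⟩ := hR z hz
    calc c / 512 * p ^ 3 * 𝐧 = p / 8 * (c / 64 * p ^ 2 * 𝐧) := by ring
      _ ≤ p / 8 * #(R z) := by gcongr
      _ ≤ #(nb G [v] (R z)) := notMem_poor.1 hvp
      _ ≤ _ := by
        refine Nat.cast_le.2 (card_le_card fun w hw => ?_)
        obtain ⟨hw1, hvw⟩ := mem_nb_singleton.1 hw
        exact mem_nb_singleton.2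
          ⟨hT1 (mem_nb_singleton.2 ⟨mem_biUnion.2 ⟨z, hz, hw1⟩, hvw⟩), hzw w hw1⟩
  have hsum := sum_le_sum hlow
  rw [sum_const, nsmul_eq_mul] at hsum
  have h3 := hsum.trans hup
  rw [hT3] at h3
  have hZpos : (0 : ℝ) < #Z := lt_of_lt_of_le (by positivity) hZ
  have h4 : (#Z : ℝ) * (c / 512 * p ^ 3 * 𝐧) ≤ #Z * (2 * p * s) := by linarith
  have h5 := le_of_mul_le_mul_left h4 hZpos
  have h6 : 2 * p * s ≤ 2 * p * (3 * (c / 4096 * p ^ 2 * 𝐧)) := by gcongr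
  have h7 : 0 < c * p ^ 3 * 𝐧 := by positivity
  linarith

/-- In a square of a path, the pairs of vertices reached from a fixed end after six steps include
many edges at almost every vertex. -/
theorem half_connect (hp : 0 < p) (hp1 : p ≤ 1) (hε : 0 < ε) (h12 : LowerReg G ε p 1 2)
    (h21 : LowerReg G ε p 2 1) (hu : UpperReg G ε p 1 2)
    (hN : 1 ≤ ε * p ^ 2 * 𝐧) {c : ℝ} (hc1 : c ≤ 1) (hεc : ε ≤ c / 5000)
    {X Y Z W S : Finset V} (hX : c * p ^ 2 * 𝐧 ≤ #X)
    (hY : c * p ^ 1 * 𝐧 ≤ #Y) (hZ : c * p ^ 0 * 𝐧 ≤ #Z)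
    (hW : c * p ^ 0 * 𝐧 ≤ #W) (hS : c * p ^ 0 * 𝐧 ≤ #S)
    (hZW : Disjoint Z W) :
    ∃ E : Finset V, (#E : ℝ) ≤ 17 * ε * 𝐧 ∧ ∀ u ∉ E,
      c / 32 * p ^ 1 * 𝐧 ≤ #{v ∈ S | G.Adj u v ∧ ∃ x ∈ X, ∃ y ∈ Y, ∃ z ∈ Z,
        ∃ w ∈ W, G.Adj x y ∧ G.Adj x z ∧ G.Adj y z ∧ G.Adj y w ∧ G.Adj z w ∧ G.Adj z v ∧
          G.Adj w v ∧ G.Adj w u} := by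
  have hc : 0 < c := by linarith
  have hNpos : 0 < 𝐧 := by
    by_contra h
    have : 𝐧 = 0 := le_antisymm (not_lt.1 h) (Nat.cast_nonneg _)
    rw [this] at hN; linarith
  have hpN1 : p ^ 1 * 𝐧 ≤ p ^ 0 * 𝐧 := by
    have := pow_le_pow_of_le_one hp.le hp1 (show 0 ≤ 1 by norm_num); gcongr
  have hpN2 : p ^ 2 * 𝐧 ≤ p ^ 1 * 𝐧 := by
    have := pow_le_pow_of_le_one hp.le hp1 (show 1 ≤ 2 by norm_num); gcongr
  have hpp2 : 0 < p ^ 2 * 𝐧 := by positivity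
  have hpp1 : 0 < p ^ 1 * 𝐧 := by positivity
  have e21 : ε * p ^ 2 * 𝐧 / p = ε * p ^ 1 * 𝐧 := by field_simp
  have e10 : ε * p ^ 1 * 𝐧 / p = ε * p ^ 0 * 𝐧 := by field_simp
  have m1 : ε * (p ^ 1 * 𝐧) ≤ c / 5000 * (p ^ 1 * 𝐧) := by gcongr
  have m2 : ε * (p ^ 2 * 𝐧) ≤ c / 5000 * (p ^ 2 * 𝐧) := by gcongr
  have m0 : ε * (p ^ 0 * 𝐧) ≤ c / 5000 * (p ^ 0 * 𝐧) := by gcongr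
  obtain ⟨Z1, hZ1Z, hZ1, R, hR⟩ :=
    half_connect_three hp hp1 hε h12 h21 hN hεc hX hY hZ hW
  have hB4 := h21.card_exceptional hp (D := Z1)
    (scale_le' hp.le hp1 hε.le (by linarith) (Nat.zero_le _) hZ1)
    (lt_of_lt_of_le (by positivity) hZ1) (B := fun z => poor G p (R z)) (b := ε * p ^ 1 * 𝐧)
    (fun z hz => h12 _ (scale_le' hp.le hp1 hε.le (by linarith) le_rfl (hR z hz).2.1))
  set B4 : Finset V := {v : V | (#{z ∈ Z1 | G.Adj v z ∧ v ∉ poor G p (R z)} : ℝ) < p / 16 * #Z1}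
  rw [mul_div_assoc, e10] at hB4
  have h01 : ε * (p ^ 2 * 𝐧) ≤ ε * (p ^ 0 * 𝐧) := by
    have := hpN2.trans hpN1
    gcongr
  have hc0 : 0 < c * (p ^ 0 * 𝐧) := by positivity
  set V1 := S \ B4
  have hV1 : c / 2 * p ^ 0 * 𝐧 ≤ #V1 := by
    have := card_sdiff_real S B4
    change _ ≤ (#V1 : ℝ) at this
    linarith
  set Zv : V → Finset V := fun v => {z ∈ Z1 | G.Adj v z ∧ v ∉ poor G p (R z)}
  -- A single `R z` guarantees `v` only about p^3 n neighbours, below the scale p^2 n at which `h12`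
  -- applies. The union over all suitable `z` reaches this scale.
  set T : V → Finset V := fun v => nb G [v] ((Zv v).biUnion R)
  have hT : ∀ v ∈ V1, c / 4096 * p ^ 2 * 𝐧 ≤ #(T v) := fun v hv => by
    have hZv : c / 32 * p ^ 1 * 𝐧 ≤ #(Zv v) := by
      have h1 := (mem_sdiff.1 hv).2
      simp only [B4, mem_filter, mem_univ, true_and, not_lt] at h1
      refine le_trans ?_ h1
      calc c / 32 * p ^ 1 * 𝐧 = p / 16 * (c / 2 * p ^ 0 * 𝐧) := by ring
        _ ≤ _ := by gcongr
    refine card_union_neighbours hp hp1 hε hu hN hc1 hεc hW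
      (hZW.mono_left ((filter_subset _ _).trans hZ1Z)) hZv fun z hz => ?_
    obtain ⟨hz1, hvz, hvp⟩ := mem_filter.1 hz
    refine ⟨(hR z hz1).1, (hR z hz1).2.1, hvp, fun w hw => ?_⟩
    obtain ⟨_, _, _, _, _, _, _, _, h⟩ := (hR z hz1).2.2 w hw
    exact h
  have hE := h21.card_exceptional hp (D := V1)
    (scale_le' hp.le hp1 hε.le (by linarith) (Nat.zero_le _) hV1)
    (lt_of_lt_of_le (by positivity) hV1) (B := fun v => poor G p (T v)) (b := ε * p ^ 1 * 𝐧)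
    (fun v hv => h12 _ (scale_le' hp.le hp1 hε.le (by linarith) le_rfl (hT v hv)))
  rw [mul_div_assoc, e10] at hE
  refine ⟨_, hE.trans ?_, fun u hu => ?_⟩
  · have h1 : p ^ 2 * 𝐧 ≤ p ^ 0 * 𝐧 := hpN2.trans hpN1
    have h2 : ε * (p ^ 2 * 𝐧) ≤ ε * (p ^ 0 * 𝐧) := by gcongr
    linarith
  · simp only [mem_filter, mem_univ, true_and, not_lt] at hu
    calc c / 32 * p ^ 1 * 𝐧 = p / 16 * (c / 2 * p ^ 0 * 𝐧) := by ring
      _ ≤ _ := by gcongr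
      _ ≤ _ := hu
      _ ≤ _ := by
        refine Nat.cast_le.2 (card_le_card fun v hv => ?_)
        obtain ⟨hv1, huv, hup⟩ := mem_filter.1 hv
        obtain ⟨w, hw, huw⟩ := nonempty_of_notMem_poor hup hp
          (lt_of_lt_of_le (by positivity) (hT v hv1))
        obtain ⟨hw1, hvw⟩ := mem_nb_singleton.1 hw
        obtain ⟨z, hz, hwz⟩ := mem_biUnion.1 hw1
        obtain ⟨hz1, hvz, -⟩ := mem_filter.1 hz
        obtain ⟨x, hx, y, hy, h1, h2, h3, h4, h5⟩ := (hR z hz1).2.2 w hwz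
        exact mem_filter.2 ⟨(mem_sdiff.1 hv1).1, huv, x, hx, y, hy, z, hZ1Z hz1, w,
          (hR z hz1).1 hwz, h1, h2, h3, h4, h5, hvz.symm, hvw.symm, huw.symm⟩

end

end HamPow

namespace HamPow
open scoped Classical
open Finset

theorem nodup_of_forall₂ {V : Type*} {F : ℕ → Finset V} {m : ℕ}
    (hF : ∀ i < m, ∀ j < m, i ≠ j → Disjoint (F i) (F j)) {l : List V} {s : List ℕ}
    (h : List.Forall₂ (fun x i => x ∈ F i) l s) (hs : s.Nodup) (hm : ∀ i ∈ s, i < m) :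
    l.Nodup := by
  induction h with
  | nil => simp
  | @cons x i l s hx h ih =>
    rw [List.nodup_cons] at hs ⊢
    refine ⟨fun hxl => ?_, ih hs.2 fun j hj => hm j (by simp [hj])⟩
    have : ∀ {l : List V} {s : List ℕ}, List.Forall₂ (fun x i => x ∈ F i) l s → x ∈ l →
        ∃ j ∈ s, x ∈ F j := by
      intro l s h
      induction h with
      | nil => simp
      | @cons y j l s hy h ih =>
        intro hx
        rcases List.mem_cons.1 hx with rfl | hx
        · exact ⟨j, by simp, hy⟩
        · obtain ⟨j, hj, h⟩ := ih hx
          exact ⟨j, by simp [hj], h⟩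
    obtain ⟨j, hj, hxj⟩ := this h hxl
    have hij : i ≠ j := by rintro rfl; exact hs.1 hj
    exact disjoint_left.1 (hF i (hm i (by simp)) j (hm j (by simp [hj])) hij) hx hxj

section

variable {V : Type*} [Fintype V] {G : SimpleGraph V} {ε p : ℝ}

local notation "𝐧" => (Fintype.card V : ℝ)

/-- The connecting path is x y z w v u t w' z' y' x'. Both halves are grown towards one middle
vertex `u`: for almost every `u` there are order pn choices of `v` from the left and of `t` from the
right, and it remains to find an edge `vt` between these two sets. -/
theorem conn_square (hp : 0 < p) (hp1 : p ≤ 1) (hε : 0 < ε) (h12 : LowerReg G ε p 1 2)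
    (h21 : LowerReg G ε p 2 1) (hu : UpperReg G ε p 1 2) (hN : 1 ≤ ε * p ^ 2 * 𝐧) {c γ : ℝ}
    (hcγ : c ≤ γ) (hγ : γ ≤ 1) (hεc : ε ≤ c / 110000) : Conn G 2 p c γ 11 := by
  intro U e f hU he hf hKe hKf hTe hTf
  obtain ⟨b, a, rfl⟩ := List.length_eq_two.1 he
  obtain ⟨b', a', rfl⟩ := List.length_eq_two.1 hf
  have hc : 0 < c := by linarith
  have hn : 0 < 𝐧 := by
    by_contra h
    rw [le_antisymm (not_lt.1 h) (Nat.cast_nonneg _)] at hN; linarith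
  have ha1 := hTe 1 (by norm_num)
  have ha2 := hTe 2 le_rfl
  have hb1 := hTf 1 (by norm_num)
  have hb2 := hTf 2 le_rfl
  simp only [List.take_succ_cons, List.take_zero] at ha1 ha2 hb1 hb2
  have hU' : c * p ^ 0 * 𝐧 ≤ #U := by
    refine le_trans ?_ hU
    rw [pow_zero, mul_one]
    gcongr
  -- The sets are listed by increasing size: the exponents 2 - i / 2, with truncated arithmetic, are
  -- 2, 2, 1, 1, 0, …, and 22 is twice the number of sets. Even indices among the first four belong
  -- to `e`, odd ones to `f`.
  obtain ⟨F, hF, hd⟩ := exists_disjoint_subsets_real 11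
    (fun i => match i with
      | 0 => nb G [b, a] U
      | 1 => nb G [b', a'] U
      | 2 => nb G [b] U
      | 3 => nb G [b'] U
      | _ => U)
    (fun i => c / 22 * p ^ (2 - i / 2) * 𝐧) (fun i j hij => scale_le hp.le hp1 (by positivity)
      (Nat.sub_le_sub_left (Nat.div_le_div_right hij) 2))
    (by
      have : ε * (p ^ 2 * 𝐧) ≤ c / 22 * (p ^ 2 * 𝐧) := by gcongr; linarith
      simp only [Nat.zero_div, Nat.sub_zero]
      linarith)
    (fun i hi => by
      have e22 : ∀ a : ℕ, 2 * ((11 : ℕ) : ℝ) * (c / 22 * p ^ a * 𝐧) = c * p ^ a * 𝐧 := fun a => by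
        push_cast; ring
      rw [e22]
      interval_cases i <;> first | exact ha2 | exact hb2 | exact ha1 | exact hb1 | exact hU')
  have hs := fun i hi => (hF i hi).2.1
  obtain ⟨E, hE, hE'⟩ := half_connect hp hp1 hε h12 h21 hu hN (c := c / 22) (by linarith)
    (by linarith) (hs 0 (by norm_num)) (hs 2 (by norm_num)) (hs 4 (by norm_num))
    (hs 5 (by norm_num)) (hs 6 (by norm_num)) (hd 4 (by norm_num) 5 (by norm_num) (by norm_num))
  obtain ⟨E2, hE2, hE2'⟩ := half_connect hp hp1 hε h12 h21 hu hN (c := c / 22) (by linarith)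
    (by linarith) (hs 1 (by norm_num)) (hs 3 (by norm_num)) (hs 7 (by norm_num))
    (hs 8 (by norm_num)) (hs 9 (by norm_num)) (hd 7 (by norm_num) 8 (by norm_num) (by norm_num))
  have h10 := hs 10 (by norm_num)
  have hεn : ε * 𝐧 ≤ c / 110000 * 𝐧 := by gcongr
  have hcn : 0 < c * 𝐧 := by positivity
  obtain ⟨u, hu10, hu⟩ := exists_mem_notMem_of_card (C := F 10) (B := E ∪ E2) (by
    have h1 : (#(E ∪ E2) : ℝ) ≤ #E + #E2 := by exact_mod_cast card_union_le _ _
    norm_num at h10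
    linarith)
  rw [mem_union, not_or] at hu
  have hS := hE' u hu.1
  have hS2 := hE2' u hu.2
  set S := {v ∈ F 6 | G.Adj u v ∧ ∃ x ∈ F 0, ∃ y ∈ F 2, ∃ z ∈ F 4,
        ∃ w ∈ F 5, G.Adj x y ∧ G.Adj x z ∧ G.Adj y z ∧ G.Adj y w ∧ G.Adj z w ∧ G.Adj z v ∧
          G.Adj w v ∧ G.Adj w u}
  have hcp : 0 < c * (p ^ 1 * 𝐧) := by positivity
  have hεp : ε * (p ^ 1 * 𝐧) ≤ c / 110000 * (p ^ 1 * 𝐧) := by gcongr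
  -- Only ε p^2 n vertices are poor for `S`, fewer than the order pn candidates for `t`; so some `t`
  -- has a neighbour `v` in `S`.
  have hpoor : (#(poor G p S) : ℝ) ≤ ε * p ^ 2 * 𝐧 :=
    h21 S (scale_le' hp.le hp1 hε.le (by linarith) le_rfl hS)
  have h21n : ε * p ^ 2 * 𝐧 ≤ ε * p ^ 1 * 𝐧 := scale_le hp.le hp1 hε.le (by norm_num)
  obtain ⟨t, ht, htS⟩ := exists_mem_notMem_of_card (B := poor G p S)
    (lt_of_lt_of_le (by linarith) hS2)
  obtain ⟨v, hv, htv⟩ := nonempty_of_notMem_poor htS hp (lt_of_lt_of_le (by positivity) hS)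
  obtain ⟨hv6, huv, x, hx, y, hy, z, hz, w, hw, a1, a2, a3, a4, a5, a6, a7, a8⟩ := mem_filter.1 hv
  obtain ⟨ht9, hut, x', hx', y', hy', z', hz', w', hw', b1, b2, b3, b4, b5, b6, b7, b8⟩ :=
    mem_filter.1 ht
  have hsub : ∀ i < 11, F i ⊆ U := fun i hi => by
    refine (hF i hi).1.trans ?_
    interval_cases i <;> first | exact nb_subset | exact subset_rfl
  have hxa := (mem_nb.1 ((hF 0 (by norm_num)).1 hx)).2
  have hyb := (mem_nb.1 ((hF 2 (by norm_num)).1 hy)).2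
  have hxa' := (mem_nb.1 ((hF 1 (by norm_num)).1 hx')).2
  have hyb' := (mem_nb.1 ((hF 3 (by norm_num)).1 hy')).2
  simp only [List.mem_cons, List.not_mem_nil, or_false,
    forall_eq_or_imp, forall_eq, KAdj, List.take_succ_cons, List.take_nil, and_true] at hxa hyb hxa' hyb' hKe hKf
  refine ⟨[x, y, z, w, v, u, t, w', z', y', x'], ?_, ?_, by simp, ?_⟩
  · simp only [List.mem_cons, List.not_mem_nil, or_false, forall_eq_or_imp, forall_eq]
    exact ⟨hsub 0 (by norm_num) hx, hsub 2 (by norm_num) hy, hsub 4 (by norm_num) hz,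
      hsub 5 (by norm_num) hw, hsub 6 (by norm_num) hv6, hsub 10 (by norm_num) hu10,
      hsub 9 (by norm_num) ht9, hsub 8 (by norm_num) hw', hsub 7 (by norm_num) hz',
      hsub 3 (by norm_num) hy', hsub 1 (by norm_num) hx'⟩
  · exact nodup_of_forall₂ hd (s := [0, 2, 4, 5, 6, 10, 9, 8, 7, 3, 1])
      (by simp [*]) (by decide) (by decide)
  · simp only [List.reverse_cons, List.reverse_nil, List.nil_append, List.cons_append, KAdj,
      List.take_succ_cons, List.take_zero, List.mem_cons, List.not_mem_nil, or_false,
      forall_eq_or_imp, forall_eq, and_true, List.take_nil]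
    exact ⟨⟨hKe.1.symm, hxa.2⟩, ⟨hxa.1, hyb⟩, ⟨a1, a2⟩, ⟨a3, a4⟩, ⟨a5, a6⟩, ⟨a7, a8⟩,
      ⟨huv.symm, htv.symm⟩, ⟨hut, b8.symm⟩, ⟨b7.symm, b6.symm⟩, ⟨b5.symm, b4.symm⟩,
      ⟨b3.symm, b2.symm⟩, ⟨b1.symm, hyb'.symm⟩, ⟨hxa'.1.symm, hxa'.2.symm⟩, hKf⟩

end

end HamPow

/-! ### Absorbing gadgets for squares. -/

namespace HamPow
open scoped Classical
open Finset

/-- The vertices `a` for which the pair `a`, `c` is not typical for some member of `𝒯`. -/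
noncomputable def badApex {V : Type*} [Fintype V] (G : SimpleGraph V) (p : ℝ)
    (𝒯 : Finset (Finset V)) (c : V) : Finset V :=
  𝒯.biUnion (poor G p) ∪ 𝒯.biUnion fun T => poor G p (nb G [c] T)

section

variable {V : Type*} [Fintype V] {G : SimpleGraph V} {ε p γ : ℝ} {𝒯 : Finset (Finset V)}

local notation "𝐧" => (Fintype.card V : ℝ)

theorem card_nb_of_notMem_poor {T : Finset V} {c : V} {γ : ℝ} {a : ℕ} (hp : 0 ≤ p)
    (hT : γ * p ^ a * 𝐧 ≤ #T) (hc : c ∉ poor G p T) :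
    γ / 8 * p ^ (a + 1) * 𝐧 ≤ #(nb G [c] T) := by
  refine le_trans ?_ (notMem_poor.1 hc)
  calc γ / 8 * p ^ (a + 1) * 𝐧 = p / 8 * (γ * p ^ a * 𝐧) := by ring
    _ ≤ _ := by gcongr

theorem card_badApex (hp : 0 ≤ p) (hp1 : p ≤ 1) (hε : 0 ≤ ε) (h21 : LowerReg G ε p 2 1)
    (hεγ : ε ≤ γ / 8) (h𝒯 : ∀ T ∈ 𝒯, γ * p ^ 0 * 𝐧 ≤ #T) (hcard : #𝒯 ≤ 4) {c : V}
    (hc : ∀ T ∈ 𝒯, c ∉ poor G p T) : (#(badApex G p 𝒯 c) : ℝ) ≤ 8 * (ε * p ^ 2 * 𝐧) := by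
  have h4 : (#𝒯 : ℝ) ≤ 4 := by exact_mod_cast hcard
  have h0 : 0 ≤ ε * p ^ 2 * 𝐧 := by positivity
  have h1 := h21.card_biUnion 𝒯 fun T hT =>
    scale_le' hp hp1 hε (by linarith) (Nat.zero_le _) (h𝒯 T hT)
  have h2 : (#(𝒯.biUnion fun T => poor G p (nb G [c] T)) : ℝ) ≤ #𝒯 * (ε * p ^ 2 * 𝐧) := by
    calc (#(𝒯.biUnion fun T => poor G p (nb G [c] T)) : ℝ)
        ≤ ∑ T ∈ 𝒯, (#(poor G p (nb G [c] T)) : ℝ) := by exact_mod_cast card_biUnion_le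
      _ ≤ ∑ T ∈ 𝒯, ε * p ^ 2 * 𝐧 := sum_le_sum fun T hT => h21 _
          (scale_le' hp hp1 hε hεγ le_rfl (card_nb_of_notMem_poor hp (h𝒯 T hT) (hc T hT)))
      _ = _ := by rw [sum_const, nsmul_eq_mul]
  have h3 : (#(badApex G p 𝒯 c) : ℝ) ≤
      #(𝒯.biUnion (poor G p)) + #(𝒯.biUnion fun T => poor G p (nb G [c] T)) := by
    exact_mod_cast card_union_le _ _
  nlinarith

theorem typ_of_notMem_badApex (hp : 0 ≤ p) (hγ : 0 ≤ γ)
    (h𝒯 : ∀ T ∈ 𝒯, γ * p ^ 0 * 𝐧 ≤ #T) {a c : V} (hc : ∀ T ∈ 𝒯, c ∉ poor G p T)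
    (ha : a ∉ badApex G p 𝒯 c) {T : Finset V} (hT : T ∈ 𝒯) : Typ G p 2 (γ / 64) [a, c] T := by
  simp only [badApex, mem_union, mem_biUnion, not_or, not_exists, not_and] at ha
  intro j hj
  interval_cases j
  · simp only [List.take_zero, nb_nil]
    refine le_trans ?_ (h𝒯 T hT)
    have : 0 ≤ γ * p ^ 0 * 𝐧 := by positivity
    linarith
  · simp only [List.take_succ_cons, List.take_zero]
    refine le_trans ?_ (card_nb_of_notMem_poor hp (h𝒯 T hT) (ha.1 T hT))
    have : 0 ≤ γ * p ^ 1 * 𝐧 := by positivity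
    norm_num at this ⊢
    linarith
  · simp only [List.take_succ_cons, List.take_zero]
    rw [nb_cons]
    refine le_trans (le_of_eq (by ring))
      (card_nb_of_notMem_poor hp (card_nb_of_notMem_poor hp (h𝒯 T hT) (hc T hT)) (ha.2 T hT))

/-- From a fixed start of a strip of triangles almost all edges are reached in two steps. -/
theorem half_strip (hp : 0 < p) (hp1 : p ≤ 1) (hε : 0 < ε) (h12 : LowerReg G ε p 1 2)
    (h21 : LowerReg G ε p 2 1) (hn : 0 < 𝐧) {c : ℝ} (hεc : ε ≤ c / 5000) (hεγ : ε ≤ γ / 8)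
    (h𝒯 : ∀ T ∈ 𝒯, γ * p ^ 0 * 𝐧 ≤ #T) (hcard : #𝒯 ≤ 4) {c₀ : V} {A₀ C₁ A₁ A₂ : Finset V}
    (hA₀ : c * p ^ 2 * 𝐧 ≤ #A₀) (hC₁ : c * p ^ 1 * 𝐧 ≤ #(nb G [c₀] C₁))
    (hA₁ : c * p ^ 1 * 𝐧 ≤ #(nb G [c₀] A₁)) (hA₂ : c * p ^ 0 * 𝐧 ≤ #A₂) :
    ∃ (E : Finset V) (Bad : V → Finset V), (#E : ℝ) ≤ 37 * (ε * p ^ 0 * 𝐧) ∧ ∀ x ∉ E,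
      (#(Bad x) : ℝ) ≤ ε * p ^ 1 * 𝐧 ∧ (∀ T ∈ 𝒯, x ∉ poor G p T) ∧ ∀ y ∉ Bad x,
      ∃ a₀ ∈ A₀, ∃ c₁ ∈ C₁, ∃ a₁ ∈ A₁, ∃ a₂ ∈ A₂, (G.Adj c₀ c₁ ∧ G.Adj a₀ c₁ ∧ G.Adj c₀ a₁ ∧
        G.Adj c₁ a₁ ∧ G.Adj a₁ x ∧ G.Adj c₁ x ∧ G.Adj c₁ a₂ ∧ G.Adj x a₂ ∧ G.Adj a₂ y) ∧
        (∀ T ∈ 𝒯, c₁ ∉ poor G p T) ∧ a₁ ∉ badApex G p 𝒯 c₁ ∧ a₂ ∉ badApex G p 𝒯 x := by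
  have hc : 0 < c := by linarith
  have h4 : (#𝒯 : ℝ) ≤ 4 := by exact_mod_cast hcard
  have hpp1 : 0 < p ^ 1 * 𝐧 := by positivity
  have hpp2 : 0 < p ^ 2 * 𝐧 := by positivity
  have e10 : ε * p ^ 1 * 𝐧 / p = ε * p ^ 0 * 𝐧 := by field_simp
  have m1 : ε * (p ^ 1 * 𝐧) ≤ c / 5000 * (p ^ 1 * 𝐧) := by gcongr
  have m2 : ε * (p ^ 2 * 𝐧) ≤ c / 5000 * (p ^ 2 * 𝐧) := by gcongr
  have l21 : ε * p ^ 2 * 𝐧 ≤ ε * p ^ 1 * 𝐧 := scale_le hp.le hp1 hε.le (by norm_num)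
  have l20 : ε * p ^ 2 * 𝐧 ≤ ε * p ^ 0 * 𝐧 := scale_le hp.le hp1 hε.le (by norm_num)
  have hc1 : 0 < c * (p ^ 1 * 𝐧) := by positivity
  have hc2 : 0 < c * (p ^ 2 * 𝐧) := by positivity
  have hε2 : 0 < ε * p ^ 2 * 𝐧 := by positivity
  have hnorm := h21.card_biUnion 𝒯 fun T hT =>
    scale_le' hp.le hp1 hε.le (by linarith) (Nat.zero_le _) (h𝒯 T hT)
  have hnorm' : (#(𝒯.biUnion (poor G p)) : ℝ) ≤ 4 * (ε * p ^ 2 * 𝐧) := hnorm.trans (by gcongr)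
  set B := poor G p A₀ ∪ poor G p (nb G [c₀] A₁) ∪ poor G p A₂ ∪ 𝒯.biUnion (poor G p)
  have hB : (#B : ℝ) ≤ 7 * (ε * p ^ 1 * 𝐧) := by
    have h1 := h12 A₀ (scale_le' hp.le hp1 hε.le (by linarith) le_rfl hA₀)
    have h2 := h21 _ (scale_le' hp.le hp1 hε.le (by linarith) le_rfl hA₁)
    have h3 := h21 A₂ (scale_le' hp.le hp1 hε.le (by linarith) (Nat.zero_le _) hA₂)
    have h5 : (#B : ℝ) ≤ #(poor G p A₀) + #(poor G p (nb G [c₀] A₁)) + #(poor G p A₂) +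
        #(𝒯.biUnion (poor G p)) := by
      exact_mod_cast (card_union_le _ _).trans (add_le_add_left ((card_union_le _ _).trans
        (add_le_add_left (card_union_le _ _) _)) _)
    linarith
  -- `D` holds the candidates for `c₁`. For a candidate `d`, `A d` below holds those for `a₁`;
  -- having removed `badApex` makes the pair `a₁`, `d` typical for all of `𝒯`.
  set D := nb G [c₀] C₁ \ B
  have hD : c / 2 * p ^ 1 * 𝐧 ≤ #D := by
    have := card_sdiff_real (nb G [c₀] C₁) B
    change _ ≤ (#D : ℝ) at this
    linarith
  have hDp : ∀ d ∈ D, d ∉ poor G p A₀ ∧ d ∉ poor G p (nb G [c₀] A₁) ∧ d ∉ poor G p A₂ ∧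
      ∀ T ∈ 𝒯, d ∉ poor G p T := fun d hd => by
    have := (mem_sdiff.1 hd).2
    simp only [B, mem_union, mem_biUnion, not_or, not_exists, not_and] at this
    tauto
  set A : V → Finset V := fun d => nb G [d] (nb G [c₀] A₁) \ badApex G p 𝒯 d
  have hA : ∀ d ∈ D, c / 16 * p ^ 2 * 𝐧 ≤ #(A d) := fun d hd => by
    have h1 := card_badApex hp.le hp1 hε.le h21 hεγ h𝒯 hcard (hDp d hd).2.2.2
    have h2 := card_nb_of_notMem_poor hp.le hA₁ (hDp d hd).2.1
    have := card_sdiff_real (nb G [d] (nb G [c₀] A₁)) (badApex G p 𝒯 d)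
    change _ ≤ (#(A d) : ℝ) at this
    norm_num at h2
    linarith
  have hA2 : ∀ d ∈ D, c / 8 * p ^ 1 * 𝐧 ≤ #(nb G [d] A₂) := fun d hd =>
    card_nb_of_notMem_poor hp.le hA₂ (hDp d hd).2.2.1
  set Bd : V → Finset V := fun d => poor G p (A d) ∪ poor G p (nb G [d] A₂)
  have hBd : ∀ d ∈ D, (#(Bd d) : ℝ) ≤ 2 * (ε * p ^ 1 * 𝐧) := fun d hd => by
    have h1 := h12 (A d) (scale_le' hp.le hp1 hε.le (by linarith) le_rfl (hA d hd))
    have h2 := h21 _ (scale_le' hp.le hp1 hε.le (by linarith) le_rfl (hA2 d hd))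
    have h3 : (#(Bd d) : ℝ) ≤ #(poor G p (A d)) + #(poor G p (nb G [d] A₂)) := by
      exact_mod_cast card_union_le _ _
    linarith
  have hE1 := h21.card_exceptional hp (D := D)
    (scale_le' hp.le hp1 hε.le (by linarith) le_rfl hD)
    (lt_of_lt_of_le (by positivity) hD) hBd
  set E1 : Finset V := {u : V | (#{d ∈ D | G.Adj u d ∧ u ∉ Bd d} : ℝ) < p / 16 * #D}
  rw [show 16 * (2 * (ε * p ^ 1 * 𝐧)) / p = 32 * (ε * p ^ 1 * 𝐧 / p) by ring, e10] at hE1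
  have hex : ∀ x : V, ∃ d : V, x ∉ E1 → d ∈ D ∧ G.Adj x d ∧ x ∉ Bd d := fun x => by
    by_cases hx : x ∈ E1
    · exact ⟨x, fun h => absurd hx h⟩
    · have hx' := hx
      simp only [E1, mem_filter, mem_univ, true_and, not_lt] at hx'
      have h1 : (0 : ℝ) < #{d ∈ D | G.Adj x d ∧ x ∉ Bd d} :=
        lt_of_lt_of_le (mul_pos (by positivity) (lt_of_lt_of_le (by positivity) hD)) hx'
      obtain ⟨d, hd⟩ := card_pos.1 (show 0 < #{d ∈ D | G.Adj x d ∧ x ∉ Bd d} by exact_mod_cast h1)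
      exact ⟨d, fun _ => mem_filter.1 hd⟩
  -- One `c₁ = d x` is fixed for each `x`. Thus the candidates for `a₂` depend on `x` only, and the
  -- excluded `y` form a single set of poor vertices.
  choose d hd using hex
  set A' : V → Finset V := fun x => nb G [x] (nb G [d x] A₂) \ badApex G p 𝒯 x
  refine ⟨E1 ∪ 𝒯.biUnion (poor G p), fun x => poor G p (A' x), ?_, fun x hx => ?_⟩
  · have : (#(E1 ∪ 𝒯.biUnion (poor G p)) : ℝ) ≤ #E1 + #(𝒯.biUnion (poor G p)) := by
      exact_mod_cast card_union_le _ _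
    linarith
  · simp only [mem_union, mem_biUnion, not_or, not_exists, not_and] at hx
    obtain ⟨hdD, hxd, hxB⟩ := hd x hx.1
    simp only [Bd, mem_union, not_or] at hxB
    have hA' : c / 128 * p ^ 2 * 𝐧 ≤ #(A' x) := by
      have h1 := card_badApex hp.le hp1 hε.le h21 hεγ h𝒯 hcard hx.2
      have h2 := card_nb_of_notMem_poor hp.le (hA2 _ hdD) hxB.2
      have := card_sdiff_real (nb G [x] (nb G [d x] A₂)) (badApex G p 𝒯 x)
      change _ ≤ (#(A' x) : ℝ) at this
      norm_num at h2
      linarith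
    refine ⟨h12 _ (scale_le' hp.le hp1 hε.le (by linarith) le_rfl hA'), hx.2, fun y hy => ?_⟩
    obtain ⟨a₂, ha₂, hya⟩ := nonempty_of_notMem_poor hy hp (lt_of_lt_of_le (by positivity) hA')
    obtain ⟨a₁, ha₁, hxa⟩ := nonempty_of_notMem_poor hxB.1 hp
      (lt_of_lt_of_le (by positivity) (hA _ hdD))
    obtain ⟨a₀, ha₀, hda⟩ := nonempty_of_notMem_poor (hDp _ hdD).1 hp
      (lt_of_lt_of_le (by positivity) hA₀)
    obtain ⟨ha₂1, ha₂2⟩ := mem_sdiff.1 ha₂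
    obtain ⟨ha₁1, ha₁2⟩ := mem_sdiff.1 ha₁
    obtain ⟨h1, h2⟩ := mem_nb_singleton.1 ha₂1
    obtain ⟨h3, h4⟩ := mem_nb_singleton.1 h1
    obtain ⟨h5, h6⟩ := mem_nb_singleton.1 ha₁1
    obtain ⟨h7, h8⟩ := mem_nb_singleton.1 h5
    obtain ⟨h9, h10⟩ := mem_nb_singleton.1 (mem_sdiff.1 hdD).1
    exact ⟨a₀, ha₀, d x, h9, a₁, h7, a₂, h3, ⟨h10, hda.symm, h8, h6, hxa.symm, hxd.symm, h4, h2,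
      hya.symm⟩, (hDp _ hdD).2.2.2, ha₁2, ha₂2⟩

end

end HamPow

namespace HamPow
open scoped Classical
open Finset

section

variable {V : Type*} [Fintype V] {G : SimpleGraph V} {ε p : ℝ}

local notation "𝐧" => (Fintype.card V : ℝ)

/-- A strip of triangles closing up at `v`: consecutive vertices `cᵢ` form a cycle with `v`, and
`aᵢ` is adjacent to `cᵢ` and to both neighbours of `cᵢ` in this cycle. -/
theorem exists_closed_strip (hp : 0 < p) (hp1 : p ≤ 1) (hε : 0 < ε) (h12 : LowerReg G ε p 1 2)
    (h21 : LowerReg G ε p 2 1) (hN : 1 ≤ ε * p ^ 2 * 𝐧) {c γ : ℝ} (hcγ : c ≤ γ)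
    (hεc : ε ≤ c / 2000000) {U : Finset V} {v : V} {𝒯 : Finset (Finset V)}
    (h𝒯 : ∀ T ∈ 𝒯, γ * p ^ 0 * 𝐧 ≤ #T) (hcard : #𝒯 ≤ 4) (hU : U ∈ 𝒯)
    (hdeg : c * p ^ 1 * 𝐧 ≤ #(nb G [v] U)) :
    ∃ a₀ a₁ a₂ a₃ a₄ a₅ c₀ c₁ c₂ c₃ c₄ c₅ : V,
      [a₀, a₁, a₂, a₃, a₄, a₅, c₀, c₁, c₂, c₃, c₄, c₅].Nodup ∧
      (∀ x ∈ [a₀, a₁, a₂, a₃, a₄, a₅, c₀, c₁, c₂, c₃, c₄, c₅], x ∈ U) ∧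
      (G.Adj v a₀ ∧ G.Adj v c₀ ∧ G.Adj v a₅ ∧ G.Adj v c₅ ∧ G.Adj c₀ c₅) ∧
      (G.Adj c₀ c₁ ∧ G.Adj c₁ c₂ ∧ G.Adj c₂ c₃ ∧ G.Adj c₃ c₄ ∧ G.Adj c₄ c₅) ∧
      (G.Adj a₀ c₀ ∧ G.Adj a₀ c₁) ∧ (G.Adj a₁ c₀ ∧ G.Adj a₁ c₁ ∧ G.Adj a₁ c₂) ∧
      (G.Adj a₂ c₁ ∧ G.Adj a₂ c₂ ∧ G.Adj a₂ c₃) ∧ (G.Adj a₃ c₂ ∧ G.Adj a₃ c₃ ∧ G.Adj a₃ c₄) ∧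
      (G.Adj a₄ c₃ ∧ G.Adj a₄ c₄ ∧ G.Adj a₄ c₅) ∧ (G.Adj a₅ c₄ ∧ G.Adj a₅ c₅) ∧
      ∀ T ∈ 𝒯, Typ G p 2 (γ / 64) [a₀, c₀] T ∧ Typ G p 2 (γ / 64) [a₁, c₁] T ∧
        Typ G p 2 (γ / 64) [a₂, c₂] T ∧ Typ G p 2 (γ / 64) [a₃, c₃] T ∧
        Typ G p 2 (γ / 64) [a₄, c₄] T ∧ Typ G p 2 (γ / 64) [a₅, c₅] T := by
  have hc : 0 < c := by linarith
  have hn : 0 < 𝐧 := by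
    by_contra h
    rw [le_antisymm (not_lt.1 h) (Nat.cast_nonneg _)] at hN; linarith
  have hUU : c * p ^ 0 * 𝐧 ≤ #U := le_trans (by gcongr) (h𝒯 U hU)
  have l21 : ε * p ^ 2 * 𝐧 ≤ ε * p ^ 1 * 𝐧 := scale_le hp.le hp1 hε.le (by norm_num)
  have l20 : ε * p ^ 2 * 𝐧 ≤ ε * p ^ 0 * 𝐧 := scale_le hp.le hp1 hε.le (by norm_num)
  have m0 : ε * (p ^ 0 * 𝐧) ≤ c / 2000000 * (p ^ 0 * 𝐧) := by gcongr
  have m1 : ε * (p ^ 1 * 𝐧) ≤ c / 2000000 * (p ^ 1 * 𝐧) := by gcongr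
  have m2 : ε * (p ^ 2 * 𝐧) ≤ c / 2000000 * (p ^ 2 * 𝐧) := by gcongr
  have hc0 : 0 < c * (p ^ 0 * 𝐧) := by positivity
  have hc1 : 0 < c * (p ^ 1 * 𝐧) := by positivity
  have hc2 : 0 < c * (p ^ 2 * 𝐧) := by positivity
  -- The four vertices adjacent to `v`, namely `a₀`, `a₅`, `c₀`, `c₅`, come from the sets `F 0`, …,
  -- `F 3` inside N(v); the others come from `U` at large.
  obtain ⟨F, hF, hd⟩ := exists_disjoint_subsets_real 12
    (fun i => if i < 4 then nb G [v] U else U)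
    (fun i => c / 24 * p ^ (1 - i / 4) * 𝐧) (fun i j hij => scale_le hp.le hp1 (by positivity)
      (Nat.sub_le_sub_left (Nat.div_le_div_right hij) 1))
    (by
      simp only [Nat.zero_div, Nat.sub_zero]
      linarith)
    (fun i hi => by
      have e24 : ∀ a : ℕ, 2 * ((12 : ℕ) : ℝ) * (c / 24 * p ^ a * 𝐧) = c * p ^ a * 𝐧 := fun a => by
        push_cast; ring
      rw [e24]
      interval_cases i <;> first | exact hdeg | exact hUU)
  have hs := fun i hi => (hF i hi).2.1
  have hs0 : ∀ i < 12, c / 24 * p ^ 1 * 𝐧 ≤ #(F i) := fun i hi =>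
    (scale_le hp.le hp1 (by positivity) (by omega)).trans (hs i hi)
  have hs4 : ∀ i < 12, 4 ≤ i → c / 24 * p ^ 0 * 𝐧 ≤ #(F i) := fun i hi h4 =>
    (scale_le hp.le hp1 (by positivity) (by omega)).trans (hs i hi)
  have hpoorF : ∀ i < 12, (#(poor G p (F i)) : ℝ) ≤ ε * p ^ 2 * 𝐧 := fun i hi =>
    h21 _ (scale_le' hp.le hp1 hε.le (by linarith) le_rfl (hs0 i hi))
  have hnorm := h21.card_biUnion 𝒯 fun T hT =>
    scale_le' hp.le hp1 hε.le (by linarith) (Nat.zero_le _) (h𝒯 T hT)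
  have hnorm' : (#(𝒯.biUnion (poor G p)) : ℝ) ≤ 4 * (ε * p ^ 2 * 𝐧) := by
    have h4 : (#𝒯 : ℝ) ≤ 4 := by exact_mod_cast hcard
    exact hnorm.trans (by gcongr)
  obtain ⟨c₀, hc₀, hc₀B⟩ := exists_mem_notMem_of_card (C := F 2)
    (B := poor G p (F 0) ∪ poor G p (F 3) ∪ poor G p (F 4) ∪ poor G p (F 5) ∪
      𝒯.biUnion (poor G p)) (by
    have h5 := (card_union_le (poor G p (F 0) ∪ poor G p (F 3) ∪ poor G p (F 4) ∪ poor G p (F 5))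
      (𝒯.biUnion (poor G p))).trans (add_le_add_left ((card_union_le _ _).trans
        (add_le_add_left ((card_union_le _ _).trans
        (add_le_add_left (card_union_le _ _) _)) _)) _)
    have h6 : (#(poor G p (F 0) ∪ poor G p (F 3) ∪ poor G p (F 4) ∪ poor G p (F 5) ∪
      𝒯.biUnion (poor G p)) : ℝ) ≤ #(poor G p (F 0)) + #(poor G p (F 3)) + #(poor G p (F 4)) +
        #(poor G p (F 5)) + #(𝒯.biUnion (poor G p)) := by exact_mod_cast h5
    have := hs0 2 (by norm_num)
    have := hpoorF 0 (by norm_num)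
    have := hpoorF 3 (by norm_num)
    have := hpoorF 4 (by norm_num)
    have := hpoorF 5 (by norm_num)
    linarith)
  simp only [mem_union, mem_biUnion, not_or, not_exists, not_and] at hc₀B
  obtain ⟨⟨⟨⟨hc₀0, hc₀3⟩, hc₀4⟩, hc₀5⟩, hc₀𝒯⟩ := hc₀B
  have d3 := card_nb_of_notMem_poor hp.le (hs0 3 (by norm_num)) hc₀3
  norm_num at d3
  obtain ⟨c₅, hc₅', hc₅B⟩ := exists_mem_notMem_of_card (C := nb G [c₀] (F 3))
    (B := poor G p (F 1) ∪ poor G p (F 8) ∪ poor G p (F 9) ∪ 𝒯.biUnion (poor G p)) (by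
    have h5 := (card_union_le (poor G p (F 1) ∪ poor G p (F 8) ∪ poor G p (F 9))
      (𝒯.biUnion (poor G p))).trans (add_le_add_left ((card_union_le _ _).trans
        (add_le_add_left (card_union_le _ _) _)) _)
    have h6 : (#(poor G p (F 1) ∪ poor G p (F 8) ∪ poor G p (F 9) ∪ 𝒯.biUnion (poor G p)) : ℝ) ≤
        #(poor G p (F 1)) + #(poor G p (F 8)) + #(poor G p (F 9)) +
        #(𝒯.biUnion (poor G p)) := by exact_mod_cast h5
    have := hpoorF 1 (by norm_num)
    have := hpoorF 8 (by norm_num)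
    have := hpoorF 9 (by norm_num)
    linarith)
  simp only [mem_union, mem_biUnion, not_or, not_exists, not_and] at hc₅B
  obtain ⟨⟨⟨hc₅1, hc₅8⟩, hc₅9⟩, hc₅𝒯⟩ := hc₅B
  obtain ⟨hc₅, hc₀₅⟩ := mem_nb_singleton.1 hc₅'
  have hεγ : ε ≤ γ / 8 := by linarith
  have hA : ∀ (x : V) (i : ℕ), i < 12 → x ∉ poor G p (F i) → (∀ T ∈ 𝒯, x ∉ poor G p T) →
      c / 400 * p ^ 2 * 𝐧 ≤ #(nb G [x] (F i) \ badApex G p 𝒯 x) := fun x i hi hx hx𝒯 => by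
    have h1 := card_badApex hp.le hp1 hε.le h21 hεγ h𝒯 hcard hx𝒯
    have h2 := card_nb_of_notMem_poor hp.le (hs0 i hi) hx
    have := card_sdiff_real (nb G [x] (F i)) (badApex G p 𝒯 x)
    norm_num at h2
    linarith
  have hD : ∀ (x : V) (i : ℕ), i < 12 → 4 ≤ i → x ∉ poor G p (F i) →
      c / 400 * p ^ 1 * 𝐧 ≤ #(nb G [x] (F i)) := fun x i hi h4 hx => by
    have h2 := card_nb_of_notMem_poor hp.le (hs4 i hi h4) hx
    norm_num at h2 ⊢
    linarith
  have hF0 : ∀ i < 12, 4 ≤ i → c / 400 * p ^ 0 * 𝐧 ≤ #(F i) := fun i hi h4 => by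
    have := hs4 i hi h4
    linarith
  obtain ⟨E, Bad, hE, hEx⟩ := half_strip hp hp1 hε h12 h21 hn (c := c / 400) (by linarith) hεγ h𝒯
    hcard (hA c₀ 0 (by norm_num) hc₀0 hc₀𝒯) (hD c₀ 4 (by norm_num) (by norm_num) hc₀4)
    (hD c₀ 5 (by norm_num) (by norm_num) hc₀5) (hF0 6 (by norm_num) (by norm_num))
  obtain ⟨E', Bad', hE', hEx'⟩ := half_strip hp hp1 hε h12 h21 hn (c := c / 400) (by linarith) hεγ
    h𝒯 hcard (hA c₅ 1 (by norm_num) hc₅1 hc₅𝒯) (hD c₅ 8 (by norm_num) (by norm_num) hc₅8)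
    (hD c₅ 9 (by norm_num) (by norm_num) hc₅9) (hF0 10 (by norm_num) (by norm_num))
  -- The half strips starting at `c₀` and `c₅` are to meet in an edge `c₂c₃`. A suitable `c₃` has
  -- order pn neighbours `c₂` in `D` with `c₃ ∉ Bad c₂`, and at most ε p n of them lie in `Bad' c₃`.
  set D := F 7 \ E
  have hDc : c / 48 * p ^ 0 * 𝐧 ≤ #D := by
    have h1 := card_sdiff_real (F 7) E
    change _ ≤ (#D : ℝ) at h1
    have := hs4 7 (by norm_num) (by norm_num)
    linarith
  have hE3 := h21.card_exceptional hp (D := D)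
    (scale_le' hp.le hp1 hε.le (by linarith) (Nat.zero_le _) hDc)
    (lt_of_lt_of_le (by positivity) hDc) (B := Bad) (b := ε * p ^ 1 * 𝐧)
    fun x hx => (hEx x (mem_sdiff.1 hx).2).1
  set E3 : Finset V := {u : V | (#{d ∈ D | G.Adj u d ∧ u ∉ Bad d} : ℝ) < p / 16 * #D}
  rw [mul_div_assoc, show ε * p ^ 1 * 𝐧 / p = ε * p ^ 0 * 𝐧 by field_simp] at hE3
  obtain ⟨c₃, hc₃, hc₃B⟩ := exists_mem_notMem_of_card (C := F 11) (B := E' ∪ E3) (by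
    have h1 : (#(E' ∪ E3) : ℝ) ≤ #E' + #E3 := by exact_mod_cast card_union_le _ _
    have := hs4 11 (by norm_num) (by norm_num)
    linarith)
  rw [mem_union, not_or] at hc₃B
  obtain ⟨hb1, hb2, hb3⟩ := hEx' c₃ hc₃B.1
  have hc₃D := hc₃B.2
  simp only [E3, mem_filter, mem_univ, true_and, not_lt] at hc₃D
  obtain ⟨c₂, hc₂', hc₂B⟩ := exists_mem_notMem_of_card (B := Bad' c₃) (lt_of_lt_of_le (by
    have : p / 16 * (c / 48 * p ^ 0 * 𝐧) ≤ p / 16 * #D := by gcongr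
    linarith) hc₃D)
  obtain ⟨hc₂D, hc₃₂, hc₃Bad⟩ := mem_filter.1 hc₂'
  obtain ⟨hc₂, hc₂E⟩ := mem_sdiff.1 hc₂D
  obtain ⟨a₀, ha₀', c₁, hc₁, a₁, ha₁, a₂, ha₂, ⟨f1, f2, f3, f4, f5, f6, f7, f8, f9⟩, hc₁𝒯, ha₁𝒯,
    ha₂𝒯⟩ := (hEx c₂ hc₂E).2.2 c₃ hc₃Bad
  have hc₂𝒯 := (hEx c₂ hc₂E).2.1
  obtain ⟨a₅, ha₅', c₄, hc₄, a₄, ha₄, a₃, ha₃, ⟨g1, g2, g3, g4, g5, g6, g7, g8, g9⟩, hc₄𝒯, ha₄𝒯,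
    ha₃𝒯⟩ := hb3 c₂ hc₂B
  obtain ⟨ha₀'', ha₀𝒯⟩ := mem_sdiff.1 ha₀'
  obtain ⟨ha₅'', ha₅𝒯⟩ := mem_sdiff.1 ha₅'
  obtain ⟨ha₀, hca₀⟩ := mem_nb_singleton.1 ha₀''
  obtain ⟨ha₅, hca₅⟩ := mem_nb_singleton.1 ha₅''
  have hv : ∀ i < 4, ∀ x ∈ F i, x ∈ U ∧ G.Adj v x := fun i hi x hx => by
    have := (hF i (by omega)).1 hx
    rw [if_pos hi] at this
    exact mem_nb_singleton.1 this
  have hsub : ∀ i < 12, F i ⊆ U := fun i hi => by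
    refine (hF i hi).1.trans ?_
    split_ifs
    exacts [nb_subset, subset_rfl]
  have ht := fun {a x : V} (h1 : ∀ T ∈ 𝒯, x ∉ poor G p T) (h2 : a ∉ badApex G p 𝒯 x) {T} hT =>
    typ_of_notMem_badApex hp.le (hc.le.trans hcγ) h𝒯 h1 h2 (T := T) hT
  refine ⟨a₀, a₁, a₂, a₃, a₄, a₅, c₀, c₁, c₂, c₃, c₄, c₅, ?_, ?_,
    ⟨(hv 0 (by norm_num) _ ha₀).2, (hv 2 (by norm_num) _ hc₀).2, (hv 1 (by norm_num) _ ha₅).2,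
      (hv 3 (by norm_num) _ hc₅).2, hc₀₅⟩, ⟨f1, f6, hc₃₂.symm, g6.symm, g1.symm⟩,
    ⟨hca₀.symm, f2⟩, ⟨f3.symm, f4.symm, f5⟩, ⟨f7.symm, f8.symm, f9⟩, ⟨g9, g8.symm, g7.symm⟩,
    ⟨g5, g4.symm, g3.symm⟩, ⟨g2, hca₅.symm⟩, fun T hT => ⟨ht hc₀𝒯 ha₀𝒯 hT, ht hc₁𝒯 ha₁𝒯 hT,
      ht hc₂𝒯 ha₂𝒯 hT, ht hb2 ha₃𝒯 hT, ht hc₄𝒯 ha₄𝒯 hT, ht hc₅𝒯 ha₅𝒯 hT⟩⟩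
  · exact nodup_of_forall₂ hd (s := [0, 5, 6, 10, 9, 1, 2, 4, 7, 11, 8, 3])
      (by simp [*]) (by decide) (by decide)
  · simp only [List.mem_cons, List.not_mem_nil, or_false, forall_eq_or_imp, forall_eq]
    exact ⟨hsub 0 (by norm_num) ha₀, hsub 5 (by norm_num) ha₁, hsub 6 (by norm_num) ha₂,
      hsub 10 (by norm_num) ha₃, hsub 9 (by norm_num) ha₄, hsub 1 (by norm_num) ha₅,
      hsub 2 (by norm_num) hc₀, hsub 4 (by norm_num) hc₁, hsub 7 (by norm_num) hc₂,
      hsub 11 (by norm_num) hc₃, hsub 8 (by norm_num) hc₄, hsub 3 (by norm_num) hc₅⟩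

/-- In the closed strip, v c₀ c₁ … c₅ is a cycle and `aᵢ` is joined to `cᵢ` and both its neighbours
on the cycle. Each segment `aᵢ cᵢ cᵢ₊₁ aᵢ₊₁` is a square of a path. Without `v`, the segments c₁c₀,
c₂c₃, c₅c₄ are used; with `v`, the segments c₁c₂, c₀vc₅, c₃c₄. The same two connections `m₁`, `m₂`,
traversed in opposite directions, link the segments in both cases, and the outer ends a₁c₁ and c₄a₄
agree. -/
theorem gad_square (hp : 0 < p) (hp1 : p ≤ 1) (hε : 0 < ε) (h12 : LowerReg G ε p 1 2)
    (h21 : LowerReg G ε p 2 1) (hu : UpperReg G ε p 1 2) (hN : 1 ≤ ε * p ^ 2 * 𝐧) {c γ : ℝ}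
    (hcγ : c ≤ γ) (hγ : γ ≤ 1) (hεc : ε ≤ c / 20000000) : Gad G 2 p c γ (γ / 64) 34 := by
  intro U v 𝒯 hU hvU hdeg hcard h𝒯
  have hc : 0 < c := by linarith
  have hn : 0 < 𝐧 := by
    by_contra h
    rw [le_antisymm (not_lt.1 h) (Nat.cast_nonneg _)] at hN; linarith
  obtain ⟨a₀, a₁, a₂, a₃, a₄, a₅, c₀, c₁, c₂, c₃, c₄, c₅, hnd, hin, ⟨v1, v2, v3, v4, v5⟩,
    ⟨b1, b2, b3, b4, b5⟩, ⟨d1, d2⟩, ⟨d3, d4, d5⟩, ⟨d6, d7, d8⟩, ⟨d9, d10, d11⟩, ⟨d12, d13, d14⟩,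
    ⟨d15, d16⟩, hT⟩ := exists_closed_strip hp hp1 hε h12 h21 hN hcγ (by linarith)
      (𝒯 := insert U 𝒯) (U := U) (v := v) (by
        intro T hT
        rw [pow_zero, mul_one]
        rcases mem_insert.1 hT with rfl | hT
        exacts [hU, h𝒯 T hT])
      ((card_insert_le _ _).trans (by omega)) (mem_insert_self _ _) (by simpa using hdeg)
  obtain ⟨t0, t1, t2, t3, t4, t5⟩ := hT U (mem_insert_self _ _)
  set S := [a₀, a₁, a₂, a₃, a₄, a₅, c₀, c₁, c₂, c₃, c₄, c₅] with hS
  have hconn : Conn G 2 p (γ / 128) (γ / 2) 11 := conn_square hp hp1 hε h12 h21 hu hN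
    (by linarith) (by linarith) (by linarith)
  -- The second connection has to avoid 12 + 11 = 23 vertices; with its own 11 vertices, the total
  -- is 34.
  have hbig : 23 ≤ γ / 128 * p ^ 2 * 𝐧 := by
    have h1 : ε * (p ^ 2 * 𝐧) ≤ γ / 20000000 * (p ^ 2 * 𝐧) := by gcongr; linarith
    linarith
  have hbig' : γ / 128 * p ^ 2 * 𝐧 ≤ γ / 128 * p ^ 0 * 𝐧 :=
    scale_le hp.le hp1 (by linarith) (by norm_num)
  have key : ∀ (D : List V) (a x a' x' : V), D.length ≤ 23 → G.Adj a x → G.Adj a' x' →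
      Typ G p 2 (γ / 64) [a, x] U → Typ G p 2 (γ / 64) [a', x'] U →
      ∃ m : List V, (∀ y ∈ m, y ∈ U ∧ y ∉ D) ∧ m.Nodup ∧ m.length ≤ 11 ∧
        KAdj G 2 ([x, a] ++ (m ++ [a', x'])) := by
    intro D a x a' x' hD h1 h2 h3 h4
    have hD' : (#D.toFinset : ℝ) ≤ 23 := by
      exact_mod_cast (List.toFinset_card_le D).trans hD
    have hsd : ∀ {e : List V}, Typ G p 2 (γ / 64) e U → Typ G p 2 (γ / 128) e (U \ D.toFinset) :=
      fun h => h.sdiff hp.le hp1 (by linarith) (by linarith)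
    obtain ⟨m, hm1, hm2, hm3, hm4⟩ := hconn (U \ D.toFinset) [a, x] [a', x'] (by
      have := card_sdiff_real U D.toFinset
      linarith) rfl rfl (by simp [KAdj, h1]) (by simp [KAdj, h2]) (hsd h3) (hsd h4)
    exact ⟨m, fun y hy => by simpa using hm1 y hy, hm2, hm3, by simpa using hm4⟩
  obtain ⟨m₁, hm₁, hm₁n, hm₁l, hm₁k⟩ := key S a₂ c₂ a₀ c₀ (by simp [hS]) d7 d1 t2 t0
  obtain ⟨m₂, hm₂, hm₂n, hm₂l, hm₂k⟩ := key (S ++ m₁) a₅ c₅ a₃ c₃ (by simp [hS]; omega) d16 d10 t5 t3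
  have hm₁r : KAdj G 2 ([c₀, a₀] ++ (m₁.reverse ++ [a₂, c₂])) := by simpa using hm₁k.reverse
  have hm₂r : KAdj G 2 ([c₃, a₃] ++ (m₂.reverse ++ [a₅, c₅])) := by simpa using hm₂k.reverse
  set l := [a₁, c₁, c₀, a₀] ++ m₁.reverse ++ [a₂, c₂, c₃, a₃] ++ m₂.reverse ++ [a₅, c₅, c₄, a₄]
  set l' := [a₁, c₁, c₂, a₂] ++ m₁ ++ [a₀, c₀, v, c₅, a₅] ++ m₂ ++ [a₃, c₃, c₄, a₄]
  have hl : KAdj G 2 l := by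
    have e1 : KAdj G 2 ([a₁, c₁] ++ [c₀, a₀]) := by
      simp [KAdj, d4, d3, b1.symm, d2.symm, d1.symm]
    have e2 := KAdj.glue (by simp) e1 hm₁r
    have e3 : KAdj G 2 ([a₂, c₂] ++ [c₃, a₃]) := by
      simp [KAdj, d7, d8, b3, d9.symm, d10.symm]
    have e4 := KAdj.glue (A := [a₁, c₁, c₀, a₀] ++ m₁.reverse) (by simp) (by simpa using e2) e3
    have e5 := KAdj.glue (A := [a₁, c₁, c₀, a₀] ++ m₁.reverse ++ [a₂, c₂]) (by simp)
      (by simpa using e4) hm₂r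
    have e6 : KAdj G 2 ([a₅, c₅] ++ [c₄, a₄]) := by
      simp [KAdj, d16, d15, b5.symm, d14.symm, d13.symm]
    have e7 := KAdj.glue
      (A := [a₁, c₁, c₀, a₀] ++ m₁.reverse ++ [a₂, c₂, c₃, a₃] ++ m₂.reverse) (by simp)
      (by simpa using e5) e6
    simpa [l] using e7
  have hl' : KAdj G 2 l' := by
    have e1 : KAdj G 2 ([a₁, c₁] ++ [c₂, a₂]) := by
      simp [KAdj, d4, d5, b2, d6.symm, d7.symm]
    have e2 := KAdj.glue (by simp) e1 hm₁k
    have e3 : KAdj G 2 ([a₀, c₀] ++ [v, c₅, a₅]) := by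
      simp [KAdj, d1, v1.symm, v2.symm, v5, v4, v3, d16.symm]
    have e4 := KAdj.glue (A := [a₁, c₁, c₂, a₂] ++ m₁) (by simp) (by simpa using e2) e3
    have e5 := KAdj.glue (A := [a₁, c₁, c₂, a₂] ++ m₁ ++ [a₀, c₀, v]) (by simp)
      (by simpa using e4) hm₂k
    have e6 : KAdj G 2 ([a₃, c₃] ++ [c₄, a₄]) := by
      simp [KAdj, d10, d11, b4, d12.symm, d13.symm]
    have e7 := KAdj.glue
      (A := [a₁, c₁, c₂, a₂] ++ m₁ ++ [a₀, c₀, v, c₅, a₅] ++ m₂) (by simp)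
      (by simpa using e5) e6
    simpa [l'] using e7
  have hperm : l.Perm (S ++ m₁ ++ m₂) := by
    rw [List.perm_iff_count]
    intro x
    simp only [l, hS, List.count_append, List.count_cons, List.count_reverse, List.count_nil]
    ring
  have hperm' : l'.Perm (v :: l) := by
    rw [List.perm_iff_count]
    intro x
    simp only [l, l', List.count_append, List.count_cons, List.count_reverse, List.count_nil]
    ring
  have hlU : ∀ x ∈ l, x ∈ U := by
    intro x hx
    rw [hperm.mem_iff, List.mem_append, List.mem_append] at hx
    rcases hx with (hx | hx) | hx
    exacts [hin x hx, (hm₁ x hx).1, (hm₂ x hx).1]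
  have hln : l.Nodup := by
    rw [hperm.nodup_iff, List.nodup_append', List.nodup_append']
    exact ⟨⟨hnd, hm₁n, fun x hx hx' => (hm₁ x hx').2 hx⟩, hm₂n, fun x hx hx' => (hm₂ x hx').2 hx⟩
  refine ⟨l, l', hl, hl', hln, ?_, ?_, hlU, by simp [l], ?_, by simp [l, l'], by simp [l, l'], ?_,
    fun T hT' => ?_⟩
  · rw [hperm'.nodup_iff, List.nodup_cons]
    exact ⟨fun h => hvU (hlU v h), hln⟩
  · rw [List.toFinset_eq_of_perm _ _ hperm', List.toFinset_cons]
  · rw [hperm.length_eq]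
    simp [hS]; omega
  · simpa [l] using t1
  · simpa [l] using (hT T (mem_insert_of_mem hT')).2.2.2.2.1

end

end HamPow

/-! ### Trees of lists and what can be reached from them. -/

namespace HamPow
open scoped Classical
open Finset

/-- There are at least `b` choices for a first vertex, for each of them at least `b` choices for a
second vertex, and so on, such that the resulting list of length `m` satisfies `P`. -/
def Many {V : Type*} (b : ℝ) : ℕ → (List V → Prop) → Prop
  | 0, P => P []
  | m + 1, P => ∃ D : Finset V, b ≤ #D ∧ ∀ d ∈ D, Many b m fun l => P (d :: l)

/-- For all but at most `s i` choices of a first vertex, all but at most `s (i + 1)` choices of a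
second vertex, and so on, the resulting list of length `m` satisfies `P`. -/
def AllBut {V : Type*} (s : ℕ → ℝ) : ℕ → ℕ → (List V → Prop) → Prop
  | 0, _, P => P []
  | m + 1, i, P => ∃ E : Finset V, (#E : ℝ) ≤ s i ∧ ∀ u ∉ E, AllBut s m (i + 1) fun l => P (u :: l)

/-- Some list satisfying `P` has its `j`th member adjacent to the `i`th member of the given list
for all `i ≤ j`. -/
def Reach {V : Type*} (G : SimpleGraph V) : (List V → Prop) → List V → Prop
  | P, [] => P []
  | P, u :: us => ∃ w, G.Adj u w ∧ Reach G (fun l => P (w :: l) ∧ ∀ x ∈ l, G.Adj u x) us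

section

variable {V : Type*} {G : SimpleGraph V}

theorem Many.mono {b : ℝ} {m : ℕ} {P Q : List V → Prop} (h : Many b m P) (hPQ : ∀ l, P l → Q l) :
    Many b m Q := by
  induction m generalizing P Q with
  | zero => exact hPQ _ h
  | succ m ih =>
    obtain ⟨D, hD, h⟩ := h
    exact ⟨D, hD, fun d hd => ih (h d hd) fun l => hPQ _⟩

theorem AllBut.mono {s : ℕ → ℝ} {m i : ℕ} {P Q : List V → Prop} (h : AllBut s m i P)
    (hPQ : ∀ l, P l → Q l) : AllBut s m i Q := by
  induction m generalizing i P Q with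
  | zero => exact hPQ _ h
  | succ m ih =>
    obtain ⟨D, hD, h⟩ := h
    exact ⟨D, hD, fun d hd => ih (h d hd) fun l => hPQ _⟩

theorem Reach.mono {P Q : List V → Prop} {us : List V} (h : Reach G P us)
    (hPQ : ∀ l, P l → Q l) : Reach G Q us := by
  induction us generalizing P Q with
  | nil => exact hPQ _ h
  | cons u us ih =>
    obtain ⟨w, huw, h⟩ := h
    exact ⟨w, huw, ih h fun l hl => ⟨hPQ _ hl.1, hl.2⟩⟩

theorem Reach.exists {P : List V → Prop} {us : List V} (h : Reach G P us) :
    ∃ ws : List V, ∃ hl : ws.length = us.length, P ws ∧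
      ∀ (i j : ℕ) (hij : i ≤ j) (hj : j < us.length), G.Adj us[i] (ws[j]'(by omega)) := by
  induction us generalizing P with
  | nil => exact ⟨[], rfl, h, by simp⟩
  | cons u us ih =>
    obtain ⟨w, huw, h⟩ := h
    obtain ⟨ws, hl, ⟨hP, hu⟩, hadj⟩ := ih h
    refine ⟨w :: ws, by simp [hl], hP, fun i j hij hj => ?_⟩
    cases i with
    | zero =>
      cases j with
      | zero => simpa using huw
      | succ j => simpa using hu _ (List.getElem_mem _)
    | succ i =>
      obtain ⟨j, rfl⟩ : ∃ j', j = j' + 1 := ⟨j - 1, by omega⟩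
      simp only [List.length_cons, Nat.add_lt_add_iff_right] at hj
      simpa using hadj i j (by omega) hj

variable [Fintype V] {ε p : ℝ} {k : ℕ}

local notation "𝐧" => (Fintype.card V : ℝ)

/-- All but few vertices retain a large part of a tree of lists in their neighbourhood. -/
theorem Many.restrict (hp : 0 < p) (hp1 : p ≤ 1) (hε : 0 ≤ ε)
    (h : LowerReg G ε p (k - 1) (2 * k - 1)) {b : ℝ} (hb : ε * p ^ (2 * k - 1) * 𝐧 ≤ b)
    (hb0 : 0 < b) {m : ℕ} (hm : m ≤ k) {P : List V → Prop} (hP : Many b m P) :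
    ∃ E : Finset V, (#E : ℝ) ≤ (17 ^ m - 1) * (ε * p ^ (k - m) * 𝐧) ∧ ∀ u ∉ E,
      Many (p * b / 16) m fun l => P l ∧ ∀ x ∈ l, G.Adj u x := by
  induction m generalizing P with
  | zero => exact ⟨∅, by simp, fun u _ => ⟨hP, by simp⟩⟩
  | succ m ih =>
    obtain ⟨D, hD, hDP⟩ := hP
    have hex : ∀ d : V, ∃ E : Finset V, d ∈ D →
        (#E : ℝ) ≤ (17 ^ m - 1) * (ε * p ^ (k - m) * 𝐧) ∧ ∀ u ∉ E,
        Many (p * b / 16) m fun l => P (d :: l) ∧ ∀ x ∈ l, G.Adj u x := fun d => by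
      by_cases hd : d ∈ D
      · obtain ⟨E, hE⟩ := ih (by omega) (hDP d hd)
        exact ⟨E, fun _ => hE⟩
      · exact ⟨∅, fun h => absurd h hd⟩
    choose E hE using hex
    -- Averaging over the roots `d` multiplies the bound for the subtrees by 16/p, and the vertices
    -- poor for `D` add one more term: 16(17^m - 1) + 1 ≤ 17^(m+1) - 1.
    have hE' := h.card_exceptional hp (D := D) (hb.trans hD) (hb0.trans_le hD) (B := E)
      fun d hd => (hE d hd).1
    refine ⟨_, hE'.trans ?_, fun u hu => ?_⟩
    · have e1 : p ^ (k - m) = p ^ (k - (m + 1)) * p := by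
        rw [← pow_succ]; congr 1; omega
      have e2 : 16 * ((17 ^ m - 1) * (ε * p ^ (k - m) * 𝐧)) / p =
          16 * (17 ^ m - 1) * (ε * p ^ (k - (m + 1)) * 𝐧) := by
        rw [e1]; field_simp
      have e3 : ε * p ^ (k - 1) * 𝐧 ≤ ε * p ^ (k - (m + 1)) * 𝐧 :=
        scale_le hp.le hp1 hε (by omega)
      have e4 : 0 ≤ ε * p ^ (k - (m + 1)) * 𝐧 := by positivity
      have e5 : (1 : ℝ) ≤ 17 ^ m := one_le_pow₀ (by norm_num)
      rw [e2, pow_succ]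
      nlinarith
    · simp only [mem_filter, mem_univ, true_and, not_lt] at hu
      refine ⟨_, le_trans ?_ hu, fun d hd => ?_⟩
      · have : p * b ≤ p * #D := by gcongr
        linarith
      · obtain ⟨hdD, hud, huE⟩ := mem_filter.1 hd
        refine ((hE d hdD).2 u huE).mono fun l hl => ⟨hl.1, fun x hx => ?_⟩
        rcases List.mem_cons.1 hx with rfl | hx
        exacts [hud, hl.2 x hx]

/-- Almost all lists are reached from the leaves of a large tree. -/
theorem Many.allBut_reach (hp : 0 < p) (hp1 : p ≤ 1) (hε : 0 ≤ ε)
    (h : LowerReg G ε p (k - 1) (2 * k - 1)) {b : ℝ} (hb0 : 0 < b) {m i : ℕ} (hm : i + m = k)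
    (hb : 0 < m → ε * p ^ (2 * k - 1) * 𝐧 ≤ b * (p / 16) ^ (m - 1)) {P : List V → Prop}
    (hP : Many b m P) : AllBut (fun i => 17 ^ k * ε * p ^ i * 𝐧) m i (Reach G P) := by
  induction m generalizing i b P with
  | zero => exact hP
  | succ m ih =>
    have hb' : ε * p ^ (2 * k - 1) * 𝐧 ≤ b := (hb m.succ_pos).trans
      (mul_le_of_le_one_right hb0.le (pow_le_one₀ (by positivity) (by linarith)))
    -- Each `u` restricts the tree to its neighbourhood, which costs a factor p/16 in the branching;
    -- then a root `d` is fixed and the next `u` faces a tree of smaller depth. The number of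
    -- excluded vertices in position `i` is of order p^i n, matching the number of candidates for
    -- that place in a clique.
    obtain ⟨E, hE, hE'⟩ := hP.restrict hp hp1 hε h hb' hb0 (by omega)
    refine ⟨E, hE.trans ?_, fun u hu => ?_⟩
    · rw [show k - (m + 1) = i by omega]
      have : (17 : ℝ) ^ (m + 1) ≤ 17 ^ k := pow_le_pow_right₀ (by norm_num) (by omega)
      have h0 : 0 ≤ ε * p ^ i * 𝐧 := by positivity
      calc (17 ^ (m + 1) - 1) * (ε * p ^ i * 𝐧) ≤ 17 ^ k * (ε * p ^ i * 𝐧) := by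
            gcongr; linarith
        _ = _ := by ring
    · obtain ⟨D, hD, hDP⟩ := hE' u hu
      have hb1 : 0 < p * b / 16 := by positivity
      have : (0 : ℝ) < #D := hb1.trans_le hD
      obtain ⟨d, hd⟩ := card_pos.1 (show 0 < #D by exact_mod_cast this)
      have key := ih (b := p * b / 16) hb1 (i := i + 1) (by omega) (fun hm0 => by
        refine (hb m.succ_pos).trans (le_of_eq ?_)
        obtain ⟨m, rfl⟩ : ∃ m', m = m' + 1 := ⟨m - 1, by omega⟩
        simp only [Nat.add_sub_cancel]
        rw [pow_succ]; ring) (hDP d hd)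
      refine key.mono fun l hl => ⟨d, ?_, hl.mono fun l hl => ⟨hl.1, fun x hx => hl.2 x ?_⟩⟩
      · obtain ⟨ws, -, hws, -⟩ := hl.exists
        exact hws.2 d (by simp)
      · simp [hx]

end

end HamPow

/-! ### Counting lists. -/

namespace HamPow
open scoped Classical
open Finset

/-- The number of lists of length `m` satisfying `P`. -/
noncomputable def cnt {V : Type*} [Fintype V] : ℕ → (List V → Prop) → ℝ
  | 0, P => if P [] then 1 else 0
  | m + 1, P => ∑ v : V, cnt m fun l => P (v :: l)

/-- Continuing the reversed list `r`, each member of the given list is a common neighbour of its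
predecessors in a prescribed set, where these common neighbourhoods are small. -/
def Bdd {V : Type*} (G : SimpleGraph V) (U : ℕ → Finset V) (s : ℕ → ℝ) : List V → List V → Prop
  | _, [] => True
  | r, u :: us => u ∈ nb G r (U r.length) ∧ (#(nb G r (U r.length)) : ℝ) ≤ s r.length ∧
      Bdd G U s (u :: r) us

section

variable {V : Type*} [Fintype V] {P Q : List V → Prop} {m : ℕ}

theorem cnt_nonneg : 0 ≤ cnt m P := by
  induction m generalizing P with
  | zero => simp only [cnt]; split_ifs <;> norm_num
  | succ m ih => exact sum_nonneg fun v _ => ih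

theorem cnt_mono (h : ∀ l, l.length = m → P l → Q l) : cnt m P ≤ cnt m Q := by
  induction m generalizing P Q with
  | zero =>
    have := h [] rfl
    simp only [cnt]; split_ifs <;> simp_all
  | succ m ih =>
    exact sum_le_sum fun v _ => ih fun l hl => h (v :: l) (by simp [hl])

theorem cnt_or : cnt m (fun l => P l ∨ Q l) ≤ cnt m P + cnt m Q := by
  induction m generalizing P Q with
  | zero =>
    simp only [cnt]; split_ifs <;> simp_all
  | succ m ih =>
    simp only [cnt]
    rw [← sum_add_distrib]
    exact sum_le_sum fun v _ => ih

theorem cnt_eq_zero (h : ∀ l, l.length = m → ¬ P l) : cnt m P = 0 := by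
  induction m generalizing P with
  | zero => simp [cnt, h []]
  | succ m ih => exact sum_eq_zero fun v _ => ih fun l hl => h (v :: l) (by simp [hl])

theorem exists_of_cnt_pos (h : 0 < cnt m P) : ∃ l, l.length = m ∧ P l := by
  by_contra! hc
  exact h.ne' (cnt_eq_zero hc)

theorem cnt_succ' : cnt (m + 1) P = ∑ v : V, cnt m fun l => P (l ++ [v]) := by
  induction m generalizing P with
  | zero => simp [cnt]
  | succ m ih =>
    calc cnt (m + 1 + 1) P = ∑ v : V, ∑ w : V, cnt m fun l => P (v :: (l ++ [w])) :=
          sum_congr rfl fun v _ => ih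
      _ = ∑ w : V, ∑ v : V, cnt m fun l => P (v :: (l ++ [w])) := sum_comm
      _ = _ := rfl

theorem cnt_reverse : cnt m (fun l => P l.reverse) = cnt m P := by
  induction m generalizing P with
  | zero => rfl
  | succ m ih =>
    rw [cnt_succ', cnt]
    simp only [List.reverse_append, List.reverse_cons, List.reverse_nil, List.nil_append,
      List.singleton_append]
    exact sum_congr rfl fun v _ => ih (P := fun l => P (v :: l))

theorem cnt_succ_le {D : Finset V} {b s : ℝ} (hs : (#D : ℝ) ≤ s) (hb : 0 ≤ b)
    (h1 : ∀ v ∉ D, ∀ l, ¬ P (v :: l)) (h2 : ∀ v ∈ D, cnt m (fun l => P (v :: l)) ≤ b) :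
    cnt (m + 1) P ≤ s * b := by
  rw [cnt, ← sum_subset (subset_univ D) fun v _ hv => cnt_eq_zero fun l _ => h1 v hv l]
  calc _ ≤ ∑ v ∈ D, b := sum_le_sum h2
    _ = #D * b := by simp
    _ ≤ _ := by gcongr

theorem le_cnt_succ {D : Finset V} {b s : ℝ} (hs : s ≤ #D) (hb : 0 ≤ b)
    (h : ∀ v ∈ D, b ≤ cnt m fun l => P (v :: l)) : s * b ≤ cnt (m + 1) P := by
  rw [cnt]
  calc s * b ≤ #D * b := by gcongr
    _ = ∑ v ∈ D, b := by simp
    _ ≤ ∑ v ∈ D, cnt m fun l => P (v :: l) := sum_le_sum h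
    _ ≤ _ := sum_le_sum_of_subset_of_nonneg (subset_univ D) fun v _ _ => cnt_nonneg

variable {G : SimpleGraph V} {U : ℕ → Finset V} {s : ℕ → ℝ}

theorem prod_range_shift {i : ℕ} :
    ∏ t ∈ range (m + 1), s (i + t) = s i * ∏ t ∈ range m, s (i + 1 + t) := by
  rw [prod_range_succ', mul_comm, Nat.add_zero]
  congr 1
  exact prod_congr rfl fun t _ => by congr 1; omega

theorem cnt_bdd_le (hs : ∀ i, 0 ≤ s i) {r : List V} :
    cnt m (Bdd G U s r) ≤ ∏ t ∈ range m, s (r.length + t) := by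
  induction m generalizing r with
  | zero => simp [cnt, Bdd]
  | succ m ih =>
    have h0 : 0 ≤ ∏ t ∈ range m, s ((r.length + 1) + t) := prod_nonneg fun t _ => hs _
    rw [prod_range_shift]
    by_cases hc : (#(nb G r (U r.length)) : ℝ) ≤ s r.length
    · refine cnt_succ_le hc h0 (fun v hv l hl => hv hl.1) fun v hv => ?_
      exact (cnt_mono fun l _ hl => hl.2.2).trans (ih (r := v :: r))
    · rw [cnt_eq_zero]
      · exact mul_nonneg (hs _) h0
      · rintro (_ | ⟨v, l⟩) h hl
        · simp at h
        · exact hc hl.2.1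

/-- A list violating `Q` has some entry in the exceptional set of its position. This position leaves
at most δ s choices, where `s` is its bound, and every other one at most its own bound; there are
`m` positions. -/
theorem AllBut.cnt_le (hs : ∀ i, 0 ≤ s i) {δ : ℝ} (hδ : 0 ≤ δ) {r : List V}
    (h : AllBut (fun i => δ * s i) m r.length Q) :
    cnt m (fun l => Bdd G U s r l ∧ ¬ Q l) ≤ m * δ * ∏ t ∈ range m, s (r.length + t) := by
  induction m generalizing r Q with
  | zero =>
    rw [cnt_eq_zero]
    · simp
    · intro l hl
      obtain rfl := List.eq_nil_of_length_eq_zero hl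
      simpa [Bdd, AllBut] using h
  | succ m ih =>
    obtain ⟨E, hE, h⟩ := h
    have h0 : 0 ≤ ∏ t ∈ range m, s ((r.length + 1) + t) := prod_nonneg fun t _ => hs _
    rw [prod_range_shift]
    set M := ∏ t ∈ range m, s ((r.length + 1) + t)
    have h1 : cnt (m + 1) (fun l => (Bdd G U s r l ∧ ¬ Q l) ∧ ∀ v ∈ l.head?, v ∈ E) ≤
        δ * s r.length * M := by
      refine cnt_succ_le hE h0 (fun v hv l hl => hv (hl.2 v (by simp))) fun v hv => ?_
      exact (cnt_mono fun l _ hl => hl.1.1.2.2).trans (cnt_bdd_le hs (r := v :: r))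
    have h2 : cnt (m + 1) (fun l => (Bdd G U s r l ∧ ¬ Q l) ∧ ∀ v ∈ l.head?, v ∉ E) ≤
        s r.length * (m * δ * M) := by
      by_cases hc : (#(nb G r (U r.length)) : ℝ) ≤ s r.length
      · refine cnt_succ_le hc (by positivity) (fun v hv l hl => hv hl.1.1.1) fun v hv => ?_
        by_cases hvE : v ∈ E
        · rw [cnt_eq_zero]
          · positivity
          · intro l _ hl
            exact hl.2 v (by simp) hvE
        · exact (cnt_mono fun l _ hl => ⟨hl.1.1.2.2, hl.1.2⟩).trans
            (ih (r := v :: r) (h v hvE))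
      · rw [cnt_eq_zero]
        · have := hs r.length
          positivity
        · rintro (_ | ⟨v, l⟩) h hl
          · simp at h
          · exact hc hl.1.1.2.1
    calc _ ≤ cnt (m + 1) (fun l => ((Bdd G U s r l ∧ ¬ Q l) ∧ ∀ v ∈ l.head?, v ∈ E) ∨
          ((Bdd G U s r l ∧ ¬ Q l) ∧ ∀ v ∈ l.head?, v ∉ E)) := by
          refine cnt_mono fun l hl h => ?_
          cases l with
          | nil => simp at hl
          | cons v l => by_cases hv : v ∈ E <;> simp [h, hv]
      _ ≤ _ := cnt_or
      _ ≤ δ * s r.length * M + s r.length * (m * δ * M) := add_le_add h1 h2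
      _ = _ := by push_cast; ring

/-- If lists satisfying `T` have many extensions satisfying `T`, then there are many lists built up
in this way. -/
theorem prod_le_cnt {k : ℕ} {T : List V → Prop} {d : ℕ → ℝ} (hd : ∀ i, 0 ≤ d i)
    (hT : ∀ r : List V, r.length < k → T r →
      ∃ D : Finset V, d r.length ≤ #D ∧ ∀ u ∈ D, T (u :: r)) {r : List V}
    (hr : ∀ r', r' <:+ r → T r') (hk : r.length + m = k) :
    ∏ t ∈ range m, d (r.length + t) ≤ cnt m fun l => ∀ r', r' <:+ l.reverse ++ r → T r' := by
  induction m generalizing r with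
  | zero =>
    simp only [cnt, range_zero, prod_empty, List.reverse_nil, List.nil_append]
    exact (if_pos hr).ge
  | succ m ih =>
    obtain ⟨D, hD, hDT⟩ := hT r (by omega) (hr r (List.suffix_refl r))
    rw [prod_range_shift]
    refine le_cnt_succ hD (prod_nonneg fun t _ => hd _) fun v hv => ?_
    refine (ih (r := v :: r) (fun r' h => ?_) (by simp; omega)).trans
      (cnt_mono fun l _ hl => ?_)
    · rcases List.suffix_cons_iff.1 h with rfl | h
      exacts [hDT v hv, hr r' h]
    · simpa using hl

omit [Fintype V] in
theorem nb_reverse {l : List V} {W : Finset V} : nb G l.reverse W = nb G l W := by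
  ext; simp

omit [Fintype V] in
theorem Bdd.of_split {r l : List V} (h : ∀ A u B, l = A ++ u :: B →
    u ∈ nb G (A.reverse ++ r) (U (A.length + r.length)) ∧
      (#(nb G (A.reverse ++ r) (U (A.length + r.length))) : ℝ) ≤ s (A.length + r.length)) :
    Bdd G U s r l := by
  induction l generalizing r with
  | nil => trivial
  | cons u l ih =>
    obtain ⟨h1, h2⟩ := h [] u l rfl
    simp only [List.reverse_nil, List.nil_append, List.length_nil, Nat.zero_add] at h1 h2
    refine ⟨h1, h2, ih fun A w B hl => ?_⟩
    have := h (u :: A) w B (by simp [hl])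
    simpa [Nat.add_assoc, Nat.add_comm 1] using this

end

section

variable {V : Type*} [Fintype V] {G : SimpleGraph V} {ε p : ℝ}

local notation "𝐧" => (Fintype.card V : ℝ)

/-- Too many rich vertices would violate `UpperReg`. As `Y` may be too small for it, `Y` is first
enlarged inside `Q` to the required size; the result still has at most 2s vertices, so at most 2p ·
2s edges per vertex are allowed on average, not more than 4ps. -/
theorem UpperReg.card_rich {i j : ℕ} (h : UpperReg G ε p i j) (hp : 0 < p) (hε : 0 ≤ ε) {X Q Y : Finset V}
    (hXQ : Disjoint X Q) (hY : Y ⊆ Q) (hQ : ε * p ^ j * 𝐧 ≤ #Q) {s : ℝ} (hYs : (#Y : ℝ) ≤ s)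
    (hs : ε * p ^ j * 𝐧 ≤ s) (h1 : 1 ≤ s) :
    (#{z ∈ X | 4 * p * s < #(nb G [z] Y)} : ℝ) ≤ ε * p ^ i * 𝐧 := by
  by_contra! hc
  set Z : Finset V := {z ∈ X | 4 * p * s < #(nb G [z] Y)}
  obtain ⟨Y', hYY', hY'Q, hY'⟩ := exists_subsuperset_card_eq hY
    (n := max #Y ⌈ε * p ^ j * 𝐧⌉₊) (le_max_left _ _)
    (max_le (card_le_card hY) (Nat.ceil_le.2 hQ))
  have h3 : ε * p ^ j * 𝐧 ≤ #Y' := by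
    rw [hY']; exact (Nat.le_ceil _).trans (by exact_mod_cast le_max_right _ _)
  have h4 : (#Y' : ℝ) ≤ 2 * s := by
    rw [hY', Nat.cast_max]
    refine max_le (by linarith) ?_
    by_cases h0 : 0 ≤ ε * p ^ j * 𝐧
    · linarith [Nat.ceil_lt_add_one h0]
    · rw [Nat.ceil_eq_zero.2 (by linarith)]; norm_num; linarith
  have h5 := h Z Y' (disjoint_of_subset_left (filter_subset _ _)
    (disjoint_of_subset_right hY'Q hXQ)) hc.le h3
  have h6 : ∑ z ∈ Z, 4 * p * s ≤ ∑ z ∈ Z, (#(nb G [z] Y') : ℝ) := by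
    refine sum_le_sum fun z hz => (mem_filter.1 hz).2.le.trans ?_
    exact_mod_cast card_le_card (nb_mono hYY')
  have h7 : 2 * p * #Z * #Y' ≤ 2 * p * #Z * (2 * s) := by gcongr
  by_cases hZ : Z = ∅
  · simp only [hZ, card_empty, Nat.cast_zero] at hc
    exact hc.not_ge (by positivity)
  · have h9 : ∑ z ∈ Z, 4 * p * s < ∑ z ∈ Z, (#(nb G [z] Y') : ℝ) := by
      refine sum_lt_sum_of_nonempty (nonempty_iff_ne_empty.2 hZ) fun z hz =>
        (mem_filter.1 hz).2.trans_le ?_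
      exact_mod_cast card_le_card (nb_mono hYY')
    rw [sum_const, nsmul_eq_mul] at h9
    linarith

end

end HamPow

/-! ### Typical cliques, and a clique that is good in both directions. -/

namespace HamPow
open scoped Classical
open Finset

/-- The reversed list `r` consists of pairwise adjacent vertices from the sets `U 0, U 1, …`, and
the sizes of the relevant common neighbourhoods in these sets are of the expected order. -/
def TypClique {V : Type*} [Fintype V] (G : SimpleGraph V) (p : ℝ) (k : ℕ) (a : ℝ)
    (U : ℕ → Finset V) (r : List V) : Prop :=
  (∀ u r', r = u :: r' → u ∈ nb G r' (U r'.length)) ∧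
  (∀ s ≤ r.length, ∀ j < k, (j + s < r.length ∨ r.length ≤ j) →
    (#(nb G (r.take s) (U j)) : ℝ) ≤ (4 * p) ^ s * (Fintype.card V : ℝ)) ∧
  ∀ j < k, r.length ≤ j → a * (p / 8) ^ r.length * (Fintype.card V : ℝ) ≤ #(nb G r (U j))

theorem card_biUnion_le_real {ι V : Type*} (I : Finset ι) (F : ι → Finset V) {b : ℝ}
    (h : ∀ i ∈ I, (#(F i) : ℝ) ≤ b) : (#(I.biUnion F) : ℝ) ≤ #I * b := by
  calc (#(I.biUnion F) : ℝ) ≤ ∑ i ∈ I, (#(F i) : ℝ) := by exact_mod_cast card_biUnion_le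
    _ ≤ ∑ i ∈ I, b := sum_le_sum h
    _ = _ := by simp

section

variable {V : Type*} [Fintype V] {G : SimpleGraph V} {ε p : ℝ} {k : ℕ}

local notation "𝐧" => (Fintype.card V : ℝ)

theorem TypClique.nil {a : ℝ} {U : ℕ → Finset V} (hU : ∀ j < k, a * 𝐧 ≤ #(U j)) :
    TypClique G p k a U [] := by
  refine ⟨by simp, fun s hs j hj _ => ?_, fun j hj _ => by simpa using hU j hj⟩
  obtain rfl : s = 0 := by simpa using hs
  simpa using card_le_univ (U j)

/-- At most `k` sets of poor vertices and k² sets of rich vertices have to be avoided. Each has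
order ε p^(k-1) n, while at least order p^i n candidates exist with i ≤ k - 1. -/
theorem TypClique.step (hp : 0 < p) (hp1 : p ≤ 1) (hε : 0 < ε) (hε1 : ε ≤ 1)
    (h : LowerReg G ε p (k - 1) (2 * k - 1)) (hu : UpperReg G ε p (k - 1) (2 * k - 1))
    (hN : 1 ≤ ε * p ^ (2 * k - 1) * 𝐧) {a : ℝ} (ha : 0 < a)
    (ha' : (k * k + k) * ε ≤ a / (2 * 8 ^ k)) {U : ℕ → Finset V}
    (hU : ∀ j < k, a * 𝐧 ≤ #(U j)) (hd : ∀ i < k, ∀ j < k, i ≠ j → Disjoint (U i) (U j))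
    {r : List V} (hr : r.length < k) (hT : TypClique G p k a U r) :
    ∃ D : Finset V, a / 2 * (p / 8) ^ r.length * 𝐧 ≤ #D ∧ ∀ u ∈ D, TypClique G p k a U (u :: r) := by
  set i := r.length with hi
  obtain ⟨-, hup, hlo⟩ := hT
  have hk : (1 : ℝ) ≤ k := by exact_mod_cast (by omega : 1 ≤ k)
  have hεa : ε ≤ a / 8 ^ k := by
    have : a / (2 * 8 ^ k) ≤ a / 8 ^ k := by gcongr; linarith [pow_pos (by norm_num : (0:ℝ) < 8) k]
    nlinarith
  have h8 : a / 8 ^ k ≤ a / 8 ^ i := by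
    have : (8 : ℝ) ^ i ≤ 8 ^ k := pow_le_pow_right₀ (by norm_num) (by omega)
    gcongr
  have e8 : ∀ t : ℕ, a * (p / 8) ^ t * 𝐧 = a / 8 ^ t * p ^ t * 𝐧 := fun t => by
    rw [div_pow]; ring
  have hpoor : ∀ j < k, i ≤ j → (#(poor G p (nb G r (U j))) : ℝ) ≤ ε * p ^ (k - 1) * 𝐧 :=
    fun j hj hij => h _ <| by
      refine le_trans ?_ (hlo j hj hij)
      rw [e8]
      exact scale_le' hp.le hp1 hε.le (hεa.trans h8) (by omega) le_rfl
  set F : ℕ × ℕ → Finset V := fun x => {z ∈ nb G r (U i) |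
    4 * p * ((4 * p) ^ x.1 * 𝐧) < #(nb G [z] (nb G (r.take x.1) (U x.2))) ∧
      x.1 ≤ i ∧ x.2 ≠ i ∧ (x.2 + x.1 < i ∨ i ≤ x.2)}
  have hF : ∀ x ∈ range k ×ˢ range k, (#(F x) : ℝ) ≤ ε * p ^ (k - 1) * 𝐧 := by
    rintro ⟨s, j⟩ hx
    simp only [mem_product, mem_range] at hx
    by_cases hc : s ≤ i ∧ j ≠ i ∧ (j + s < i ∨ i ≤ j)
    · refine le_trans ?_ (hu.card_rich hp hε.le (X := nb G r (U i)) (Q := U j)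
        (Y := nb G (r.take s) (U j)) (disjoint_of_subset_left nb_subset
          (hd i hr j hx.2 hc.2.1.symm)) nb_subset ?_ (hup s hc.1 j hx.2 hc.2.2) ?_ ?_)
      · exact_mod_cast card_le_card fun z hz => by
          simp only [F, mem_filter] at hz ⊢
          exact ⟨hz.1, hz.2.1⟩
      · refine le_trans ?_ (hU j hx.2)
        have := scale_le (V := V) hp.le hp1 hε.le (Nat.zero_le (2 * k - 1))
        have h9 : a / 8 ^ k ≤ a := div_le_self ha.le (one_le_pow₀ (by norm_num))
        calc _ ≤ _ := this
          _ ≤ a * 𝐧 := by rw [pow_zero, mul_one]; gcongr; linarith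
      all_goals
        have h10 : ε * p ^ (2 * k - 1) ≤ (4 * p) ^ s := by
          calc ε * p ^ (2 * k - 1) ≤ 1 * p ^ s := by
                gcongr ?_ * ?_
                exact pow_le_pow_of_le_one hp.le hp1 (by omega)
            _ ≤ (4 * p) ^ s := by rw [one_mul]; gcongr; linarith
        have h11 : ε * p ^ (2 * k - 1) * 𝐧 ≤ (4 * p) ^ s * 𝐧 := by gcongr
        linarith
    · have : F (s, j) = ∅ := filter_eq_empty_iff.2 fun z _ hz => hc hz.2
      rw [this]; simp; positivity
  set B := (range k).biUnion (fun j => if i ≤ j then poor G p (nb G r (U j)) else ∅) ∪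
    (range k ×ˢ range k).biUnion F
  have hB : (#B : ℝ) ≤ (k * k + k) * (ε * p ^ (k - 1) * 𝐧) := by
    have h1 := card_biUnion_le_real (range k)
      (fun j => if i ≤ j then poor G p (nb G r (U j)) else ∅) (b := ε * p ^ (k - 1) * 𝐧)
      fun j hj => by
        split_ifs with hij
        · exact hpoor j (mem_range.1 hj) hij
        · simp; positivity
    have h2 := card_biUnion_le_real _ F hF
    have h3 : (#B : ℝ) ≤ _ := Nat.cast_le.2 (card_union_le _ _)
    rw [card_range] at h1
    rw [card_product, card_range] at h2
    push_cast at h2 h3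
    linarith
  refine ⟨nb G r (U i) \ B, ?_, fun u hu => ?_⟩
  · have h1 := card_sdiff_real (nb G r (U i)) B
    have h2 := hlo i hr le_rfl
    have h3 : (k * k + k) * (ε * p ^ (k - 1) * 𝐧) ≤ a / 2 * (p / 8) ^ i * 𝐧 := by
      calc (k * k + k) * (ε * p ^ (k - 1) * 𝐧) = ((k * k + k) * ε) * (p ^ (k - 1) * 𝐧) := by ring
        _ ≤ a / (2 * 8 ^ k) * (p ^ i * 𝐧) := by
          gcongr ?_ * (?_ * _)
          exact pow_le_pow_of_le_one hp.le hp1 (by omega)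
        _ = (a / 8 ^ k) / 2 * p ^ i * 𝐧 := by field_simp
        _ ≤ (a / 8 ^ i) / 2 * p ^ i * 𝐧 := by gcongr
        _ = _ := by rw [div_pow]; ring
    linarith
  · obtain ⟨huN, huB⟩ := mem_sdiff.1 hu
    simp only [B, mem_union, not_or, mem_biUnion, mem_range, not_exists, not_and,
      mem_product] at huB
    refine ⟨fun w r' hw => ?_, fun s hs j hj hsj => ?_, fun j hj hij => ?_⟩
    · obtain ⟨rfl, rfl⟩ := List.cons.inj hw
      exact huN
    · cases s with
      | zero => simpa using card_le_univ (U j)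
      | succ s =>
        simp only [List.length_cons, ← hi] at hs hsj
        rw [List.take_succ_cons, nb_cons]
        have := huB.2 (s, j) ⟨by omega, hj⟩
        simp only [F, mem_filter, not_and] at this
        by_contra! hc
        refine this huN ?_ (by omega) (by omega) (by omega)
        rw [pow_succ] at hc
        linarith
    · simp only [List.length_cons, ← hi] at hij ⊢
      have h1 := huB.1 j hj
      rw [if_pos (by omega), notMem_poor] at h1
      rw [nb_cons, pow_succ]
      have h2 := hlo j hj (by omega)
      calc a * ((p / 8) ^ i * (p / 8)) * 𝐧 = p / 8 * (a * (p / 8) ^ i * 𝐧) := by ring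
        _ ≤ p / 8 * #(nb G r (U j)) := by gcongr
        _ ≤ _ := h1

/-- If two properties hold for almost all lists, then they hold for some clique and its reversal,
respectively. -/
theorem exists_clique_of_allBut (hp : 0 < p) (hp1 : p ≤ 1) (hε : 0 < ε) (hε1 : ε ≤ 1)
    (h : LowerReg G ε p (k - 1) (2 * k - 1)) (hu : UpperReg G ε p (k - 1) (2 * k - 1))
    (hN : 1 ≤ ε * p ^ (2 * k - 1) * 𝐧) {a : ℝ} (ha : 0 < a)
    (ha' : (k * k + k) * ε ≤ a / (2 * 8 ^ k)) {U : ℕ → Finset V}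
    (hU : ∀ j < k, a * 𝐧 ≤ #(U j)) (hd : ∀ i < k, ∀ j < k, i ≠ j → Disjoint (U i) (U j))
    {δ : ℝ} (hδ : 0 ≤ δ) (hδa : 2 * k * δ < (a / (2 * 32 ^ k)) ^ k) {Q Q' : List V → Prop}
    (hQ : AllBut (fun i => δ * p ^ i * 𝐧) k 0 Q) (hQ' : AllBut (fun i => δ * p ^ i * 𝐧) k 0 Q') :
    ∃ us : List V, us.length = k ∧ us.Pairwise G.Adj ∧
      (∀ x ∈ us, ∃ j < k, x ∈ U j) ∧ Q us ∧ Q' us.reverse := by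
  set s : ℕ → ℝ := fun i => (4 * p) ^ i * 𝐧 with hs
  have hn : 0 < 𝐧 := by
    by_contra! hc
    have : ε * p ^ (2 * k - 1) * 𝐧 ≤ 0 := mul_nonpos_of_nonneg_of_nonpos (by positivity) hc
    linarith
  have hs0 : ∀ i, 0 < s i := fun i => by positivity
  have hmono : ∀ {m i} {P : List V → Prop}, AllBut (fun i => δ * p ^ i * 𝐧) m i P →
      AllBut (fun i => δ * s i) m i P := by
    intro m
    induction m with
    | zero => exact fun h => h
    | succ m ih =>
      rintro i P ⟨E, hE, h⟩
      refine ⟨E, hE.trans ?_, fun u hu => ih (h u hu)⟩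
      simp only [hs, mul_assoc]
      gcongr
      linarith
  have b1 := (hmono hQ).cnt_le (G := G) (U := U) (r := []) (fun i => (hs0 i).le) hδ
  have b2 := (hmono hQ').cnt_le (G := G) (U := fun i => U (k - 1 - i)) (r := [])
    (fun i => (hs0 i).le) hδ
  rw [← cnt_reverse] at b2
  have lb := prod_le_cnt (k := k) (T := TypClique G p k a U)
    (d := fun i => a / 2 * (p / 8) ^ i * 𝐧) (fun i => by positivity)
    (fun r hr hT => hT.step hp hp1 hε hε1 h hu hN ha ha' hU hd hr) (r := [])
    (fun r' hr' => by rw [List.suffix_nil.1 hr']; exact TypClique.nil hU)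
    (m := k) (by simp)
  simp only [List.length_nil, Nat.zero_add, List.append_nil] at b1 b2 lb
  set M := ∏ t ∈ range k, s t
  have hM : 0 < M := prod_pos fun t _ => hs0 t
  -- Position by position, the guaranteed number of choices, of order (p/8)^t n, differs from the
  -- upper bound (4p)^t n by a factor 32^t, up to constants.
  have lb' : (a / (2 * 32 ^ k)) ^ k * M ≤ ∏ t ∈ range k, (a / 2 * (p / 8) ^ t * 𝐧) := by
    have : (a / (2 * 32 ^ k)) ^ k * M = ∏ t ∈ range k, (a / (2 * 32 ^ k) * s t) := by
      rw [prod_mul_distrib, prod_const, card_range]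
    rw [this]
    refine prod_le_prod (fun t _ => mul_nonneg (by positivity) (hs0 t).le) fun t ht => ?_
    have ht := mem_range.1 ht
    have h1 : (32 : ℝ) ^ t ≤ 32 ^ k := pow_le_pow_right₀ (by norm_num) ht.le
    calc a / (2 * 32 ^ k) * s t ≤ a / (2 * 32 ^ t) * s t := by
          have := hs0 t
          gcongr
      _ = a / 2 * (p / 8) ^ t * 𝐧 := by
          simp only [hs]
          rw [show (32 : ℝ) = 4 * 8 by norm_num, mul_pow, mul_pow, div_pow]
          field_simp
  set C : List V → Prop := fun l => ∀ r', r' <:+ l.reverse → TypClique G p k a U r'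
  have hclique : ∀ l : List V, C l → l.length = k → l.reverse.Pairwise G.Adj ∧
      (∀ A u B, l.reverse = A ++ u :: B → u ∈ nb G B (U B.length)) := by
    intro l hC hl
    have h1 : ∀ A u B, l.reverse = A ++ u :: B → u ∈ nb G B (U B.length) := fun A u B h =>
      (hC (u :: B) ⟨A, h.symm⟩).1 u B rfl
    refine ⟨?_, h1⟩
    generalize l.reverse = r at h1
    induction r with
    | nil => exact List.Pairwise.nil
    | cons u r ih =>
      refine List.Pairwise.cons (fun x hx => ((mem_nb.1 (h1 [] u r rfl)).2 x hx).symm)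
        (ih fun A w B h => h1 (u :: A) w B (by simp [h]))
  have hbdd : ∀ l : List V, C l → l.length = k → Bdd G U s [] l := by
    intro l hC hl
    refine Bdd.of_split fun A u B hlAB => ?_
    have hrev : l.reverse = B.reverse ++ u :: A.reverse := by simp [hlAB]
    have hlen : A.length + (B.length + 1) = k := by rw [← hl, hlAB]; simp
    have h1 := (hclique l hC hl).2 _ _ _ hrev
    have h2 := (hC A.reverse ⟨B.reverse ++ [u], by rw [hrev]; simp⟩).2.1 A.length (by simp)
      A.length (by omega) (by simp)
    simp only [List.append_nil, List.length_nil, Nat.add_zero]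
    rw [List.take_of_length_le (by simp)] at h2
    rw [List.length_reverse] at h1
    exact ⟨h1, h2⟩
  have hbdd' : ∀ l : List V, C l → l.length = k →
      Bdd G (fun i => U (k - 1 - i)) s [] l.reverse := by
    intro l hC hl
    refine Bdd.of_split fun A u B hlAB => ?_
    have hlen : A.length + (B.length + 1) = k := by
      rw [← hl, ← List.length_reverse (as := l), hlAB]; simp
    obtain ⟨hpw, hmem⟩ := hclique l hC hl
    simp only [List.append_nil, List.length_nil, Nat.add_zero]
    rw [show k - 1 - A.length = B.length by omega, nb_reverse]
    have h1 := hmem A u B hlAB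
    -- Read backwards, the vertex in `U j` is chosen after those with larger index. Its candidates
    -- are the common neighbours in `U j` of the last k - 1 - j vertices of the clique; this is why
    -- `TypClique` also controls sets that have already been used.
    have h2 := (hC l.reverse List.suffix_rfl).2.1 A.length (by simp; omega) B.length (by omega)
      (by left; simp; omega)
    rw [hlAB, List.take_left'  rfl] at h2
    refine ⟨mem_nb.2 ⟨(mem_nb.1 h1).1, fun x hx => ?_⟩, h2⟩
    rw [hlAB, List.pairwise_append] at hpw
    exact hpw.2.2 x hx u (by simp)
  -- Each typical clique is good, or violates `Q`, or violates `Q'` read backwards. The last two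
  -- kinds number at most kδM each, together fewer than all typical cliques.
  have key : cnt k C ≤ cnt k (fun l => C l ∧ Q l ∧ Q' l.reverse) +
      (cnt k (fun l => Bdd G U s [] l ∧ ¬ Q l) +
        cnt k fun l => Bdd G (fun i => U (k - 1 - i)) s [] l.reverse ∧ ¬ Q' l.reverse) := by
    refine le_trans (cnt_mono fun l hl hC => ?_) (cnt_or.trans (add_le_add_right cnt_or _))
    have h1 := hbdd l hC hl
    have h2 := hbdd' l hC hl
    by_cases hq : Q l <;> by_cases hq' : Q' l.reverse <;> simp [hC, h1, h2, hq, hq']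
  have hpos : 0 < cnt k (fun l => C l ∧ Q l ∧ Q' l.reverse) := by
    have h1 : (2 * k * δ) * M < (a / (2 * 32 ^ k)) ^ k * M := by gcongr
    linarith
  obtain ⟨us, hl, hC, hq, hq'⟩ := exists_of_cnt_pos hpos
  obtain ⟨hpw, hmem⟩ := hclique us hC hl
  refine ⟨us, hl, ?_, fun x hx => ?_, hq, hq'⟩
  · rw [List.pairwise_reverse] at hpw
    exact hpw.imp fun h => h.symm
  · obtain ⟨A, B, hAB⟩ := List.append_of_mem (List.mem_reverse.2 hx)
    refine ⟨B.length, ?_, (mem_nb.1 (hmem A x B hAB)).1⟩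
    rw [← hl, ← List.length_reverse (as := us), hAB]; simp; omega

end

end HamPow

/-! ### Connections for k-th powers. -/

namespace HamPow
open scoped Classical
open Finset

section

variable {V : Type*} {G : SimpleGraph V} {k : ℕ}

theorem kadj_of_pairwise {l : List V} (h : l.Pairwise G.Adj) : KAdj G k l :=
  kadj_iff.2 fun i j hij _ hj => List.pairwise_iff_getElem.1 h i j (by omega) hj hij

theorem kadj_append {A B : List V} (hA : KAdj G k A) (hB : KAdj G k B) (hk : A.length = k)
    (hAB : ∀ (j i : ℕ) (hj : j < B.length) (_ : j ≤ i) (hi : i < A.length), G.Adj B[j] A[i]) :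
    KAdj G k (A ++ B) := by
  rw [kadj_iff] at hA hB ⊢
  intro i j hij hjk hj
  have hlen := List.length_append (as := A) (bs := B)
  by_cases hjA : j < A.length
  · rw [List.getElem_append_left hjA, List.getElem_append_left (by omega)]
    exact hA i j hij hjk hjA
  · rw [List.getElem_append_right (i := j) (by omega)]
    by_cases hiA : i < A.length
    · rw [List.getElem_append_left hiA]
      exact (hAB (j - A.length) i (by omega) (by omega) hiA).symm
    · rw [List.getElem_append_right (i := i) (by omega)]
      exact hB _ _ (by omega) (by omega) (by omega)

/-- In `ws ++ us`, the vertices `ws[j]` and `us[i]` are k + i - j places apart, so adjacency is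
needed only for i ≤ j, which is what `Reach` provides. Likewise `ws[t]` is close only to the k - t
outermost vertices of `e`. -/
theorem kadj_half {e ws us : List V} (he : KAdj G k e) (hek : e.length = k)
    (hws : ws.Pairwise G.Adj) (hwk : ws.length = k) (hus : us.Pairwise G.Adj) (huk : us.length = k)
    (hew : ∀ (t : ℕ) (ht : t < ws.length), ∀ x ∈ e.take (k - t), G.Adj x ws[t])
    (hwu : ∀ (i j : ℕ) (_ : i ≤ j) (hj : j < us.length), G.Adj us[i] (ws[j]'(by omega))) :
    KAdj G k (e.reverse ++ (ws ++ us)) := by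
  refine KAdj.glue hwk.ge (kadj_append he.reverse (kadj_of_pairwise hws) (by simpa using hek) ?_)
    (kadj_append (kadj_of_pairwise hws) (kadj_of_pairwise hus) hwk ?_)
  · intro j i hj hji hi
    rw [List.length_reverse] at hi
    refine (hew j hj _ ?_).symm
    rw [List.getElem_reverse, List.mem_take_iff_getElem]
    exact ⟨e.length - 1 - i, by omega, rfl⟩
  · exact fun j i hj hji hi => hwu j i hji (by omega)

theorem pairwise_adj_nodup {l : List V} (h : l.Pairwise G.Adj) : l.Nodup := h.imp fun h => h.ne

variable [Fintype V] {ε p : ℝ}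

local notation "𝐧" => (Fintype.card V : ℝ)

/-- Sets of increasing orders of magnitude contain many cliques with one vertex in each of them. -/
theorem many_cliques (hp : 0 < p) (hp1 : p ≤ 1) (hε : 0 ≤ ε) (h : LowerReg G ε p k (k - 1))
    {a : ℝ} {m : ℕ} (hm : m ≤ k) (ha : 0 < a) (hεa : k * ε ≤ a / (2 * 8 ^ m)) {C : ℕ → Finset V}
    (hC : ∀ t < m, a * p ^ (k - t) * 𝐧 ≤ #(C t)) :
    Many (a / (2 * 8 ^ m) * p ^ k * 𝐧) m fun ws => ws.length = m ∧ ws.Pairwise G.Adj ∧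
      ∀ (t : ℕ) (ht : t < ws.length), ws[t] ∈ C t := by
  suffices H : ∀ (i : ℕ) (hi : i + m ≤ k) (a : ℝ) (ha : 0 < a) (hεa : k * ε ≤ a / (2 * 8 ^ m))
      (C : ℕ → Finset V) (hC : ∀ t < m, a * p ^ (k - t) * 𝐧 ≤ #(C t)),
      Many (a / (2 * 8 ^ m) * p ^ k * 𝐧) m fun ws => ws.length = m ∧ ws.Pairwise G.Adj ∧
        ∀ (t : ℕ) (ht : t < ws.length), ws[t] ∈ C t from
    H 0 (by omega) a ha hεa C hC
  clear hC C hεa ha a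
  induction m with
  | zero =>
    intro i hi a ha hεa C hC
    exact ⟨rfl, List.Pairwise.nil, by simp⟩
  | succ m ih =>
    intro i hi a ha hεa C hC
    have hk : (1 : ℝ) ≤ k := by exact_mod_cast (by omega : 1 ≤ k)
    have h8 : (1 : ℝ) ≤ 8 ^ (m + 1) := one_le_pow₀ (by norm_num)
    have hεa' : k * ε ≤ a / 2 := hεa.trans (by gcongr; linarith)
    have hε1 : ε ≤ a := by nlinarith
    set B := (range m).biUnion fun t => poor G p (C (t + 1))
    have hB : (#B : ℝ) ≤ k * (ε * p ^ k * 𝐧) := by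
      refine (card_biUnion_le_real _ _ (b := ε * p ^ k * 𝐧) fun t ht => h _ ?_).trans ?_
      · have ht := mem_range.1 ht
        refine le_trans ?_ (hC (t + 1) (by omega))
        have : p ^ (k - 1) ≤ p ^ (k - (t + 1)) := pow_le_pow_of_le_one hp.le hp1 (by omega)
        gcongr
      · rw [card_range]
        have : (m : ℝ) ≤ k := by exact_mod_cast (by omega : m ≤ k)
        gcongr
    refine ⟨C 0 \ B, ?_, fun d hd => ?_⟩
    · have h1 := card_sdiff_real (C 0) B
      have h2 := hC 0 (by omega)
      have h3 : k * (ε * p ^ k * 𝐧) ≤ a / 2 * (p ^ k * 𝐧) := by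
        rw [mul_assoc ε, ← mul_assoc]; gcongr
      have h4 : a / (2 * 8 ^ (m + 1)) * p ^ k * 𝐧 ≤ a / 2 * p ^ k * 𝐧 := by
        gcongr; linarith
      rw [Nat.sub_zero] at h2
      linarith
    · obtain ⟨hdC, hdB⟩ := mem_sdiff.1 hd
      simp only [B, mem_biUnion, mem_range, not_exists, not_and] at hdB
      have e1 : a / 8 / (2 * 8 ^ m) = a / (2 * 8 ^ (m + 1)) := by rw [pow_succ]; field_simp
      -- Passing to neighbours of `d` costs a factor p/8, and the shift from `C t` to `C (t + 1)`
      -- gains one power of p; so the assumption recurs with a/8 in place of `a`.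
      have := ih (by omega) i (by omega) (a / 8) (by positivity) (by rw [e1]; exact hεa)
        (fun t => nb G [d] (C (t + 1))) fun t ht => by
          have h1 := notMem_poor.1 (hdB t ht)
          have h2 := hC (t + 1) (by omega)
          rw [show k - t = k - (t + 1) + 1 by omega, pow_succ]
          calc a / 8 * (p ^ (k - (t + 1)) * p) * 𝐧 = p / 8 * (a * p ^ (k - (t + 1)) * 𝐧) := by ring
            _ ≤ p / 8 * #(C (t + 1)) := by gcongr
            _ ≤ _ := h1
      rw [e1] at this
      refine this.mono fun l hl => ⟨by simp [hl.1], ?_, fun t ht => ?_⟩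
      · refine List.Pairwise.cons (fun x hx => ?_) hl.2.1
        obtain ⟨t, ht, rfl⟩ := List.getElem_of_mem hx
        exact (mem_nb_singleton.1 (hl.2.2 t ht)).2
      · cases t with
        | zero => simpa using hdC
        | succ t =>
          simp only [List.length_cons, Nat.add_lt_add_iff_right] at ht
          simpa using nb_subset (hl.2.2 t ht)

/-- Typical ends can be connected by `3 * k` vertices. -/
theorem conn_power (hk : 1 ≤ k) (hp : 0 < p) (hp1 : p ≤ 1) (hε : 0 < ε) (hε1 : ε ≤ 1)
    (h1 : LowerReg G ε p k (k - 1)) (h2 : LowerReg G ε p (k - 1) (2 * k - 1))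
    (hu : UpperReg G ε p (k - 1) (2 * k - 1)) (hN : 1 ≤ ε * p ^ (2 * k - 1) * 𝐧) {c γ : ℝ}
    (hc : 0 < c) (hcγ : c ≤ γ) {a : ℝ} (hac : a = c / (6 * k))
    (hεa1 : ε ≤ a / (2 * 8 ^ k * 16 ^ k)) (hεa2 : (k * k + k) * ε ≤ a / (2 * 8 ^ k))
    (hεa3 : 2 * k * (17 ^ k * ε) < (a / (2 * 32 ^ k)) ^ k) : Conn G k p c γ (3 * k) := by
  intro U e f hU hek hfk he hf hTe hTf
  have hk' : (1 : ℝ) ≤ k := by exact_mod_cast hk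
  have ha : 0 < a := by rw [hac]; positivity
  have hεa : ε ≤ a := by
    refine hεa1.trans (div_le_self ha.le ?_)
    have : (1 : ℝ) ≤ 8 ^ k := one_le_pow₀ (by norm_num)
    have : (1 : ℝ) ≤ 16 ^ k := one_le_pow₀ (by norm_num)
    nlinarith
  -- Even indices below 2k serve `e`, odd ones `f`, with exponents decreasing as i / 2 grows. The
  -- last `k` sets, of linear size, host the middle clique.
  set F : ℕ → Finset V := fun i =>
    if i < 2 * k then nb G ((if i % 2 = 0 then e else f).take (k - i / 2)) U else U
  obtain ⟨F', hF', hdis⟩ := exists_disjoint_subsets_real (3 * k) F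
    (fun i => a * p ^ (k - i / 2) * 𝐧)
    (fun i j hij => scale_le hp.le hp1 ha.le (by omega))
    (hN.trans (scale_le' hp.le hp1 hε.le hεa (by omega) le_rfl)) (fun i hi => by
      have e1 : 2 * ((3 * k : ℕ) : ℝ) * (a * p ^ (k - i / 2) * 𝐧) = c * p ^ (k - i / 2) * 𝐧 := by
        rw [hac]; push_cast; field_simp; ring
      rw [e1]
      simp only [F]
      split_ifs with h1 h2
      · exact hTe _ (Nat.sub_le _ _)
      · exact hTf _ (Nat.sub_le _ _)
      · rw [show k - i / 2 = 0 by omega, pow_zero, mul_one]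
        exact le_trans (by gcongr) hU)
  have he : ∀ t < k, F' (2 * t) ⊆ nb G (e.take (k - t)) U ∧
      F' (2 * t + 1) ⊆ nb G (f.take (k - t)) U := fun t ht => by
    have h1 := (hF' (2 * t) (by omega)).1
    have h2 := (hF' (2 * t + 1) (by omega)).1
    simp only [F] at h1 h2
    rw [if_pos (by omega), if_pos (by omega)] at h1
    rw [if_pos (by omega), if_neg (by omega)] at h2
    rw [show 2 * t / 2 = t by omega] at h1
    rw [show (2 * t + 1) / 2 = t by omega] at h2
    exact ⟨h1, h2⟩
  have hεk : k * ε ≤ a / (2 * 8 ^ k) := le_trans (by nlinarith) hεa2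
  -- The tree branches at order p^k n; k - 1 restrictions by p/16 bring this down to p^(2k-1) n, the
  -- scale in the hypothesis `h2`.
  have hb : 0 < k → ε * p ^ (2 * k - 1) * 𝐧 ≤
      a / (2 * 8 ^ k) * p ^ k * 𝐧 * (p / 16) ^ (k - 1) := fun _ => by
    have : (16 : ℝ) ^ (k - 1) ≤ 16 ^ k := pow_le_pow_right₀ (by norm_num) (by omega)
    calc ε * p ^ (2 * k - 1) * 𝐧 ≤ a / (2 * 8 ^ k * 16 ^ (k - 1)) * p ^ (2 * k - 1) * 𝐧 := by
          gcongr; exact hεa1.trans (by gcongr)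
      _ = _ := by
          rw [show 2 * k - 1 = k + (k - 1) by omega, pow_add, div_pow]
          field_simp
  have hn : 0 < 𝐧 := by
    by_contra! hc
    have : ε * p ^ (2 * k - 1) * 𝐧 ≤ 0 := mul_nonpos_of_nonneg_of_nonpos (by positivity) hc
    linarith
  have T1 := many_cliques hp hp1 hε.le h1 le_rfl ha hεk (C := fun t => F' (2 * t))
    fun t ht => by
      have := (hF' (2 * t) (by omega)).2.1
      rwa [show 2 * t / 2 = t by omega] at this
  have T2 := many_cliques hp hp1 hε.le h1 le_rfl ha hεk (C := fun t => F' (2 * t + 1))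
    fun t ht => by
      have := (hF' (2 * t + 1) (by omega)).2.1
      rwa [show (2 * t + 1) / 2 = t by omega] at this
  obtain ⟨us, huk, hupw, huU, hQ, hQ'⟩ := exists_clique_of_allBut hp hp1 hε hε1 h2 hu hN ha hεa2
    (U := fun t => F' (2 * k + t)) (fun t ht => by
      have := (hF' (2 * k + t) (by omega)).2.1
      rwa [show k - (2 * k + t) / 2 = 0 by omega, pow_zero, mul_one] at this)
    (fun i hi j hj hij => hdis _ (by omega) _ (by omega) (by omega)) (δ := 17 ^ k * ε)
    (by positivity) hεa3
    (T1.allBut_reach hp hp1 hε.le h2 (by positivity) (Nat.zero_add k) hb)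
    (T2.allBut_reach hp hp1 hε.le h2 (by positivity) (Nat.zero_add k) hb)
  obtain ⟨ws, hwl, ⟨hwk, hwpw, hwC⟩, hwu⟩ := hQ.exists
  obtain ⟨ws', hwl', ⟨hwk', hwpw', hwC'⟩, hwu'⟩ := hQ'.exists
  have A1 := kadj_half ‹KAdj G k e› hek hwpw hwk hupw huk (fun t ht x hx =>
    (mem_nb.1 ((he t (by omega)).1 (hwC t ht))).2 x hx) hwu
  have A2 := kadj_half hf hfk hwpw' hwk' (us := us.reverse)
    (List.pairwise_reverse.2 (hupw.imp fun h => h.symm)) (by simpa using huk) (fun t ht x hx =>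
    (mem_nb.1 ((he t (by omega)).2 (hwC' t ht))).2 x hx) hwu'
  have A3 : KAdj G k (us ++ (ws'.reverse ++ f)) := by
    have := A2.reverse
    simpa using this
  have hw : ∀ x ∈ ws, ∃ t < k, x ∈ F' (2 * t) := fun x hx => by
    obtain ⟨t, ht, rfl⟩ := List.getElem_of_mem hx
    exact ⟨t, by omega, hwC t ht⟩
  have hw' : ∀ x ∈ ws', ∃ t < k, x ∈ F' (2 * t + 1) := fun x hx => by
    obtain ⟨t, ht, rfl⟩ := List.getElem_of_mem hx
    exact ⟨t, by omega, hwC' t ht⟩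
  have hne : ∀ i < 3 * k, ∀ j < 3 * k, i ≠ j → ∀ x ∈ F' i, x ∉ F' j := fun i hi j hj hij x hx =>
    disjoint_left.1 (hdis i hi j hj hij) hx
  refine ⟨ws ++ (us ++ ws'.reverse), ?_, ?_, by simp; omega, ?_⟩
  · intro x hx
    simp only [List.mem_append, List.mem_reverse] at hx
    rcases hx with hx | hx | hx
    · obtain ⟨t, ht, hx⟩ := hw x hx
      exact nb_subset ((he t ht).1 hx)
    · obtain ⟨t, ht, hx⟩ := huU x hx
      have := (hF' (2 * k + t) (by omega)).1 hx
      simpa [F] using this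
    · obtain ⟨t, ht, hx⟩ := hw' x hx
      exact nb_subset ((he t ht).2 hx)
  · rw [List.nodup_append', List.nodup_append', List.nodup_reverse]
    refine ⟨pairwise_adj_nodup hwpw, ⟨pairwise_adj_nodup hupw, pairwise_adj_nodup hwpw', ?_⟩, ?_⟩
    · intro x hx hx'
      obtain ⟨t, ht, hx⟩ := huU x hx
      obtain ⟨t', ht', hx'⟩ := hw' x (List.mem_reverse.1 hx')
      exact hne _ (by omega) _ (by omega) (by omega) x hx hx'
    · intro x hx hx'
      obtain ⟨t, ht, hx⟩ := hw x hx
      rcases List.mem_append.1 hx' with hx' | hx'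
      · obtain ⟨t', ht', hx'⟩ := huU x hx'
        exact hne _ (by omega) _ (by omega) (by omega) x hx hx'
      · obtain ⟨t', ht', hx'⟩ := hw' x (List.mem_reverse.1 hx')
        exact hne _ (by omega) _ (by omega) (by omega) x hx hx'
  · have := KAdj.glue (A := e.reverse ++ ws) (B := us) (C := ws'.reverse ++ f) huk.ge
      (by simpa using A1) A3
    simpa using this

end

end HamPow

/-! ### Absorbing gadgets for k-th powers. -/

namespace HamPow
open scoped Classical
open Finset

section

variable {V : Type*} {T : List V → Prop}

theorem exists_of_step {k : ℕ} (h0 : T [])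
    (hT : ∀ r : List V, r.length < k → T r → ∃ u, T (u :: r)) :
    ∃ r : List V, r.length = k ∧ ∀ r', r' <:+ r → T r' := by
  induction k with
  | zero => exact ⟨[], rfl, fun r' h => by rwa [List.suffix_nil.1 h]⟩
  | succ k ih =>
    obtain ⟨r, hr, h⟩ := ih fun r hr => hT r (by omega)
    obtain ⟨u, hu⟩ := hT r (by omega) (h r List.suffix_rfl)
    refine ⟨u :: r, by simp [hr], fun r' h' => ?_⟩
    rcases List.suffix_cons_iff.1 h' with rfl | h'
    exacts [hu, h r' h']

variable [Fintype V] {G : SimpleGraph V} {ε p : ℝ} {k : ℕ}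

local notation "𝐧" => (Fintype.card V : ℝ)

/-- A path of 2k vertices is built greedily inside N(v), keeping the common neighbourhoods of its
most recent vertices of the expected size in every set of interest. As `v` is adjacent to all of it,
`v` can be inserted after `k` vertices without changing either end. The last common neighbourhoods
in N(v) have order p^(k+1) n. -/
theorem gad_power (hp : 0 < p) (hp1 : p ≤ 1) (hε : 0 < ε) (h : LowerReg G ε p (k + 1) k)
    (hN : 1 ≤ ε * p ^ (k + 1) * 𝐧) {c γ : ℝ} (hcγ : c ≤ γ)
    (hεc : (7 * k + 1) * ε < c / 8 ^ k) : Gad G k p c γ (γ / 8 ^ k) (2 * k) := by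
  intro U v 𝒯 hU hvU hdeg hcard h𝒯
  have hn : 0 < 𝐧 := by
    by_contra! hc
    have : ε * p ^ (k + 1) * 𝐧 ≤ 0 := mul_nonpos_of_nonneg_of_nonpos (by positivity) hc
    linarith
  have hεc' : ε ≤ c / 8 ^ k := by
    have : (0 : ℝ) ≤ k := Nat.cast_nonneg k
    nlinarith
  have hc : 0 < c := by
    have := hε.trans_le hεc'
    by_contra! hc
    exact this.not_ge (div_nonpos_of_nonpos_of_nonneg hc (by positivity))
  set S := nb G [v] U with hS
  set 𝒲 := insert S (insert U 𝒯) with h𝒲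
  have h𝒲card : #𝒲 ≤ 5 := (card_insert_le _ _).trans (by have := card_insert_le U 𝒯; omega)
  have h𝒲size : ∀ W ∈ 𝒲, c * p ^ 1 * 𝐧 ≤ #W := by
    have h1 : c * p ^ 1 * 𝐧 ≤ γ * 𝐧 := by
      rw [pow_one]; gcongr; nlinarith
    intro W hW
    simp only [h𝒲, mem_insert] at hW
    rcases hW with rfl | rfl | hW
    exacts [by simpa using hdeg, h1.trans hU, h1.trans (h𝒯 W hW)]
  obtain ⟨r, hr, hsuf⟩ := exists_of_step (k := 2 * k) (T := fun r => KAdj G k r ∧ r.Nodup ∧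
      (∀ x ∈ r, x ∈ S) ∧ ∀ W ∈ 𝒲, ∀ j ≤ k, (p / 8) ^ j * #W ≤ #(nb G (r.take j) W))
    ⟨trivial, List.nodup_nil, by simp, fun W hW j hj => by
      simp only [List.take_nil, nb_nil]
      exact mul_le_of_le_one_left (Nat.cast_nonneg _)
        (pow_le_one₀ (by positivity) (by linarith))⟩ (by
      rintro r hrk ⟨hr1, hr2, hr3, hr4⟩
      have hbig : ∀ W ∈ 𝒲, ∀ j ≤ k, c / 8 ^ k * p ^ (j + 1) * 𝐧 ≤ #(nb G (r.take j) W) :=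
        fun W hW j hj => by
          refine le_trans ?_ (hr4 W hW j hj)
          calc c / 8 ^ k * p ^ (j + 1) * 𝐧 ≤ c / 8 ^ j * p ^ (j + 1) * 𝐧 := by
                have : (8 : ℝ) ^ j ≤ 8 ^ k := pow_le_pow_right₀ (by norm_num) hj
                gcongr
            _ = (p / 8) ^ j * (c * p ^ 1 * 𝐧) := by rw [div_pow, pow_succ]; ring
            _ ≤ _ := by gcongr; exact h𝒲size W hW
      -- At most 5k sets of poor vertices and 2k vertices already used are avoided; hence the
      -- coefficient 7k in the assumption on ε.
      set B := (𝒲 ×ˢ range k).biUnion fun x => poor G p (nb G (r.take x.2) x.1)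
      have hB : (#B : ℝ) ≤ (5 * k) * (ε * p ^ (k + 1) * 𝐧) := by
        refine (card_biUnion_le_real _ _ (b := ε * p ^ (k + 1) * 𝐧) ?_).trans ?_
        · rintro ⟨W, j⟩ hx
          simp only [mem_product, mem_range] at hx
          exact h _ (scale_le' hp.le hp1 hε.le hεc' (by omega) (hbig W hx.1 j hx.2.le))
        · rw [card_product, card_range]
          push_cast
          have : (#𝒲 : ℝ) ≤ 5 := by exact_mod_cast h𝒲card
          gcongr
      have hrt : (#r.toFinset : ℝ) ≤ 2 * k * (ε * p ^ (k + 1) * 𝐧) := by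
        have h1 : (#r.toFinset : ℝ) ≤ 2 * k := by
          have := r.toFinset_card_le
          exact_mod_cast (by omega : #r.toFinset ≤ 2 * k)
        have : (0 : ℝ) ≤ 2 * k := by positivity
        nlinarith
      obtain ⟨u, hu, huB⟩ := exists_mem_notMem_of_card (C := nb G (r.take k) S)
        (B := B ∪ r.toFinset) (by
          have h1 := hbig S (mem_insert_self _ _) k le_rfl
          have h2 : (#(B ∪ r.toFinset) : ℝ) ≤ _ := Nat.cast_le.2 (card_union_le _ _)
          push_cast at h2
          have h3 : (7 * k + 1) * ε * (p ^ (k + 1) * 𝐧) < c / 8 ^ k * (p ^ (k + 1) * 𝐧) := by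
            gcongr
          have h4 : 0 < ε * p ^ (k + 1) * 𝐧 := by positivity
          linarith)
      simp only [B, mem_union, not_or, mem_biUnion, not_exists, not_and, mem_product, mem_range,
        List.mem_toFinset] at huB
      obtain ⟨huS, hadj⟩ := mem_nb.1 hu
      refine ⟨u, ⟨fun x hx => (hadj x hx).symm, hr1⟩, List.nodup_cons.2 ⟨huB.2, hr2⟩,
        by simpa using ⟨huS, hr3⟩, fun W hW j hj => ?_⟩
      cases j with
      | zero => simp
      | succ j =>
        have h1 := notMem_poor.1 (huB.1 (W, j) ⟨hW, by omega⟩)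
        have h2 := hr4 W hW j (by omega)
        rw [List.take_succ_cons, nb_cons, pow_succ]
        calc (p / 8) ^ j * (p / 8) * (#W : ℝ) = p / 8 * ((p / 8) ^ j * #W) := by ring
          _ ≤ p / 8 * #(nb G (r.take j) W) := by gcongr
          _ ≤ _ := h1)
  obtain ⟨hr1, hr2, hr3, hr4⟩ := hsuf r List.suffix_rfl
  have hv : ∀ x ∈ r, G.Adj v x := fun x hx => (mem_nb_singleton.1 (hr3 x hx)).2
  have hsize : ∀ W ∈ 𝒲, γ * 𝐧 ≤ #W → ∀ j ≤ k, γ / 8 ^ k * p ^ j * 𝐧 ≤ (p / 8) ^ j * #W :=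
    fun W _ hW j hj => by
      have hγ : 0 < γ := by linarith
      calc γ / 8 ^ k * p ^ j * 𝐧 ≤ γ / 8 ^ j * p ^ j * 𝐧 := by
            have : (8 : ℝ) ^ j ≤ 8 ^ k := pow_le_pow_right₀ (by norm_num) hj
            gcongr
        _ = (p / 8) ^ j * (γ * 𝐧) := by rw [div_pow]; ring
        _ ≤ _ := by gcongr
  have hlen : (r.take k).length = k := by rw [List.length_take]; omega
  have hdrop : (r.drop k).length = k := by rw [List.length_drop]; omega
  have hvr : v ∉ r := fun hvr => G.irrefl (hv v hvr)
  refine ⟨r, r.take k ++ v :: r.drop k, hr1, KAdj.insert_mid (by rwa [List.take_append_drop])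
    (by rwa [List.take_append_drop]), hr2, ?_, ?_, fun x hx => nb_subset (hr3 x hx), by omega,
    hr.le, List.take_left' hlen, ?_, fun j hj => ?_, fun T hT j hj => ?_⟩
  · rw [List.nodup_middle, List.take_append_drop]
    exact List.nodup_cons.2 ⟨hvr, hr2⟩
  · ext x
    have : x ∈ r ↔ x ∈ r.take k ∨ x ∈ r.drop k := by
      rw [← List.mem_append, List.take_append_drop]
    simp [this]
  · conv_rhs => rw [← List.take_append_drop k r]
    rw [List.reverse_append, List.reverse_append, List.reverse_cons, List.append_assoc,
      List.take_left' (by simpa using hdrop), List.take_left' (by simpa using hdrop)]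
  · rw [List.take_take, min_eq_left hj]
    exact (hsize U (by simp [h𝒲]) hU j hj).trans (hr4 U (by simp [h𝒲]) j hj)
  · rw [List.take_take, min_eq_left hj, List.take_reverse, nb_reverse]
    -- The list grew by prepending, so its last `j` members are an earlier stage of the
    -- construction, at which they were already typical.
    have h1 := (hsuf (r.drop (r.length - j)) (List.drop_suffix _ _)).2.2.2 T (by simp [h𝒲, hT]) j hj
    rw [List.take_of_length_le (by rw [List.length_drop]; omega)] at h1
    exact (hsize T (by simp [h𝒲, hT]) (h𝒯 T hT) j hj).trans h1

end

end HamPow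

/-! ### Extending an absorbing path. -/

namespace HamPow
open scoped Classical
open Finset

/-- There is a path with first end `f` and last end `e`, which covers `T` and into which any part
of `R` can be absorbed. -/
def Absorbing {V : Type*} (G : SimpleGraph V) (k : ℕ) (f e : List V) (T R : Finset V) : Prop :=
  Disjoint T R ∧ ∀ S ⊆ R, PathOn G k f e (T ∪ S)

theorem exists_of_decreasing {σ : Type*} (I halt : σ → Prop) (μ : σ → ℕ)
    (h : ∀ s, I s → ¬ halt s → ∃ s', I s' ∧ μ s' < μ s) {s : σ} (hs : I s) :
    ∃ s', I s' ∧ halt s' := by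
  induction hn : μ s using Nat.strong_induction_on generalizing s with
  | _ n ih =>
    by_cases hst : halt s
    · exact ⟨s, hs, hst⟩
    · obtain ⟨s', hs', hlt⟩ := h s hs hst
      exact ih _ (hn ▸ hlt) hs' rfl

section

variable {V : Type*} {G : SimpleGraph V} {k : ℕ} {f e : List V}

theorem PathOn.kadj_left {S : Finset V} (h : PathOn G k f e S) : KAdj G k f := by
  obtain ⟨l, hl, -, -, rfl, -⟩ := h
  exact hl.take k

theorem PathOn.kadj_right {S : Finset V} (h : PathOn G k f e S) : KAdj G k e := by
  obtain ⟨l, hl, -, -, -, rfl, -⟩ := h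
  exact hl.reverse.take k

variable [Fintype V] {p : ℝ}

local notation "𝐧" => (Fintype.card V : ℝ)

/-- A vertex with many neighbours in `U` can be added to the path or to the set of vertices which
can be absorbed, using few vertices of `U`. -/
theorem Absorbing.extend {c γ cv : ℝ} {K : ℕ} (hp : 0 < p) (hp1 : p ≤ 1)
    (hC : Conn G k p (c / 8) γ K) (hG : Gad G k p cv γ c K) (hc : 0 < c)
    (hcK : 2 * K + 1 ≤ c / 8 * p ^ k * 𝐧) (hγK : K + 1 ≤ γ * 𝐧) {T R : Finset V}
    (h : Absorbing G k f e T R) {U : Finset V} {v : V} {𝒯 : Finset (Finset V)} (hTU : Disjoint T U)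
    (hvT : v ∉ T) (hU : 2 * γ * 𝐧 ≤ #U) (hv : cv * p * 𝐧 ≤ #(nb G [v] U)) (h𝒯 : #𝒯 ≤ 3)
    (h𝒯U : ∀ W ∈ 𝒯, 2 * γ * 𝐧 ≤ #W) (he : Typ G p k (c / 4) e U) :
    ∃ (e' : List V) (D : Finset V), D ⊆ U ∧ v ∉ D ∧ #D ≤ 2 * K ∧
      (∀ W ∈ 𝒯, Typ G p k (c / 2) e' (W \ insert v D)) ∧
      Absorbing G k f e' (insert v (T ∪ D)) (R \ insert v D) ∧
      Absorbing G k f e' (T ∪ D) (insert v (R \ D)) := by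
  have hK : (0 : ℝ) ≤ K := Nat.cast_nonneg K
  have herase : ∀ W : Finset V, 2 * γ * 𝐧 ≤ #W → γ * 𝐧 ≤ #(W.erase v) := fun W hW => by
    have h1 := card_sdiff_real W {v}
    rw [sdiff_singleton_eq_erase, card_singleton] at h1
    push_cast at h1
    linarith
  have hnbv : nb G [v] (U.erase v) = nb G [v] U := by
    ext x
    simp only [mem_nb_singleton, mem_erase]
    exact ⟨fun h => ⟨h.1.2, h.2⟩, fun h => ⟨⟨h.2.ne', h.1⟩, h.2⟩⟩
  obtain ⟨l, l', hl, hl', hln, hln', hll', hlU, hkl, hlK, htake, hrev, hT1, hT2⟩ :=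
    hG (U.erase v) v (𝒯.image fun W => W.erase v) (herase U hU) (notMem_erase v U)
      (by rwa [hnbv]) (card_image_le.trans h𝒯) (by
        intro W hW
        obtain ⟨W', hW', rfl⟩ := mem_image.1 hW
        exact herase W' (h𝒯U W' hW'))
  have hlc : (#l.toFinset : ℝ) ≤ K := by
    exact_mod_cast (List.toFinset_card_le l).trans hlK
  have hP := h.2 ∅ (empty_subset R)
  have hlv : ∀ x ∈ l, x ≠ v ∧ x ∈ U := fun x hx => by simpa using hlU x hx
  -- The two versions `l` and `l'` of the gadget start with the same `k` vertices, so one connection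
  -- `m` serves both.
  obtain ⟨m, hmU, hmn, hmK, hm⟩ := hC (U.erase v \ l.toFinset) e (l.take k) (by
      have h1 := card_sdiff_real U (insert v l.toFinset)
      have h2 : (#(insert v l.toFinset) : ℝ) ≤ #l.toFinset + 1 := by
        exact_mod_cast card_insert_le _ _
      have h3 : U.erase v \ l.toFinset = U \ insert v l.toFinset := by
        ext; simp; tauto
      rw [h3]; linarith) hP.length_right (by rw [List.length_take]; omega) hP.kadj_right
    (hl.take k) (by
      have h3 : U.erase v \ l.toFinset = U \ insert v l.toFinset := by
        ext; simp; tauto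
      have h2 : (#(insert v l.toFinset) : ℝ) ≤ #l.toFinset + 1 := by
        exact_mod_cast card_insert_le _ _
      rw [h3]
      refine he.sdiff hp.le hp1 (by linarith) ?_
      rw [show c / 4 - c / 8 = c / 8 by ring]
      linarith) (by
      have h0 : 0 < p ^ k := by positivity
      refine hT1.sdiff hp.le hp1 (by linarith) ?_
      have : c / 8 * p ^ k * 𝐧 ≤ (c - c / 8) * p ^ k * 𝐧 := by gcongr; linarith
      linarith)
  have hmv : ∀ x ∈ m, (x ≠ v ∧ x ∈ U) ∧ x ∉ l := fun x hx => by simpa using hmU x hx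
  have hTU' : ∀ x ∈ U, x ∉ T := fun x hx hx' => disjoint_left.1 hTU hx' hx
  set D := m.toFinset ∪ l.toFinset with hD
  have hDmem : ∀ x, x ∈ D ↔ x ∈ m ∨ x ∈ l := fun x => by simp [hD]
  have hDv : v ∉ D := fun hvD => by
    rcases (hDmem v).1 hvD with h | h
    exacts [(hmv v h).1.1 rfl, (hlv v h).1 rfl]
  have hDU : D ⊆ U := fun x hx => by
    rcases (hDmem x).1 hx with h | h
    exacts [(hmv x h).1.2, (hlv x h).2]
  have hDK : #D ≤ 2 * K := by
    have h1 := card_union_le m.toFinset l.toFinset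
    have h2 := List.toFinset_card_le m
    have h3 := List.toFinset_card_le l
    rw [hD]
    omega
  -- Version `l` skips `v` and version `l'`, used in `key2`, contains it. Always using `l'` covers
  -- `v` for good; choosing according to whether `v ∈ S` makes `v` absorbable. If `D` meets the
  -- reservoir, those vertices become permanent members of the path.
  have key1 : ∀ S ⊆ R \ D, PathOn G k f (l.reverse.take k) (T ∪ S ∪ D) := fun S hS => by
    have hS' : ∀ x ∈ S, x ∈ R ∧ x ∉ D := fun x hx => by simpa using hS hx
    have hPS := h.2 S fun x hx => (hS' x hx).1
    have hno : ∀ x ∈ D, x ∉ T ∪ S := fun x hx hxS => by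
      rcases mem_union.1 hxS with hxT | hxS
      exacts [hTU' x (hDU hx) hxT, (hS' x hxS).2 hx]
    have := hPS.append (PathOn.of_kadj hl hln hkl) hm hmn
      (disjoint_left.2 fun x hx hx' => hno x ((hDmem x).2 (Or.inr (List.mem_toFinset.1 hx'))) hx)
      (fun x hx => hno x ((hDmem x).2 (Or.inl hx)))
      (fun x hx => by simpa using (hmv x hx).2)
    rwa [union_assoc (T ∪ S)] at this
  have key2 : ∀ S ⊆ R \ insert v D, PathOn G k f (l.reverse.take k) (T ∪ S ∪ insert v D) :=
    fun S hS => by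
    have hS' : ∀ x ∈ S, x ∈ R ∧ x ≠ v ∧ x ∉ D := fun x hx => by simpa using hS hx
    have hPS := h.2 S fun x hx => (hS' x hx).1
    have hno : ∀ x ∈ D, x ∉ T ∪ S := fun x hx hxS => by
      rcases mem_union.1 hxS with hxT | hxS
      exacts [hTU' x (hDU hx) hxT, (hS' x hxS).2.2 hx]
    have hlen : l'.length = l.length + 1 := by
      rw [← List.toFinset_card_of_nodup hln', hll', card_insert_of_notMem,
        List.toFinset_card_of_nodup hln]
      simpa using fun h => (hlv v h).1 rfl
    have := hPS.append (PathOn.of_kadj hl' hln' (by omega)) (by rw [htake]; exact hm) hmn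
      (disjoint_left.2 fun x hx hx' => by
        rw [hll', mem_insert, List.mem_toFinset] at hx'
        rcases hx' with rfl | hx'
        · rcases mem_union.1 hx with hx | hx
          exacts [hvT hx, (hS' x hx).2.1 rfl]
        · exact hno x ((hDmem x).2 (Or.inr hx')) hx)
      (fun x hx => hno x ((hDmem x).2 (Or.inl hx)))
      (fun x hx => by simpa [hll'] using ⟨(hmv x hx).1.1, (hmv x hx).2⟩)
    rw [hrev, hll', union_assoc (T ∪ S), union_insert] at this
    exact this
  refine ⟨l.reverse.take k, D, hDU, hDv, hDK, fun W hW => ?_, ⟨?_, fun S hS => ?_⟩, ?_,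
    fun S hS => ?_⟩
  · have h1 := hT2 (W.erase v) (mem_image_of_mem _ hW)
    have h2 : W.erase v \ D = W \ insert v D := by ext; simp; tauto
    rw [← h2]
    have h0 : 0 < p ^ k := by positivity
    refine h1.sdiff hp.le hp1 (by linarith) ?_
    have h3 : c / 8 * p ^ k * 𝐧 ≤ (c - c / 2) * p ^ k * 𝐧 := by gcongr; linarith
    have h4 : (#D : ℝ) ≤ 2 * K := by exact_mod_cast hDK
    linarith
  · refine disjoint_left.2 fun x hx hx' => ?_
    simp only [mem_insert, mem_union, mem_sdiff, not_or] at hx hx'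
    have : x ∈ T → x ∉ R := fun hxT => disjoint_left.1 h.1 hxT
    tauto
  · have := key2 S hS
    rwa [show T ∪ S ∪ insert v D = insert v (T ∪ D) ∪ S by ext; simp; tauto] at this
  · refine disjoint_left.2 fun x hx hx' => ?_
    simp only [mem_insert, mem_union, mem_sdiff] at hx hx'
    have : x ∈ T → x ∉ R := fun hxT => disjoint_left.1 h.1 hxT
    rcases hx' with rfl | hx' <;> tauto
  · by_cases hvS : v ∈ S
    · have := key2 (S.erase v) fun x hx => by
        have := hS (mem_of_mem_erase hx)
        simp only [mem_insert, mem_sdiff, mem_erase] at this hx ⊢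
        tauto
      rwa [show T ∪ S.erase v ∪ insert v D = T ∪ D ∪ S by
        ext x; simp only [mem_union, mem_insert, mem_erase]
        by_cases hx : x = v
        · subst hx; simp [hvS]
        · simp [hx]; tauto] at this
    · have := key1 S fun x hx => by
        have h1 := hS hx
        rcases mem_insert.1 h1 with rfl | h1
        exacts [absurd hx hvS, h1]
      rwa [union_right_comm] at this

end

end HamPow

/-! ### The hierarchy of constants and the growth of the path. -/

namespace HamPow
open scoped Classical
open Finset

/-- Short connections and absorbers exist in `G`, for a suitable hierarchy of constants. -/
structure Setting {V : Type*} [Fintype V] (G : SimpleGraph V) (k : ℕ) (p ε β α γ c cv : ℝ)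
    (K : ℕ) : Prop where
  hp : 0 < p
  hp1 : p ≤ 1
  hk : 1 ≤ k
  hK : 1 ≤ K
  hε : 0 < ε
  hN : 1 ≤ ε * p ^ k * (Fintype.card V : ℝ)
  lower : LowerReg G ε p k 0
  conn : Conn G k p (c / 8) γ K
  gad : Gad G k p cv γ c K
  deg : ∀ v, β * p * (Fintype.card V : ℝ) ≤ #(nb G [v] univ)
  hα : 0 < α
  hαK : 48 * K * α ≤ 1
  hαβ : α ≤ β
  hγ : 16 * K * γ = α
  hc : 0 < c
  hcγ : c ≤ γ
  hcvβ : cv ≤ β / 8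
  hcvγ : cv ≤ γ / 4
  hεc : 100 * K * ε ≤ c

section

variable {V : Type*} [Fintype V] {G : SimpleGraph V} {k : ℕ} {p ε β α γ c cv : ℝ} {K : ℕ}
  {f : List V}

local notation "𝐧" => (Fintype.card V : ℝ)

theorem Setting.card_pos (h : Setting G k p ε β α γ c cv K) : 0 < 𝐧 := by
  by_contra! hc
  have := h.hp
  have := h.hε
  have : ε * p ^ k * 𝐧 ≤ 0 := mul_nonpos_of_nonneg_of_nonpos (by positivity) hc
  linarith [h.hN]

theorem Setting.le_c (h : Setting G k p ε β α γ c cv K) :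
    100 * (K * (ε * p ^ k * 𝐧)) ≤ c * p ^ k * 𝐧 := by
  have := h.hp
  calc 100 * (K * (ε * p ^ k * 𝐧)) = 100 * K * ε * (p ^ k * 𝐧) := by ring
    _ ≤ c * (p ^ k * 𝐧) := by gcongr; exact h.hεc
    _ = _ := by ring

theorem Setting.c_le (h : Setting G k p ε β α γ c cv K) : c * p ^ k * 𝐧 ≤ γ * p * 𝐧 := by
  have := h.hp
  have h1 : p ^ k ≤ p := pow_le_of_le_one h.hp.le h.hp1 (by have := h.hk; omega)
  have := h.hc
  have := h.hcγ
  have : 0 ≤ γ := by linarith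
  gcongr

theorem Setting.hγ0 (h : Setting G k p ε β α γ c cv K) : 0 < γ := h.hc.trans_le h.hcγ

theorem Setting.mul_p_le (h : Setting G k p ε β α γ c cv K) {x : ℝ} (hx : 0 ≤ x) :
    x * p * 𝐧 ≤ x * 𝐧 := by
  have := h.hp1
  have := h.card_pos
  gcongr
  exact mul_le_of_le_one_right hx h.hp1

theorem Setting.small_le (h : Setting G k p ε β α γ c cv K) :
    ε * p ^ k * 𝐧 ≤ K * (ε * p ^ k * 𝐧) := by
  have h1 : (1 : ℝ) ≤ K := by exact_mod_cast h.hK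
  nlinarith [h.hN]

theorem Setting.K_le (h : Setting G k p ε β α γ c cv K) :
    (K : ℝ) ≤ K * (ε * p ^ k * 𝐧) :=
  le_mul_of_one_le_right (Nat.cast_nonneg K) h.hN

theorem Setting.αγ (h : Setting G k p ε β α γ c cv K) : α * 𝐧 = 16 * (K * (γ * 𝐧)) := by
  rw [← h.hγ]; ring

theorem Setting.γ_le (h : Setting G k p ε β α γ c cv K) : γ * 𝐧 ≤ K * (γ * 𝐧) := by
  have h1 : (1 : ℝ) ≤ K := by exact_mod_cast h.hK
  have := h.hγ0
  have := h.card_pos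
  exact le_mul_of_one_le_left (by positivity) h1

theorem Setting.α_le (h : Setting G k p ε β α γ c cv K) : 48 * (K * (α * 𝐧)) ≤ 𝐧 := by
  have := h.card_pos
  calc 48 * (K * (α * 𝐧)) = 48 * K * α * 𝐧 := by ring
    _ ≤ 1 * 𝐧 := by gcongr; exact h.hαK
    _ = 𝐧 := one_mul _

theorem Setting.α_le' (h : Setting G k p ε β α γ c cv K) : α * 𝐧 ≤ K * (α * 𝐧) := by
  have h1 : (1 : ℝ) ≤ K := by exact_mod_cast h.hK
  have := h.hα
  have := h.card_pos
  exact le_mul_of_one_le_left (by positivity) h1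

theorem Setting.card_poor (h : Setting G k p ε β α γ c cv K) {U : Finset V}
    (hU : 2 * γ * 𝐧 ≤ #U) : (#(poor G p U) : ℝ) ≤ ε * p ^ k * 𝐧 := by
  refine h.lower U ?_
  have h1 : ε ≤ γ := by
    have h1 : (1 : ℝ) ≤ K := by exact_mod_cast h.hK
    nlinarith [h.hεc, h.hcγ, h.hε]
  have := h.hγ0
  have := h.card_pos
  rw [pow_zero, mul_one]
  refine le_trans ?_ hU
  gcongr
  linarith

theorem Setting.deg_of_notMem_poor (h : Setting G k p ε β α γ c cv K) {U : Finset V} {v : V}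
    (hU : 2 * γ * 𝐧 ≤ #U) (hv : v ∉ poor G p U) : cv * p * 𝐧 ≤ #(nb G [v] U) := by
  have hp := h.hp
  have := h.card_pos
  calc cv * p * 𝐧 ≤ γ / 4 * p * 𝐧 := by gcongr; exact h.hcvγ
    _ = p / 8 * (2 * γ * 𝐧) := by ring
    _ ≤ p / 8 * #U := by gcongr
    _ ≤ _ := notMem_poor.1 hv

theorem Setting.exists_good (h : Setting G k p ε β α γ c cv K) {U L : Finset V}
    (hU : 2 * γ * 𝐧 ≤ #U) (hL : ε * p ^ k * 𝐧 < #L) :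
    ∃ v ∈ L, cv * p * 𝐧 ≤ #(nb G [v] U) := by
  obtain ⟨v, hvL, hv⟩ := exists_mem_notMem_of_card ((h.card_poor hU).trans_lt hL)
  exact ⟨v, hvL, h.deg_of_notMem_poor hU hv⟩

theorem Setting.extend (h : Setting G k p ε β α γ c cv K) {e : List V} {T R : Finset V}
    (ha : Absorbing G k f e T R) {U : Finset V} {v : V} {𝒯 : Finset (Finset V)}
    (hTU : Disjoint T U) (hvT : v ∉ T) (hU : 2 * γ * 𝐧 ≤ #U) (hv : cv * p * 𝐧 ≤ #(nb G [v] U))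
    (h𝒯 : #𝒯 ≤ 3) (h𝒯U : ∀ W ∈ 𝒯, 2 * γ * 𝐧 ≤ #W) (he : Typ G p k (c / 4) e U) :
    ∃ (e' : List V) (D : Finset V), D ⊆ U ∧ v ∉ D ∧ #D ≤ 2 * K ∧
      (∀ W ∈ 𝒯, Typ G p k (c / 2) e' (W \ insert v D)) ∧
      Absorbing G k f e' (insert v (T ∪ D)) (R \ insert v D) ∧
      Absorbing G k f e' (T ∪ D) (insert v (R \ D)) := by
  have h1 : (1 : ℝ) ≤ K := by exact_mod_cast h.hK
  have h2 := h.le_c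
  have h3 := h.c_le
  have h4 := h.mul_p_le h.hγ0.le
  have h5 := h.K_le
  exact ha.extend h.hp h.hp1 h.conn h.gad h.hc (by linarith) (by linarith) hTU hvT hU hv h𝒯 h𝒯U he

/-- A partition of the vertex set into a large part and two small ones. -/
structure Parts {V : Type*} [Fintype V] (α : ℝ) (A : Fin 3 → Finset V) : Prop where
  disj : ∀ i j, i ≠ j → Disjoint (A i) (A j)
  cover : ∀ x, ∃ i, x ∈ A i
  lower1 : α * (Fintype.card V : ℝ) ≤ #(A 1)
  lower2 : α * (Fintype.card V : ℝ) ≤ #(A 2)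
  upper1 : #(A 1) ≤ 2 * α * (Fintype.card V : ℝ)
  upper2 : #(A 2) ≤ 2 * α * (Fintype.card V : ℝ)

theorem Setting.exists_parts (h : Setting G k p ε β α γ c cv K) :
    ∃ A : Fin 3 → Finset V, Parts α A := by
  have hn := h.card_pos
  have h1 : 1 ≤ α * 𝐧 := by
    linarith [h.αγ, h.γ_le, h.mul_p_le h.hγ0.le, h.c_le, h.le_c, h.small_le, h.hN]
  obtain ⟨F, hF, hd⟩ := exists_disjoint_subsets_real 2 (fun _ => (univ : Finset V))
    (fun _ => α * 𝐧) monotone_const h1 fun i _ => by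
      push_cast
      rw [card_univ]
      linarith [h.α_le, h.α_le']
  refine ⟨![univ \ (F 0 ∪ F 1), F 0, F 1], ?_, fun x => ?_, (hF 0 (by norm_num)).2.1,
    (hF 1 (by norm_num)).2.1, ?_, ?_⟩
  · have h01 := hd 0 (by norm_num) 1 (by norm_num) (by norm_num)
    have h2 : Disjoint (univ \ (F 0 ∪ F 1)) (F 0) :=
      disjoint_of_subset_right subset_union_left sdiff_disjoint
    have h3 : Disjoint (univ \ (F 0 ∪ F 1)) (F 1) :=
      disjoint_of_subset_right subset_union_right sdiff_disjoint
    intro i j hij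
    fin_cases i <;> fin_cases j <;> first
      | exact absurd rfl hij
      | exact h01
      | exact h01.symm
      | exact h2
      | exact h2.symm
      | exact h3
      | exact h3.symm
  · by_cases h0 : x ∈ F 0
    · exact ⟨1, h0⟩
    · by_cases h1 : x ∈ F 1
      · exact ⟨2, h1⟩
      · exact ⟨0, by simp [h0, h1]⟩
  · have := (hF 0 (by norm_num)).2.2
    simp only [Matrix.cons_val_one, Matrix.cons_val_zero]
    linarith
  · have := (hF 1 (by norm_num)).2.2
    simp only [Matrix.cons_val]
    linarith

variable {A : Fin 3 → Finset V}

theorem Parts.card_zero (hA : Parts α A) : (1 - 4 * α) * 𝐧 ≤ #(A 0) := by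
  have h1 : Fintype.card V ≤ #(A 0) + (#(A 1) + #(A 2)) := by
    rw [← card_univ]
    refine (card_le_card (t := A 0 ∪ (A 1 ∪ A 2)) fun x _ => ?_).trans
      ((card_union_le _ _).trans (Nat.add_le_add_left (card_union_le _ _) _))
    obtain ⟨i, hi⟩ := hA.cover x
    simp only [mem_union]
    fin_cases i <;> simp_all
  have h2 : 𝐧 ≤ #(A 0) + (#(A 1) + #(A 2)) := by exact_mod_cast h1
  linarith [hA.upper1, hA.upper2]

/-- Not too many vertices outside the large part and not too many others are in `T`. -/
theorem Setting.card_sdiff_le (h : Setting G k p ε β α γ c cv K) (hA : Parts α A) {T : Finset V}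
    (hT : (#T : ℝ) ≤ 4 * (K * (ε * p ^ k * 𝐧))) (i : Fin 3) : 2 * γ * 𝐧 ≤ #(A i \ T) := by
  have h1 := card_sdiff_real (A i) T
  have h2 : α * 𝐧 ≤ #(A i) := by
    fin_cases i
    · have := hA.card_zero
      simp only [Fin.zero_eta]
      linarith [h.α_le, h.α_le']
    · exact hA.lower1
    · exact hA.lower2
  linarith [h.αγ, h.γ_le, h.mul_p_le h.hγ0.le, h.c_le, h.le_c]

/-- A gadget is used merely as a supply of a path with typical ends: its vertex `v` and its second
version are discarded. It lies in `A 2`, where the cycle will be closed at `f`. -/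
theorem Setting.start (h : Setting G k p ε β α γ c cv K) (hA : Parts α A) :
    ∃ (f e : List V) (T : Finset V), Absorbing G k f e T ∅ ∧ #T ≤ K ∧ Typ G p k c f (A 2) ∧
      ∀ i, Typ G p k (c / 2) e (A i \ T) := by
  have hsz : ∀ i, 2 * γ * 𝐧 ≤ #(A i) := fun i => by
    have h1 : (0 : ℝ) ≤ 4 * (K * (ε * p ^ k * 𝐧)) := by linarith [h.small_le, h.hN]
    simpa using h.card_sdiff_le hA (T := ∅) (by simpa using h1) i
  have hγ1 : 1 ≤ γ * 𝐧 := by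
    linarith [h.mul_p_le h.hγ0.le, h.c_le, h.le_c, h.small_le, h.hN]
  obtain ⟨v, -, hv⟩ := h.exists_good (L := univ) (hsz 2) (by
    rw [card_univ]
    have h4 := h.card_pos
    have := h.mul_p_le h.hα.le
    linarith [h.αγ, h.γ_le, h.mul_p_le h.hγ0.le, h.c_le, h.le_c, h.small_le, h.α_le, h.α_le',
      h.hN])
  have hnbv : nb G [v] ((A 2).erase v) = nb G [v] (A 2) := by
    ext x
    simp only [mem_nb_singleton, mem_erase]
    exact ⟨fun h => ⟨h.1.2, h.2⟩, fun h => ⟨⟨h.2.ne', h.1⟩, h.2⟩⟩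
  have h2 : γ * 𝐧 ≤ #((A 2).erase v) := by
    have h1 := card_sdiff_real (A 2) {v}
    rw [sdiff_singleton_eq_erase, card_singleton] at h1
    push_cast at h1
    linarith [hsz 2]
  obtain ⟨l, -, hl, -, hln, -, -, hlU, hkl, hlK, -, -, hT1, hT2⟩ :=
    h.gad ((A 2).erase v) v (univ.image A) h2 (notMem_erase v _) (by rwa [hnbv])
      (card_image_le.trans (by simp)) (by
        intro W hW
        obtain ⟨i, -, rfl⟩ := mem_image.1 hW
        linarith [hsz i])
  refine ⟨l.take k, l.reverse.take k, l.toFinset, ⟨disjoint_empty_right _, fun S hS => ?_⟩,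
    (List.toFinset_card_le l).trans hlK, hT1.mono_right (erase_subset _ _), fun i => ?_⟩
  · rw [subset_empty.1 hS, union_empty]
    exact PathOn.of_kadj hl hln hkl
  · refine (hT2 (A i) (mem_image_of_mem _ (mem_univ i))).sdiff h.hp.le h.hp1
      (by linarith [h.hc]) ?_
    have h3 : (#l.toFinset : ℝ) ≤ K := by exact_mod_cast (List.toFinset_card_le l).trans hlK
    have h4 : (c - c / 2) * p ^ k * 𝐧 = c * p ^ k * 𝐧 / 2 := by ring
    linarith [h.K_le, h.le_c, h.small_le, h.hN]

/-- The vertices with few neighbours in the last part can be covered. -/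
theorem Setting.cover_poor (h : Setting G k p ε β α γ c cv K) (hA : Parts α A) {e : List V}
    {T : Finset V} (ha : Absorbing G k f e T ∅) (hT : #T ≤ K)
    (he : ∀ i, Typ G p k (c / 2) e (A i \ T)) :
    ∃ (e : List V) (T : Finset V), Absorbing G k f e T ∅ ∧
      (#T : ℝ) ≤ 4 * (K * (ε * p ^ k * 𝐧)) ∧ poor G p (A 2) ⊆ T ∧
      ∀ i, Typ G p k (c / 2) e (A i \ T) := by
  set E := poor G p (A 2) with hE
  have hEc : (#E : ℝ) ≤ ε * p ^ k * 𝐧 := h.card_poor (by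
    have := h.card_sdiff_le hA (T := ∅) (by simp; linarith [h.small_le, h.hN]) 2
    simpa using this)
  have hTc : ∀ T : Finset V, #T ≤ K + (2 * K + 1) * #(E ∩ T) →
      (#T : ℝ) ≤ 4 * (K * (ε * p ^ k * 𝐧)) := fun T hT => by
    have h1 : (#T : ℝ) ≤ K + (2 * K + 1) * #(E ∩ T) := by exact_mod_cast hT
    have h2 : (#(E ∩ T) : ℝ) ≤ ε * p ^ k * 𝐧 :=
      le_trans (by exact_mod_cast card_le_card inter_subset_left) hEc
    have h3 : (2 * K + 1) * (#(E ∩ T) : ℝ) ≤ (2 * K + 1) * (ε * p ^ k * 𝐧) := by gcongr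
    linarith [h.K_le, h.small_le]
  -- Each poor vertex costs itself and at most 2K further vertices. As there are at most ε p^k n of
  -- them, the path stays small.
  obtain ⟨⟨e', T'⟩, ⟨h1, h2, h3⟩, h4⟩ := exists_of_decreasing (σ := List V × Finset V)
    (fun s => Absorbing G k f s.1 s.2 ∅ ∧ #s.2 ≤ K + (2 * K + 1) * #(E ∩ s.2) ∧
      ∀ i, Typ G p k (c / 2) s.1 (A i \ s.2)) (fun s => E ⊆ s.2) (fun s => #(E \ s.2))
    (by
      rintro ⟨e, T⟩ ⟨ha, hT, he⟩ hhalt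
      dsimp only at ha hT he hhalt ⊢
      obtain ⟨v, hvE, hvT⟩ := not_subset.1 hhalt
      have hT' := hTc T hT
      have hsz := h.card_sdiff_le hA hT'
      -- The vertex `v` has at least β p n neighbours, few of them in `A 2` because it is poor, and
      -- few in `T` because `T` is small. So `A 0` or `A 1` must contain many unused ones.
      have hdeg : ∃ i, cv * p * 𝐧 ≤ #(nb G [v] (A i \ T)) := by
        by_contra! hc
        have e1 : #(nb G [v] univ) ≤ #T + (#(nb G [v] (A 2)) +
            (#(nb G [v] (A 0 \ T)) + #(nb G [v] (A 1 \ T)))) := by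
          refine (card_le_card (t := T ∪ (nb G [v] (A 2) ∪ (nb G [v] (A 0 \ T) ∪
            nb G [v] (A 1 \ T)))) fun x hx => ?_).trans ((card_union_le _ _).trans
            (Nat.add_le_add_left ((card_union_le _ _).trans
              (Nat.add_le_add_left (card_union_le _ _) _)) _))
          obtain ⟨i, hi⟩ := hA.cover x
          have := (mem_nb_singleton.1 hx).2
          simp only [mem_union, mem_nb_singleton, mem_sdiff]
          fin_cases i <;> simp_all <;> tauto
        have e2 : (#(nb G [v] univ) : ℝ) ≤ #T + (#(nb G [v] (A 2)) +
            (#(nb G [v] (A 0 \ T)) + #(nb G [v] (A 1 \ T)))) := by exact_mod_cast e1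
        have e3 := mem_poor.1 hvE
        have e4 : p / 8 * #(A 2) ≤ p / 8 * (2 * α * 𝐧) := by
          have := h.hp
          gcongr
          exact hA.upper2
        have hp := h.hp
        have hn := h.card_pos
        have e5 : α * p * 𝐧 ≤ β * p * 𝐧 := by gcongr; exact h.hαβ
        have e6 : cv * p * 𝐧 ≤ β / 8 * p * 𝐧 := by gcongr; exact h.hcvβ
        have e7 : 16 * (γ * p * 𝐧) ≤ α * p * 𝐧 := by
          have : 16 * γ ≤ α := by
            rw [← h.hγ]
            have h1 : (1 : ℝ) ≤ K := by exact_mod_cast h.hK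
            nlinarith [h.hγ0]
          calc 16 * (γ * p * 𝐧) = 16 * γ * p * 𝐧 := by ring
            _ ≤ _ := by gcongr
        have e8 : 0 < γ * p * 𝐧 := by have := h.hγ0; positivity
        linarith [hc 0, hc 1, h.deg v, h.le_c, h.c_le]
      obtain ⟨i, hi⟩ := hdeg
      obtain ⟨e', D, hD, hvD, hDK, hTyp, ha', -⟩ := h.extend ha (U := A i \ T) (v := v)
        (𝒯 := univ.image fun j => A j \ T) disjoint_sdiff hvT (hsz i) hi
        (card_image_le.trans (by simp)) (by simpa using hsz)
        ((he i).mono_left h.hp.le (by linarith [h.hc]))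
      rw [empty_sdiff] at ha'
      refine ⟨(e', insert v (T ∪ D)), ⟨ha', ?_, fun j => ?_⟩, card_lt_card ?_⟩
      · have h1 : #(insert v (T ∪ D)) ≤ #T + #D + 1 :=
          (card_insert_le _ _).trans (Nat.add_le_add_right (card_union_le _ _) _)
        have h2 : #(E ∩ T) + 1 ≤ #(E ∩ insert v (T ∪ D)) := by
          rw [← card_insert_of_notMem (s := E ∩ T) (a := v) (by simp [hvT])]
          refine card_le_card fun x hx => ?_
          simp only [mem_insert, mem_inter, mem_union] at hx ⊢
          rcases hx with rfl | hx
          · exact ⟨hvE, Or.inl rfl⟩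
          · exact ⟨hx.1, Or.inr (Or.inl hx.2)⟩
        dsimp only
        nlinarith
      · have := hTyp _ (mem_image_of_mem _ (mem_univ j))
        rwa [show (A j \ T) \ insert v D = A j \ insert v (T ∪ D) by ext; simp; tauto] at this
      · refine ⟨fun x hx => ?_, fun hsub => ?_⟩
        · simp only [mem_sdiff, mem_insert, mem_union, not_or] at hx ⊢
          exact ⟨hx.1, hx.2.2.1⟩
        · have := hsub (mem_sdiff.2 ⟨hvE, hvT⟩)
          simp at this)
    (s := (e, T)) ⟨ha, hT.trans (Nat.le_add_right _ _), he⟩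
  exact ⟨e', T', h1, hTc _ h2, h4, h3⟩

end

end HamPow

namespace HamPow
open scoped Classical
open Finset

section

variable {V : Type*} [Fintype V] {G : SimpleGraph V} {k : ℕ} {p ε β α γ c cv : ℝ} {K : ℕ}
  {f : List V} {A : Fin 3 → Finset V}

local notation "𝐧" => (Fintype.card V : ℝ)

/-- Most vertices of the small parts can be made absorbable. -/
theorem Setting.absorb (h : Setting G k p ε β α γ c cv K) (hA : Parts α A) {e : List V}
    {T : Finset V} (ha : Absorbing G k f e T ∅) (hT : (#T : ℝ) ≤ 4 * (K * (ε * p ^ k * 𝐧)))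
    (he : ∀ i, Typ G p k (c / 2) e (A i \ T)) :
    ∃ (e' : List V) (T' R : Finset V), Absorbing G k f e' T' R ∧ R ⊆ A 1 ∪ A 2 ∧ T ⊆ T' ∧
      (∀ x ∈ A 1 ∪ A 2, x ∈ T' → x ∈ T) ∧
      (#((A 1 ∪ A 2) \ (T' ∪ R)) : ℝ) ≤ ε * p ^ k * 𝐧 ∧
      ∀ i, Typ G p k (c / 2) e' (A i \ T') := by
  have h12 : ∀ x ∈ A 1 ∪ A 2, x ∉ A 0 := fun x hx hx0 => by
    rcases mem_union.1 hx with hx | hx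
    exacts [disjoint_left.1 (hA.disj 0 1 (by decide)) hx0 hx,
      disjoint_left.1 (hA.disj 0 2 (by decide)) hx0 hx]
  obtain ⟨⟨e', T', R'⟩, ⟨h1, h2, h3, h4, -, h5⟩, h6⟩ := exists_of_decreasing
    (σ := List V × Finset V × Finset V)
    (fun s => Absorbing G k f s.1 s.2.1 s.2.2 ∧ s.2.2 ⊆ A 1 ∪ A 2 ∧ T ⊆ s.2.1 ∧
      (∀ x ∈ A 1 ∪ A 2, x ∈ s.2.1 → x ∈ T) ∧ #s.2.1 ≤ #T + 2 * K * #s.2.2 ∧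
      ∀ i, Typ G p k (c / 2) s.1 (A i \ s.2.1))
    (fun s => (#((A 1 ∪ A 2) \ (s.2.1 ∪ s.2.2)) : ℝ) ≤ ε * p ^ k * 𝐧)
    (fun s => #((A 1 ∪ A 2) \ (s.2.1 ∪ s.2.2)))
    (by
      rintro ⟨e', T', R⟩ ⟨ha, hR, hTT', hT', hcard, he⟩ hhalt
      dsimp only at ha hR hTT' hT' hcard he hhalt ⊢
      rw [not_le] at hhalt
      have hRc : (#R : ℝ) ≤ 4 * (α * 𝐧) := by
        have h1 : (#R : ℝ) ≤ #(A 1) + #(A 2) := by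
          exact_mod_cast (card_le_card hR).trans (card_union_le _ _)
        linarith [hA.upper1, hA.upper2]
      -- The path has at most |T| + 2K|R| vertices and |R| ≤ 4αn, so the bound 48Kα ≤ 1 keeps `A 0`
      -- far from exhausted. The other two parts are not touched: all gadget and connection vertices
      -- come from `A 0`.
      have hsz : ∀ i, 2 * γ * 𝐧 ≤ #(A i \ T') := fun i => by
        by_cases hi : i = 0
        · subst hi
          have h1 : (#T' : ℝ) ≤ #T + 2 * K * #R := by exact_mod_cast hcard
          have h2 : 2 * K * (#R : ℝ) ≤ 2 * K * (4 * (α * 𝐧)) := by gcongr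
          linarith [card_sdiff_real (A 0) T', hA.card_zero, h.α_le, h.α_le', h.αγ, h.γ_le,
            h.mul_p_le h.hγ0.le, h.c_le, h.le_c]
        · refine (h.card_sdiff_le hA hT i).trans ?_
          exact_mod_cast card_le_card fun x hx => by
            rw [mem_sdiff] at hx ⊢
            refine ⟨hx.1, fun hxT => hx.2 (hT' x ?_ hxT)⟩
            rw [mem_union]
            fin_cases i
            exacts [absurd rfl hi, Or.inl hx.1, Or.inr hx.1]
      obtain ⟨v, hvL, hv⟩ := h.exists_good (hsz 0) hhalt
      simp only [mem_sdiff, mem_union (s := T'), not_or] at hvL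
      obtain ⟨e'', D, hD, hvD, hDK, hTyp, -, ha'⟩ := h.extend ha (U := A 0 \ T') (v := v)
        (𝒯 := univ.image fun j => A j \ T') disjoint_sdiff hvL.2.1 (hsz 0) hv
        (card_image_le.trans (by simp)) (by simpa using hsz)
        ((he 0).mono_left h.hp.le (by linarith [h.hc]))
      have hD0 : ∀ x ∈ D, x ∈ A 0 := fun x hx => (mem_sdiff.1 (hD hx)).1
      have hRD : R \ D = R := sdiff_eq_self_of_disjoint
        (disjoint_left.2 fun x hx hxD => h12 x (hR hx) (hD0 x hxD))
      rw [hRD] at ha'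
      refine ⟨(e'', T' ∪ D, insert v R), ⟨ha', insert_subset hvL.1 hR,
        hTT'.trans subset_union_left, fun x hx hxT => ?_, ?_, fun j => ?_⟩, card_lt_card ?_⟩
      · rcases mem_union.1 hxT with hxT | hxD
        exacts [hT' x hx hxT, absurd (hD0 x hxD) (h12 x hx)]
      · have h1 := card_union_le T' D
        dsimp only
        rw [card_insert_of_notMem hvL.2.2]
        nlinarith
      · refine (hTyp _ (mem_image_of_mem _ (mem_univ j))).mono_right fun x hx => ?_
        simp only [mem_sdiff, mem_insert, mem_union, not_or] at hx ⊢
        tauto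
      · refine ⟨fun x hx => ?_, fun hsub => ?_⟩
        · simp only [mem_sdiff, mem_insert, mem_union, not_or] at hx ⊢
          tauto
        · have := hsub (mem_sdiff.2 ⟨hvL.1, by simpa using hvL.2⟩)
          simp at this)
    (s := (e, T, ∅)) ⟨ha, by simp, subset_rfl, fun x _ h => h, by simp, he⟩
  exact ⟨e', T', R', h1, h2, h3, h4, h6, h5⟩

/-- Most vertices of the large part can be covered. -/
theorem Setting.cover_large (h : Setting G k p ε β α γ c cv K) (hA : Parts α A) {e : List V}
    {T R : Finset V} (ha : Absorbing G k f e T R) (hR : R ⊆ A 1 ∪ A 2)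
    (hsz : ∀ i, i ≠ 0 → 2 * γ * 𝐧 ≤ #(A i \ T)) (he : ∀ i, Typ G p k (c / 2) e (A i \ T)) :
    ∃ (e' : List V) (T' : Finset V), Absorbing G k f e' T' R ∧ T ⊆ T' ∧
      (∀ x ∈ A 1 ∪ A 2, x ∈ T' → x ∈ T) ∧ (#(A 0 \ T') : ℝ) ≤ 2 * γ * 𝐧 ∧
      ∀ i, Typ G p k (c / 2) e' (A i \ T') := by
  have h12 : ∀ x ∈ A 1 ∪ A 2, x ∉ A 0 := fun x hx hx0 => by
    rcases mem_union.1 hx with hx | hx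
    exacts [disjoint_left.1 (hA.disj 0 1 (by decide)) hx0 hx,
      disjoint_left.1 (hA.disj 0 2 (by decide)) hx0 hx]
  obtain ⟨⟨e', T'⟩, ⟨h1, h2, h3, h4⟩, h5⟩ := exists_of_decreasing (σ := List V × Finset V)
    (fun s => Absorbing G k f s.1 s.2 R ∧ T ⊆ s.2 ∧ (∀ x ∈ A 1 ∪ A 2, x ∈ s.2 → x ∈ T) ∧
      ∀ i, Typ G p k (c / 2) s.1 (A i \ s.2))
    (fun s => (#(A 0 \ s.2) : ℝ) ≤ 2 * γ * 𝐧) (fun s => #(A 0 \ s.2))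
    (by
      rintro ⟨e', T'⟩ ⟨ha, hTT', hT', he⟩ hhalt
      dsimp only at ha hTT' hT' he hhalt ⊢
      rw [not_le] at hhalt
      have hsz : ∀ i, 2 * γ * 𝐧 ≤ #(A i \ T') := fun i => by
        by_cases hi : i = 0
        · subst hi; exact hhalt.le
        · refine (hsz i hi).trans ?_
          exact_mod_cast card_le_card fun x hx => by
            rw [mem_sdiff] at hx ⊢
            refine ⟨hx.1, fun hxT => hx.2 (hT' x ?_ hxT)⟩
            rw [mem_union]
            fin_cases i
            exacts [absurd rfl hi, Or.inl hx.1, Or.inr hx.1]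
      obtain ⟨v, hvL, hv⟩ := h.exists_good (hsz 0) (L := A 0 \ T')
        (lt_of_le_of_lt (by
          linarith [h.mul_p_le h.hγ0.le, h.c_le, h.le_c, h.small_le, h.hN]) hhalt)
      rw [mem_sdiff] at hvL
      obtain ⟨e'', D, hD, hvD, hDK, hTyp, ha', -⟩ := h.extend ha (U := A 0 \ T') (v := v)
        (𝒯 := univ.image fun j => A j \ T') disjoint_sdiff hvL.2 (hsz 0) hv
        (card_image_le.trans (by simp)) (by simpa using hsz)
        ((he 0).mono_left h.hp.le (by linarith [h.hc]))
      have hD0 : ∀ x ∈ insert v D, x ∈ A 0 := fun x hx => by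
        rcases mem_insert.1 hx with rfl | hx
        exacts [hvL.1, (mem_sdiff.1 (hD hx)).1]
      -- Both the covered vertex and the building material lie in `A 0`, so the reservoir stays
      -- intact.
      have hRD : R \ insert v D = R := sdiff_eq_self_of_disjoint
        (disjoint_left.2 fun x hx hxD => h12 x (hR hx) (hD0 x hxD))
      rw [hRD, ← union_insert] at ha'
      refine ⟨(e'', T' ∪ insert v D), ⟨ha', hTT'.trans subset_union_left,
        fun x hx hxT => ?_, fun j => ?_⟩, card_lt_card ?_⟩
      · rcases mem_union.1 hxT with hxT | hxD
        exacts [hT' x hx hxT, absurd (hD0 x hxD) (h12 x hx)]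
      · have := hTyp _ (mem_image_of_mem _ (mem_univ j))
        rwa [show (A j \ T') \ insert v D = A j \ (T' ∪ insert v D) by ext; simp; tauto] at this
      · refine ⟨fun x hx => ?_, fun hsub => ?_⟩
        · simp only [mem_sdiff, mem_union, not_or] at hx ⊢
          tauto
        · have := hsub (mem_sdiff.2 hvL)
          simp at this)
    (s := (e, T)) ⟨ha, subset_rfl, fun x _ h => h, he⟩
  exact ⟨e', T', h1, h2, h3, h5, h4⟩

/-- Remaining vertices are covered using absorbable vertices from the set `B`. -/
theorem Setting.consume (h : Setting G k p ε β α γ c cv K) {e : List V} {T R B : Finset V}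
    (ha : Absorbing G k f e T R) {𝒲 : Finset (Finset V)} (h𝒲 : #𝒲 ≤ 3) (hB : B ∈ 𝒲)
    (hd : ∀ W ∈ 𝒲, W = B ∨ Disjoint B W)
    (hsz : ∀ W ∈ 𝒲, 2 * γ * 𝐧 + 2 * K * (#(T ∪ R)ᶜ : ℝ) ≤ #(R ∩ W))
    (he : ∀ W ∈ 𝒲, Typ G p k (c / 4) e (R ∩ W)) {s : ℝ}
    (hv : ∀ L ⊆ (T ∪ R)ᶜ, s < #L → ∀ R' ⊆ R, #((R ∩ B) \ R') ≤ 2 * K * #(T ∪ R)ᶜ →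
      2 * γ * 𝐧 ≤ #(R' ∩ B) → ∃ v ∈ L, cv * p * 𝐧 ≤ #(nb G [v] (R' ∩ B))) :
    ∃ (e' : List V) (T' R' : Finset V), Absorbing G k f e' T' R' ∧ R' ⊆ R ∧ R \ R' ⊆ B ∧
      (T' ∪ R')ᶜ ⊆ (T ∪ R)ᶜ ∧ (#(T' ∪ R')ᶜ : ℝ) ≤ s ∧
      #((R ∩ B) \ R') ≤ 2 * K * #(T ∪ R)ᶜ ∧ ∀ W ∈ 𝒲, Typ G p k (c / 4) e' (R' ∩ W) := by
  -- The invariant sums the reservoir vertices lost and 2K times the number of uncovered vertices: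
  -- each round covers one vertex and spends at most 2K vertices of `R ∩ B`.
  obtain ⟨⟨e', T', R'⟩, ⟨h1, h2, h3, h4, h5, h6⟩, h7⟩ := exists_of_decreasing
    (σ := List V × Finset V × Finset V)
    (fun s => Absorbing G k f s.1 s.2.1 s.2.2 ∧ s.2.2 ⊆ R ∧ R \ s.2.2 ⊆ B ∧
      (s.2.1 ∪ s.2.2)ᶜ ⊆ (T ∪ R)ᶜ ∧
      #((R ∩ B) \ s.2.2) + 2 * K * #(s.2.1 ∪ s.2.2)ᶜ ≤ 2 * K * #(T ∪ R)ᶜ ∧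
      ∀ W ∈ 𝒲, Typ G p k (c / 4) s.1 (s.2.2 ∩ W))
    (fun x => (#(x.2.1 ∪ x.2.2)ᶜ : ℝ) ≤ s) (fun x => #(x.2.1 ∪ x.2.2)ᶜ)
    (by
      rintro ⟨e', T', R'⟩ ⟨ha, hR, hRB, hL, hcard, he⟩ hhalt
      dsimp only at ha hR hRB hL hcard he hhalt ⊢
      rw [not_le] at hhalt
      have hcard' : #((R ∩ B) \ R') ≤ 2 * K * #(T ∪ R)ᶜ := by omega
      have hγ := h.hγ0
      have hn := h.card_pos
      have hsz' : ∀ W ∈ 𝒲, 2 * γ * 𝐧 ≤ #(R' ∩ W) := fun W hW => by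
        rcases hd W hW with rfl | hdW
        · have h1 := card_sdiff_real (R ∩ W) ((R ∩ W) \ R')
          have h2 : (R ∩ W) \ ((R ∩ W) \ R') ⊆ R' ∩ W := fun x hx => by
            simp only [mem_sdiff, mem_inter] at hx ⊢; tauto
          have h3 : (#((R ∩ W) \ ((R ∩ W) \ R')) : ℝ) ≤ #(R' ∩ W) := by
            exact_mod_cast card_le_card h2
          have h4 : (#((R ∩ W) \ R') : ℝ) ≤ 2 * K * #(T ∪ R)ᶜ := by exact_mod_cast hcard'
          linarith [hsz W hW]
        · have h2 : R ∩ W ⊆ R' ∩ W := fun x hx => by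
            rw [mem_inter] at hx ⊢
            refine ⟨?_, hx.2⟩
            by_contra hxR
            exact disjoint_left.1 hdW (hRB (mem_sdiff.2 ⟨hx.1, hxR⟩)) hx.2
          have h3 : (#(R ∩ W) : ℝ) ≤ #(R' ∩ W) := by exact_mod_cast card_le_card h2
          have h4 : (0 : ℝ) ≤ 2 * K * (#(T ∪ R)ᶜ : ℝ) := by positivity
          linarith [hsz W hW]
      obtain ⟨v, hvL, hv⟩ := hv _ hL hhalt R' hR hcard' (hsz' B hB)
      have hvL' := hvL
      rw [mem_compl, mem_union, not_or] at hvL'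
      have hTR : Disjoint T' (R' ∩ B) := disjoint_of_subset_right inter_subset_left ha.1
      obtain ⟨e'', D, hD, hvD, hDK, hTyp, ha', -⟩ := h.extend ha (U := R' ∩ B) (v := v)
        (𝒯 := 𝒲.image fun W => R' ∩ W) hTR hvL'.1 (hsz' B hB) hv
        (card_image_le.trans h𝒲) (by
          intro W hW
          obtain ⟨W', hW', rfl⟩ := mem_image.1 hW
          exact hsz' W' hW') (he B hB)
      have hDm : ∀ x ∈ D, x ∈ R' ∧ x ∈ B := fun x hx => mem_inter.1 (hD hx)
      have hLe : (insert v (T' ∪ D) ∪ R' \ insert v D)ᶜ = (T' ∪ R')ᶜ.erase v := by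
        ext x
        have := hDm x
        simp only [mem_compl, mem_union, mem_insert, mem_sdiff, mem_erase]
        tauto
      refine ⟨(e'', insert v (T' ∪ D), R' \ insert v D), ⟨ha', sdiff_subset.trans hR,
        fun x hx => ?_, ?_, ?_, fun W hW => ?_⟩, ?_⟩
      · simp only [mem_sdiff, mem_insert, not_and, not_not] at hx
        by_cases hxR : x ∈ R'
        · rcases hx.2 hxR with rfl | hxD
          exacts [absurd hxR hvL'.2, (hDm x hxD).2]
        · exact hRB (mem_sdiff.2 ⟨hx.1, hxR⟩)
      · dsimp only
        rw [hLe]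
        exact (erase_subset _ _).trans hL
      · dsimp only
        rw [hLe]
        have h1 := card_erase_add_one hvL
        have h2 : #((R ∩ B) \ (R' \ insert v D)) ≤ #((R ∩ B) \ R') + #D := by
          refine (card_le_card fun x hx => ?_).trans (card_union_le _ _)
          simp only [mem_sdiff, mem_insert, not_and, not_not, mem_inter, mem_union] at hx ⊢
          by_cases hxR : x ∈ R'
          · rcases hx.2 hxR with rfl | hxD
            exacts [absurd hxR hvL'.2, Or.inr hxD]
          · exact Or.inl ⟨hx.1, hxR⟩
        nlinarith
      · have := hTyp _ (mem_image_of_mem _ hW)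
        refine (this.mono_left h.hp.le (c' := c / 4) (by linarith [h.hc])).mono_right
          fun x hx => ?_
        simp only [mem_sdiff, mem_inter] at hx ⊢
        tauto
      · dsimp only
        rw [hLe]
        exact card_erase_lt_of_mem hvL)
    (s := (e, T, R)) ⟨ha, subset_rfl, by simp, subset_rfl, by simp, he⟩
  exact ⟨e', T', R', h1, h2, h3, h4, h7, by dsimp only at h5; omega, h6⟩

/-- The path closes to a cycle through absorbable vertices. -/
theorem Setting.close (h : Setting G k p ε β α γ c cv K) (h3 : 3 ≤ Fintype.card V) {e : List V}
    {T R B : Finset V} (ha : Absorbing G k f e T R) (hTR : (T ∪ R)ᶜ = ∅)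
    (hB : γ * 𝐧 ≤ #(R ∩ B)) (he : Typ G p k (c / 8) e (R ∩ B)) (hf : Typ G p k (c / 8) f (R ∩ B)) :
    ContainsHamiltonCyclePower G k := by
  have hP := ha.2 ∅ (empty_subset R)
  obtain ⟨m, hmU, hmn, -, hm⟩ := h.conn (R ∩ B) e f hB hP.length_right hP.length_left
    hP.kadj_right hP.kadj_left he hf
  -- The reservoir vertices used in `m` are left out of the path, which absorbs all the others.
  refine PathOn.close h3 (ha.2 (R \ m.toFinset) sdiff_subset) hm hmn (fun x hx hxS => ?_)
    fun x => ?_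
  · have hxR := (mem_inter.1 (hmU x hx)).1
    rcases mem_union.1 hxS with hxT | hxS
    · exact disjoint_left.1 ha.1 hxT hxR
    · exact (mem_sdiff.1 hxS).2 (List.mem_toFinset.2 hx)
  · have : x ∈ T ∪ R := by
      by_contra hx
      have := mem_compl.2 hx
      rw [hTR] at this
      simp at this
    simp only [mem_union, mem_sdiff, List.mem_toFinset] at this ⊢
    tauto

/-- Two reservoirs are needed. Covering a leftover of order γn may spend order Kγn reservoir
vertices, possibly all neighbours of some vertex, so only the guarantee that most vertices are good
is available, and it stops at ε p^k n leftover vertices. Covering these spends only order K ε p^k n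
vertices of the second reservoir, far fewer than the order pn neighbours each of them has in `A 2`.
-/
theorem Setting.containsHamiltonCyclePower (h : Setting G k p ε β α γ c cv K)
    (h3 : 3 ≤ Fintype.card V) : ContainsHamiltonCyclePower G k := by
  obtain ⟨A, hA⟩ := h.exists_parts
  obtain ⟨f, e₀, T₀, ha₀, hT₀, hf, he₀⟩ := h.start hA
  obtain ⟨e₁, T₁, ha₁, hT₁, hpoor, he₁⟩ := h.cover_poor hA ha₀ hT₀ he₀
  obtain ⟨e₂, T₂, R, ha₂, hR, hT₁₂, hT₂, hZ₂, he₂⟩ := h.absorb hA ha₁ hT₁ he₁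
  have hin : ∀ i : Fin 3, i ≠ 0 → A i ⊆ A 1 ∪ A 2 := fun i hi => by
    fin_cases i
    exacts [absurd rfl hi, subset_union_left, subset_union_right]
  obtain ⟨e, T, ha, hT₂', hT, hU, he⟩ := h.cover_large hA ha₂ hR (fun i hi =>
    (h.card_sdiff_le hA hT₁ i).trans (by
      exact_mod_cast card_le_card fun x hx => by
        rw [mem_sdiff] at hx ⊢
        exact ⟨hx.1, fun hxT => hx.2 (hT₂ x (hin i hi hx.1) hxT)⟩)) he₂
  have hTT₁ : ∀ x ∈ A 1 ∪ A 2, x ∈ T → x ∈ T₁ := fun x hx hxT => hT₂ x hx (hT x hx hxT)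
  set x := ε * p ^ k * 𝐧 with hx
  set Z := (A 1 ∪ A 2) \ (T ∪ R)
  have hZ : (#Z : ℝ) ≤ x := le_trans (by
    exact_mod_cast card_le_card (sdiff_subset_sdiff subset_rfl
      (union_subset_union_left hT₂'))) hZ₂
  have hx1 : 1 ≤ x := h.hN
  have hxK := h.small_le
  have hxc := h.le_c
  have hcγ := h.c_le
  have hpγ := h.mul_p_le h.hγ0.le
  have hγK := h.γ_le
  have hαγ := h.αγ
  have hLc : (#(T ∪ R)ᶜ : ℝ) ≤ 2 * γ * 𝐧 + x := by
    have h1 : #(T ∪ R)ᶜ ≤ #(A 0 \ T) + #Z := by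
      refine (card_le_card fun y hy => ?_).trans (card_union_le _ _)
      obtain ⟨i, hi⟩ := hA.cover y
      simp only [mem_compl, mem_union, mem_sdiff, Z] at hy ⊢
      fin_cases i <;> simp_all
    have h2 : (#(T ∪ R)ᶜ : ℝ) ≤ #(A 0 \ T) + #Z := by exact_mod_cast h1
    linarith
  have hAR : ∀ i : Fin 3, i ≠ 0 → (#(A i \ R) : ℝ) ≤ 4 * (K * x) + x := fun i hi => by
    have h1 : #(A i \ R) ≤ #T₁ + #Z := by
      refine (card_le_card fun y hy => ?_).trans (card_union_le _ _)
      have h1 := hin i hi (mem_sdiff.1 hy).1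
      have h2 := hTT₁ y h1
      simp only [mem_sdiff, mem_union, Z] at hy h1 ⊢
      tauto
    have h2 : (#(A i \ R) : ℝ) ≤ #T₁ + #Z := by exact_mod_cast h1
    linarith
  have hRA : ∀ i : Fin 3, i ≠ 0 → α * 𝐧 - (4 * (K * x) + x) ≤ #(R ∩ A i) := fun i hi => by
    have h1 := hAR i hi
    have h2 : (#(A i) : ℝ) = #(R ∩ A i) + #(A i \ R) := by
      rw [inter_comm]; exact_mod_cast (card_inter_add_card_sdiff (A i) R).symm
    have h4 : α * 𝐧 ≤ #(A i) := by
      fin_cases i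
      exacts [absurd rfl hi, hA.lower1, hA.lower2]
    linarith
  have hTyp : ∀ i : Fin 3, i ≠ 0 → Typ G p k (c / 4) e (R ∩ A i) := fun i hi => by
    refine ((he i).sdiff (c' := c / 4) (D := Z) h.hp.le h.hp1 (by linarith [h.hc]) ?_).mono_right
      fun y hy => ?_
    · have : (c / 2 - c / 4) * p ^ k * 𝐧 = c * p ^ k * 𝐧 / 4 := by ring
      linarith
    · have h1 : y ∈ A i → y ∈ A 1 ∪ A 2 := fun h => hin i hi h
      simp only [mem_sdiff, mem_inter, Z, mem_union] at hy h1 ⊢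
      tauto
  have hK : (0 : ℝ) ≤ K := Nat.cast_nonneg K
  -- The choice αn = 16Kγn leaves room for the 2K(2γn + x) vertices of `A 1` that may be spent here.
  -- `A 2` is listed only to keep the end typical for it.
  obtain ⟨e', T', R', ha', hR', hRB', hL', hL'x, -, he'⟩ := h.consume ha (B := A 1)
    (𝒲 := {A 1, A 2}) (card_le_two.trans (by norm_num)) (by simp)
    (by
      simp only [mem_insert, mem_singleton, forall_eq_or_imp, true_or, forall_eq, true_and]
      exact Or.inr (hA.disj 1 2 (by decide)))
    (by
      have h1 : 2 * K * (#(T ∪ R)ᶜ : ℝ) ≤ 2 * K * (2 * γ * 𝐧 + x) := by gcongr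
      simp only [mem_insert, mem_singleton, forall_eq_or_imp, forall_eq]
      constructor
      · linarith [hRA 1 (by decide)]
      · linarith [hRA 2 (by decide)])
    (by simpa using ⟨hTyp 1 (by decide), hTyp 2 (by decide)⟩) (s := x)
    fun L _ hL R' _ _ hR' => h.exists_good hR' hL
  have hRA2 : R' ∩ A 2 = R ∩ A 2 := by
    refine (inter_subset_inter_right hR').antisymm fun y hy => ?_
    rw [mem_inter] at hy ⊢
    refine ⟨?_, hy.2⟩
    by_contra hyR
    exact disjoint_left.1 (hA.disj 1 2 (by decide)) (hRB' (mem_sdiff.2 ⟨hy.1, hyR⟩)) hy.2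
  have hL'K : 2 * K * (#(T' ∪ R')ᶜ : ℝ) ≤ 2 * K * x := by gcongr
  have hbad : ∀ R'' : Finset V, #((R' ∩ A 2) \ R'') ≤ 2 * K * #(T' ∪ R')ᶜ →
      (#(A 2 \ R'') : ℝ) ≤ 7 * (K * x) := fun R'' h1 => by
    have h1 : (#((R' ∩ A 2) \ R'') : ℝ) ≤ 2 * K * (#(T' ∪ R')ᶜ : ℝ) := by exact_mod_cast h1
    have h2 : #(A 2 \ R'') ≤ #(A 2 \ R) + #((R' ∩ A 2) \ R'') := by
      rw [hRA2]
      refine (card_le_card fun y hy => ?_).trans (card_union_le _ _)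
      simp only [mem_sdiff, mem_inter, mem_union] at hy ⊢
      tauto
    have h3 : (#(A 2 \ R'') : ℝ) ≤ #(A 2 \ R) + #((R' ∩ A 2) \ R'') := by exact_mod_cast h2
    linarith [hAR 2 (by decide)]
  -- With threshold 0, every remaining vertex must be usable. It is: poor vertices were covered at
  -- the beginning, and at most 7Kx vertices of `A 2` are missing from the reservoir.
  obtain ⟨e'', T'', R'', ha'', -, -, -, hL'', hcard'', he''⟩ := h.consume ha' (B := A 2)
    (𝒲 := {A 2}) (by simp) (by simp) (by simp)
    (by
      simp only [mem_singleton, forall_eq]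
      rw [hRA2]
      linarith [hRA 2 (by decide)])
    (by simpa using he' (A 2) (by simp)) (s := 0)
    (by
      intro L hL hL0 R'' _ hcard _
      obtain ⟨v, hv⟩ := Finset.card_pos.1 (show 0 < #L by exact_mod_cast hL0)
      refine ⟨v, hv, ?_⟩
      have hvT : v ∉ T := fun hvT => mem_compl.1 (hL' (hL hv)) (mem_union_left _ hvT)
      have hvp : v ∉ poor G p (A 2) := fun hvp => hvT (hT₂' (hT₁₂ (hpoor hvp)))
      have h1 := notMem_poor.1 hvp
      have h2 : #(nb G [v] (A 2)) ≤ #(nb G [v] (R'' ∩ A 2)) + #(A 2 \ R'') := by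
        refine (card_le_card fun y hy => ?_).trans (card_union_le _ _)
        simp only [mem_nb_singleton, mem_inter, mem_union, mem_sdiff] at hy ⊢
        tauto
      have h3 : (#(nb G [v] (A 2)) : ℝ) ≤ #(nb G [v] (R'' ∩ A 2)) + #(A 2 \ R'') := by
        exact_mod_cast h2
      have h4 := hbad R'' hcard
      have hp := h.hp
      have hn := h.card_pos
      have hγ0 := h.hγ0
      have h5 : p / 8 * (α * 𝐧) ≤ p / 8 * #(A 2) := by gcongr; exact hA.lower2
      have h6 : cv * p * 𝐧 ≤ γ / 4 * p * 𝐧 := by gcongr; exact h.hcvγ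
      have h7 : p * (γ * 𝐧) ≤ p * (K * (γ * 𝐧)) := by gcongr
      rw [hαγ] at h5
      have h8 : 0 < p * (γ * 𝐧) := by positivity
      linarith)
  have hbad'' := hbad R'' hcard''
  refine h.close h3 ha'' (card_eq_zero.1 (by exact_mod_cast hL''.antisymm (by positivity)))
    (B := A 2) ?_ ((he'' (A 2) (by simp)).mono_left h.hp.le (by linarith [h.hc])) ?_
  · have h2 : (#(A 2) : ℝ) = #(R'' ∩ A 2) + #(A 2 \ R'') := by
      rw [inter_comm]; exact_mod_cast (card_inter_add_card_sdiff (A 2) R'').symm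
    linarith [hA.lower2]
  · refine (hf.sdiff (c' := c / 8) (D := A 2 \ R'') h.hp.le h.hp1 (by linarith [h.hc])
      ?_).mono_right fun y hy => ?_
    · have : (c - c / 8) * p ^ k * 𝐧 = 7 / 8 * (c * p ^ k * 𝐧) := by ring
      linarith
    · simp only [mem_sdiff, mem_inter] at hy ⊢
      tauto

end

end HamPow

/-! ### Choice of constants and derivation of regularity. -/

namespace HamPow
open scoped Classical
open Finset Filter Topology

theorem Conn.mono {V : Type*} [Fintype V] {G : SimpleGraph V} {k : ℕ} {p c γ : ℝ} {K K' : ℕ}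
    (h : Conn G k p c γ K) (hK : K ≤ K') : Conn G k p c γ K' :=
  fun U e f hU he hf hke hkf hte htf =>
    (h U e f hU he hf hke hkf hte htf).imp fun _ hm => ⟨hm.1, hm.2.1, hm.2.2.1.trans hK, hm.2.2.2⟩

theorem Gad.mono {V : Type*} [Fintype V] {G : SimpleGraph V} {k : ℕ} {p cv γ c : ℝ} {K K' : ℕ}
    (h : Gad G k p cv γ c K) (hK : K ≤ K') : Gad G k p cv γ c K' := by
  intro U v 𝒯 h1 h2 h3 h4 h5
  obtain ⟨l, l', a1, a2, a3, a4, a5, a6, a7, a8, a9⟩ := h U v 𝒯 h1 h2 h3 h4 h5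
  exact ⟨l, l', a1, a2, a3, a4, a5, a6, a7, a8.trans hK, a9⟩

theorem eventually_mul_lt (M : ℝ) {b : ℝ} (hb : 0 < b) : ∀ᶠ ε in 𝓝[>] (0 : ℝ), M * ε < b := by
  have : Tendsto (fun ε : ℝ => M * ε) (𝓝[>] 0) (𝓝 (M * 0)) :=
    (tendsto_id.mono_left nhdsWithin_le_nhds).const_mul M
  rw [mul_zero] at this
  exact this.eventually_lt_const hb

/-- Stated for all small ε, so that finitely many smallness conditions can be intersected. The value
p = 1 is allowed because the nearly complete case is reduced to it. -/
theorem eventually_square {β : ℝ} (hβ : 0 < β) : ∀ᶠ ε in 𝓝[>] (0 : ℝ),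
    ∀ (V : Type*) [Fintype V] (G : SimpleGraph V) (p : ℝ), 3 ≤ Fintype.card V → 0 < p → p ≤ 1 →
      (∀ v, β * p * (Fintype.card V : ℝ) ≤ #(nb G [v] univ)) →
      1 ≤ ε * p ^ 2 * (Fintype.card V : ℝ) → LowerReg G ε p 1 2 → LowerReg G ε p 2 1 →
      UpperReg G ε p 1 2 → ContainsHamiltonCyclePower G 2 := by
  set α : ℝ := min β (1 / (48 * 34))
  have hα : 0 < α := lt_min hβ (by norm_num)
  have hα1 : α ≤ 1 / (48 * 34) := min_le_right _ _
  have hαβ : α ≤ β := min_le_left _ _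
  set γ : ℝ := α / (16 * 34) with hγ
  have hγ0 : 0 < γ := by positivity
  have hγα : γ ≤ α := div_le_self hα.le (by norm_num)
  have hγβ : γ / 4 ≤ β / 8 := by rw [hγ]; linarith
  filter_upwards [eventually_mul_lt 1 (show 0 < γ / 64 / 8 / 110000 by positivity),
    eventually_mul_lt 1 (show 0 < γ / 4 / 20000000 by positivity),
    eventually_mul_lt (100 * 34) (show 0 < γ / 64 by positivity),
    eventually_mem_nhdsWithin] with ε h1 h2 h3 hε V _ G p hn hp hp1 hdeg hN h12 h21 hu
  have hε : 0 < ε := hε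
  rw [one_mul] at h1 h2
  have S : Setting G 2 p ε β α γ (γ / 64) (γ / 4) 34 :=
    { hp := hp
      hp1 := hp1
      hk := by norm_num
      hK := by norm_num
      hε := hε
      hN := hN
      lower := h21.mono hp.le hp1 hε.le le_rfl (by norm_num)
      conn := (conn_square hp hp1 hε h12 h21 hu hN (by linarith) (by linarith) h1.le).mono
        (by norm_num)
      gad := gad_square hp hp1 hε h12 h21 hu hN (by linarith) (by linarith) h2.le
      deg := hdeg
      hα := hα
      hαK := by push_cast; linarith
      hαβ := hαβ
      hγ := by rw [hγ]; push_cast; field_simp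
      hc := by positivity
      hcγ := by linarith
      hcvβ := hγβ
      hcvγ := le_rfl
      hεc := by push_cast; linarith }
  exact S.containsHamiltonCyclePower hn

theorem eventually_power {k : ℕ} (hk : 2 ≤ k) {β : ℝ} (hβ : 0 < β) : ∀ᶠ ε in 𝓝[>] (0 : ℝ),
    ∀ (V : Type*) [Fintype V] (G : SimpleGraph V) (p : ℝ), 3 ≤ Fintype.card V → 0 < p → p ≤ 1 →
      (∀ v, β * p * (Fintype.card V : ℝ) ≤ #(nb G [v] univ)) →
      1 ≤ ε * p ^ (2 * k - 1) * (Fintype.card V : ℝ) → LowerReg G ε p (k + 1) k →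
      LowerReg G ε p (k - 1) (2 * k - 1) → UpperReg G ε p (k - 1) (2 * k - 1) →
      ContainsHamiltonCyclePower G k := by
  have hk' : (2 : ℝ) ≤ k := by exact_mod_cast hk
  have hk0 : (0 : ℝ) < k := by linarith
  set α : ℝ := min β (1 / (48 * (3 * k)))
  have hα : 0 < α := lt_min hβ (by positivity)
  have hα1 : α ≤ 1 / (48 * (3 * k)) := min_le_right _ _
  have hαβ : α ≤ β := min_le_left _ _
  set γ : ℝ := α / (16 * (3 * k)) with hγ
  have hγ0 : 0 < γ := by positivity
  have hγα : γ ≤ α / 16 := by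
    rw [hγ]; gcongr; linarith
  have h8 : (1 : ℝ) ≤ 8 ^ k := one_le_pow₀ (by norm_num)
  set c : ℝ := γ / 8 ^ k with hc
  have hc0 : 0 < c := by positivity
  have hcγ : c ≤ γ := div_le_self hγ0.le h8
  set a : ℝ := c / 8 / (6 * k) with ha
  have ha0 : 0 < a := by positivity
  filter_upwards [eventually_mul_lt 1 one_pos,
    eventually_mul_lt 1 (show 0 < a / (2 * 8 ^ k * 16 ^ k) by positivity),
    eventually_mul_lt (k * k + k) (show 0 < a / (2 * 8 ^ k) by positivity),
    eventually_mul_lt (2 * k * 17 ^ k) (show 0 < (a / (2 * 32 ^ k)) ^ k by positivity),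
    eventually_mul_lt (7 * k + 1) (show 0 < γ / 4 / 8 ^ k by positivity),
    eventually_mul_lt (100 * (3 * k)) hc0,
    eventually_mem_nhdsWithin] with ε h1 h2 h3 h4 h5 h6 hε V _ G p hn hp hp1 hdeg hN hl hl' hu
  have hε : 0 < ε := hε
  rw [one_mul] at h1 h2
  rw [mul_assoc] at h4
  have hN' : ∀ i ≤ 2 * k - 1, 1 ≤ ε * p ^ i * (Fintype.card V : ℝ) := fun i hi =>
    hN.trans (scale_le hp.le hp1 hε.le hi)
  have S : Setting G k p ε β α γ c (γ / 4) (3 * k) :=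
    { hp := hp
      hp1 := hp1
      hk := by omega
      hK := by omega
      hε := hε
      hN := hN' k (by omega)
      lower := hl.mono hp.le hp1 hε.le (by omega) (by omega)
      conn := conn_power (by omega) hp hp1 hε h1.le
        (hl.mono hp.le hp1 hε.le (by omega) (by omega)) hl' hu hN (by positivity)
        (by linarith) ha h2.le h3.le h4
      gad := (gad_power hp hp1 hε hl (hN' (k + 1) (by omega)) (by linarith) h5).mono (by omega)
      deg := hdeg
      hα := hα
      hαK := by
        push_cast
        calc 48 * (3 * k) * α ≤ 48 * (3 * k) * (1 / (48 * (3 * k))) := by gcongr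
          _ = 1 := by field_simp
      hαβ := hαβ
      hγ := by rw [hγ]; push_cast; field_simp
      hc := hc0
      hcγ := hcγ
      hcvβ := by linarith
      hcvγ := le_rfl
      hεc := by push_cast; exact h6.le }
  exact S.containsHamiltonCyclePower hn

/-- The edge density between large disjoint sets is close to `p`. -/
def Dense {V : Type*} [Fintype V] (G : SimpleGraph V) (ε p : ℝ) (i j : ℕ) : Prop :=
  ∀ X Y : Finset V, Disjoint X Y → ε * p ^ i * (Fintype.card V : ℝ) ≤ #X →
    ε * p ^ j * (Fintype.card V : ℝ) ≤ #Y →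
    (1 - ε) * p * #X * #Y < ∑ x ∈ X, (#(nb G [x] Y) : ℝ) ∧
      ∑ x ∈ X, (#(nb G [x] Y) : ℝ) < (1 + ε) * p * #X * #Y

section

variable {V : Type*} [Fintype V] {G : SimpleGraph V} {ε p : ℝ} {i j : ℕ}

local notation "𝐧" => (Fintype.card V : ℝ)

theorem card_interedges_eq [DecidableRel G.Adj] (X Y : Finset V) :
    (#(G.interedges X Y) : ℝ) = ∑ x ∈ X, (#(nb G [x] Y) : ℝ) := by
  rw [SimpleGraph.interedges_def, card_filter, sum_product]
  push_cast
  refine sum_congr rfl fun x _ => ?_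
  rw [nb, card_filter]
  push_cast
  refine sum_congr rfl fun y _ => ?_
  by_cases h : G.Adj x y <;> simp [h]

theorem dense_of_isPseudorandom [DecidableRel G.Adj] (h : IsPseudorandom G ε p i j) :
    Dense G ε p i j := fun X Y hXY hX hY => by
  have := h X Y hXY hX hY
  rw [card_interedges_eq, abs_lt] at this
  constructor <;> linarith [this.1, this.2]

theorem Dense.symm (h : Dense G ε p i j) : Dense G ε p j i := fun X Y hXY hX hY => by
  have hsum : ∑ x ∈ X, (#(nb G [x] Y) : ℝ) = ∑ y ∈ Y, (#(nb G [y] X) : ℝ) := by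
    have := sum_card_bipartiteAbove_eq_sum_card_bipartiteBelow (s := X) (t := Y) G.Adj
    have e1 : ∀ x, nb G [x] Y = bipartiteAbove G.Adj Y x := fun x => by
      ext; simp [bipartiteAbove]
    have e2 : ∀ y, nb G [y] X = bipartiteBelow G.Adj X y := fun y => by
      ext; simp [bipartiteBelow, G.adj_comm]
    simp_rw [e1, e2]
    exact_mod_cast this
  have := h Y X hXY.symm hY hX
  rw [hsum]
  constructor <;> linarith [this.1, this.2]

theorem Dense.upperReg (h : Dense G ε p i j) (hp : 0 ≤ p) (hε : 0 ≤ ε) (hε1 : ε ≤ 1) :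
    UpperReg G (4 * ε) p i j := fun X Y hXY hX hY => by
  have h4 : ∀ i : ℕ, ε * p ^ i * 𝐧 ≤ 4 * ε * p ^ i * 𝐧 := fun i => by gcongr; linarith
  refine (h X Y hXY ((h4 i).trans hX) ((h4 j).trans hY)).2.le.trans ?_
  gcongr
  linarith

/-- The poor vertices may meet `Y`, while density is known for disjoint sets only. So `Y` is halved:
a large set of poor vertices outside one half would send too few edges to that half, since |Y| ≤
3|Y'| even after rounding and 3/8 < 7/8. The parts of the poor set outside the two halves cover it.
-/
theorem Dense.lowerReg (h : Dense G ε p i j) (hp : 0 < p) (hε : 0 ≤ ε) (hε1 : ε ≤ 1 / 8)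
    (hN : 1 ≤ ε * p ^ j * 𝐧) : LowerReg G (4 * ε) p i j := by
  intro Y hY
  by_contra! hP
  have hY4 : (4 : ℝ) ≤ #Y := by linarith
  have hY4' : 4 ≤ #Y := by exact_mod_cast hY4
  obtain ⟨Y₁, hY₁, hc₁⟩ := exists_subset_card_eq (Nat.div_le_self #Y 2)
  have key : ∀ Y' ⊆ Y, #Y / 2 ≤ #Y' → (#(poor G p Y \ Y') : ℝ) < 2 * ε * p ^ i * 𝐧 := by
    intro Y' hY' hc
    by_contra! hX
    have h1 : (#Y : ℝ) ≤ 3 * #Y' := by exact_mod_cast (by omega : #Y ≤ 3 * #Y')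
    have h0 : 0 ≤ ε * p ^ i * 𝐧 := by positivity
    have h2 := (h (poor G p Y \ Y') Y' sdiff_disjoint (by linarith) (by linarith)).1
    have h3 : ∑ x ∈ poor G p Y \ Y', (#(nb G [x] Y') : ℝ) ≤
        ∑ x ∈ poor G p Y \ Y', p / 8 * (#Y : ℝ) := by
      refine sum_le_sum fun x hx => le_trans ?_ (mem_poor.1 (Finset.mem_sdiff.1 hx).1).le
      exact_mod_cast card_le_card (nb_mono hY')
    rw [sum_const, nsmul_eq_mul] at h3
    set m : ℝ := (#(poor G p Y \ Y') : ℝ)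
    have hm : 0 ≤ m := Nat.cast_nonneg _
    have h5 : m * (p / 8 * (#Y : ℝ)) ≤ m * (p / 8 * (3 * #Y')) := by gcongr
    have h6 : (7 / 8) * p * m * #Y' ≤ (1 - ε) * p * m * #Y' := by gcongr; linarith
    have h7 : 0 ≤ p * m * #Y' := by positivity
    linarith
  have h1 := key Y₁ hY₁ hc₁.ge
  have h2 := key (Y \ Y₁) sdiff_subset (by rw [card_sdiff_of_subset hY₁]; omega)
  have h3 : #(poor G p Y) ≤ #(poor G p Y \ Y₁) + #(poor G p Y \ (Y \ Y₁)) := by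
    refine (card_le_card fun x hx => ?_).trans (card_union_le _ _)
    simp only [mem_union, Finset.mem_sdiff]
    tauto
  have h4 : (#(poor G p Y) : ℝ) ≤ #(poor G p Y \ Y₁) + #(poor G p Y \ (Y \ Y₁)) := by
    exact_mod_cast h3
  linarith

/-- If single vertices are large sets, then the graph is almost complete. -/
theorem Dense.almost_complete (h : Dense G ε p i j) (hp : 0 < p) (hp1 : p ≤ 1) (hε : 0 < ε)
    (hε1 : ε ≤ 1 / 8) (hN : ε * p ^ j * 𝐧 ≤ 1) (hn : 3 ≤ Fintype.card V) :
    (∀ u v, u ≠ v → G.Adj u v) ∨ (1 ≤ ε * 𝐧 ∧ (∀ v, 1 / 2 * 1 * 𝐧 ≤ #(nb G [v] univ)) ∧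
      (∀ a b, LowerReg G (4 * ε) 1 a b) ∧ ∀ a b, UpperReg G (4 * ε) 1 a b) := by
  have hn' : (3 : ℝ) ≤ 𝐧 := by exact_mod_cast hn
  -- Here `{v}` itself is a large set, and it has no edges to the non-neighbours of `v`; so these
  -- cannot form a large set.
  have hnon : ∀ v, (#{u | u ≠ v ∧ ¬ G.Adj u v} : ℝ) < ε * 𝐧 := by
    intro v
    by_contra! hc
    set X : Finset V := {u | u ≠ v ∧ ¬ G.Adj u v}
    have h1 := (h X {v} (by simp [X]) (by
      refine le_trans ?_ hc
      have := scale_le (V := V) hp.le hp1 hε.le (Nat.zero_le i)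
      rwa [pow_zero, mul_one] at this) (by simpa using hN)).1
    have h2 : ∑ x ∈ X, (#(nb G [x] {v}) : ℝ) = 0 := by
      refine sum_eq_zero fun x hx => ?_
      have hx : x ≠ v ∧ ¬ G.Adj x v := by simpa [X] using hx
      rw [Nat.cast_eq_zero, card_eq_zero, eq_empty_iff_forall_notMem]
      intro y hy
      obtain ⟨hy1, hy2⟩ := mem_nb_singleton.1 hy
      rw [mem_singleton.1 hy1] at hy2
      exact hx.2 hy2
    rw [h2] at h1
    have : 0 ≤ (1 - ε) * p * #X * #({v} : Finset V) := by
      have : 0 ≤ 1 - ε := by linarith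
      positivity
    linarith
  by_cases hεn : 1 ≤ ε * 𝐧
  · right
    have hdeg : ∀ (v : V) (Y : Finset V), (#Y : ℝ) - 2 * ε * 𝐧 ≤ #(nb G [v] Y) := by
      intro v Y
      have h1 : #Y ≤ #(nb G [v] Y) + (#{u | u ≠ v ∧ ¬ G.Adj u v} + #({v} : Finset V)) := by
        refine (card_le_card (t := nb G [v] Y ∪ (({u | u ≠ v ∧ ¬ G.Adj u v} : Finset V) ∪ {v}))
          fun x hx => ?_).trans ((card_union_le _ _).trans
            (Nat.add_le_add_left (card_union_le _ _) _))
        simp only [mem_union, mem_nb_singleton, mem_filter, mem_univ, true_and, mem_singleton,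
          G.adj_comm v]
        tauto
      have h2 : (#Y : ℝ) ≤ #(nb G [v] Y) + (#{u | u ≠ v ∧ ¬ G.Adj u v} + 1) := by
        rw [card_singleton] at h1
        exact_mod_cast h1
      linarith [hnon v]
    refine ⟨hεn, fun v => ?_, fun a b Y hY => ?_, fun a b X Y _ _ _ => ?_⟩
    · have h1 := hdeg v univ
      rw [card_univ] at h1
      have : ε * 𝐧 ≤ 1 / 8 * 𝐧 := by gcongr
      linarith
    · have : poor G 1 Y = ∅ := by
        refine eq_empty_iff_forall_notMem.2 fun v => notMem_poor.2 ?_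
        rw [one_pow, mul_one] at hY
        have := hdeg v Y
        have h0 : (0 : ℝ) ≤ #Y := Nat.cast_nonneg _
        linarith
      rw [this, card_empty, Nat.cast_zero]
      positivity
    · calc ∑ x ∈ X, (#(nb G [x] Y) : ℝ) ≤ ∑ x ∈ X, (#Y : ℝ) :=
            sum_le_sum fun x _ => by exact_mod_cast card_le_card nb_subset
        _ = #X * #Y := by simp
        _ ≤ 2 * 1 * #X * #Y := by
            have : (0 : ℝ) ≤ #X * #Y := by positivity
            linarith
  · left
    intro u v huv
    by_contra hadj
    have h1 : 0 < #{u | u ≠ v ∧ ¬ G.Adj u v} := Finset.card_pos.2 ⟨u, by simp [huv, hadj]⟩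
    have h2 : (1 : ℝ) ≤ #{u | u ≠ v ∧ ¬ G.Adj u v} := by exact_mod_cast h1
    linarith [hnon v]

end

end HamPow

/-! ### Conclusion. -/

namespace HamPow
open scoped Classical
open Filter Topology

theorem exists_hamiltonCyclePower (k : ℕ) (hk : 2 ≤ k) (β : ℝ) (hβ : 0 < β) :
    ∃ ε : ℝ, 0 < ε ∧
      ∀ (V : Type*) [Fintype V] (G : SimpleGraph V) [DecidableRel G.Adj] (p : ℝ),
        3 ≤ Fintype.card V → 0 < p → p < 1 →
        β * p * (Fintype.card V : ℝ) ≤ (G.minDegree : ℝ) →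
        (IsPseudorandom G ε p 1 2 → ContainsHamiltonCyclePower G 2) ∧
        (IsPseudorandom G ε p (k - 1) (2 * k - 1) → IsPseudorandom G ε p k (k + 1) →
          ContainsHamiltonCyclePower G k) := by
  -- The bound 1/2 is the relative minimum degree available in the nearly complete case, where p is
  -- replaced by 1.
  have hβ' : 0 < min β (1 / 2) := lt_min hβ (by norm_num)
  obtain ⟨ε', hsq, hpow, hε1, hε0⟩ := ((eventually_square hβ').and
    ((eventually_power hk hβ').and ((eventually_mul_lt 1 (show (0 : ℝ) < 1 / 2 by norm_num)).and
      eventually_mem_nhdsWithin))).exists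
  have hε0 : 0 < ε' := hε0
  -- Passing from density to one-sided regularity loses a factor 4 in ε.
  obtain ⟨ε, rfl⟩ : ∃ ε, ε' = 4 * ε := ⟨ε' / 4, by ring⟩
  have hε : 0 < ε := by linarith
  have hε8 : ε ≤ 1 / 8 := by linarith
  refine ⟨ε, hε, fun V _ G _ p hn hp hp1 hdeg => ?_⟩
  have hdeg' : ∀ v, min β (1 / 2) * p * (Fintype.card V : ℝ) ≤
      (nb G [v] Finset.univ).card := fun v => by
    have h1 : (G.minDegree : ℝ) ≤ (nb G [v] Finset.univ).card := by
      refine Nat.cast_le.2 ((G.minDegree_le_degree v).trans (Finset.card_le_card fun x hx => ?_))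
      rw [SimpleGraph.mem_neighborFinset] at hx
      exact mem_nb_singleton.2 ⟨Finset.mem_univ _, hx⟩
    refine le_trans ?_ (hdeg.trans h1)
    gcongr
    exact min_le_left _ _
  have hdense : ∀ v, 1 / 2 * 1 * (Fintype.card V : ℝ) ≤ (nb G [v] Finset.univ).card →
      min β (1 / 2) * 1 * (Fintype.card V : ℝ) ≤ (nb G [v] Finset.univ).card := fun v h => by
    refine le_trans ?_ h
    gcongr
    exact min_le_right _ _
  have hN4 : ∀ j : ℕ, 1 ≤ ε * p ^ j * (Fintype.card V : ℝ) →
      1 ≤ 4 * ε * p ^ j * (Fintype.card V : ℝ) := fun j h => by linarith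
  constructor
  · intro h
    have h := dense_of_isPseudorandom h
    rcases le_total 1 (ε * p ^ 2 * (Fintype.card V : ℝ)) with hN | hN
    · exact hsq V G p hn hp hp1.le hdeg' (hN4 2 hN) (h.lowerReg hp hε.le hε8 hN)
        (h.symm.lowerReg hp hε.le hε8 (hN.trans (scale_le hp.le hp1.le hε.le (by norm_num))))
        (h.upperReg hp.le hε.le (by linarith))
    · rcases h.almost_complete hp hp1.le hε hε8 hN hn with hc | ⟨h1, h2, h3, h4⟩
      · exact containsHamiltonCyclePower_of_complete hc
      · exact hsq V G 1 hn one_pos le_rfl (fun v => hdense v (h2 v))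
          (by rw [one_pow]; linarith) (h3 _ _) (h3 _ _) (h4 _ _)
  · intro h h'
    have h := dense_of_isPseudorandom h
    have h' := dense_of_isPseudorandom h'
    rcases le_total 1 (ε * p ^ (2 * k - 1) * (Fintype.card V : ℝ)) with hN | hN
    · exact hpow V G p hn hp hp1.le hdeg' (hN4 _ hN)
        -- Exchanging the roles of the two sets, the exponents (k, k + 1) bound the number of poor
        -- vertices by order p^(k+1) n for sets of order p^k n, as `gad_power` requires.
        (h'.symm.lowerReg hp hε.le hε8 (hN.trans (scale_le hp.le hp1.le hε.le (by omega))))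
        (h.lowerReg hp hε.le hε8 hN) (h.upperReg hp.le hε.le (by linarith))
    · rcases h.almost_complete hp hp1.le hε hε8 hN hn with hc | ⟨h1, h2, h3, h4⟩
      · exact containsHamiltonCyclePower_of_complete hc
      · exact hpow V G 1 hn one_pos le_rfl (fun v => hdense v (h2 v))
          (by rw [one_pow]; linarith) (h3 _ _) (h3 _ _) (h4 _ _)

end HamPow

theorem theorem1p2 (k : ℕ) (hk : 2 ≤ k) (β : ℝ) (hβ : 0 < β) :
    ∃ ε : ℝ, 0 < ε ∧
      ∀ (V : Type*) [Fintype V] (G : SimpleGraph V) [DecidableRel G.Adj] (p : ℝ),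
        3 ≤ Fintype.card V → 0 < p → p < 1 →
        β * p * (Fintype.card V : ℝ) ≤ (G.minDegree : ℝ) →
        (IsPseudorandom G ε p 1 2 → ContainsHamiltonCyclePower G 2) ∧
        (IsPseudorandom G ε p (k - 1) (2 * k - 1) → IsPseudorandom G ε p k (k + 1) →
          ContainsHamiltonCyclePower G k) :=
  HamPow.exists_hamiltonCyclePower k hk β hβ
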